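/- Let $d\in\mathbb N$ and $0<T<\infty$. A \emph{time weight} on $(0,T)$ is a smooth function $a:(0,T)\to(0,\infty)$ with $\int_0^t a(s)^{-1}\,ds<\infty$ for every $t\in(0,T)$. For every time weight $a_0$ there is a time weight $a_1$ (depending only on $d,T,a_0$) such that the following holds. Let $u_0\in bmo(\mathbb R^d)^d$ and let $f=(f_{ij})$ be a $d\times d$ tensor field on $\mathbb R^d\times(0,T)$ such that \[ a_0 f\in C^\infty\big((0,T)\times\mathbb R^d\big),\qquad \sup_{0<t<T}\|a_0(t)f_{ij}(\cdot,t)\|_{BMO(\mathbb R^d)}<\infty\quad (1\le i,j\le d), \] and such that $f(\cdot,t)$ is real-analytic for every $t\in(0,T)$, locally uniformly: every $(x_0,t_0)\in\mathbb R^d\times(0,T)$ has a neighbourhood on which $|\nabla_x^n f_{ij}(x,t)|\le C R^n n!$ for all $n\ge 0$, with constants $C,R$ independent of $n$ and of $(x,t)$ in that neighbourhood. Put, with $(\nabla\cdot f)_i=\sum_j\partial_jf_{ij}$, \[ u(t)=e^{t\Delta}u_0+\int_0^t\nabla\cdot e^{(t-s)\Delta}f(s)\,ds,\qquad 0<t<T,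 \] where $e^{t\Delta}$ is convolution with the Gauss--Weierstrass kernel. Then all integrals and derivatives in this formula exist; $u$ is a classical solution of $\partial_tu-\Delta u=\nabla\cdot f$ in $\mathbb R^d\times(0,T)$, and $u(t)\to u_0$ in the sense of distributions as $t\to0^+$; $u(\cdot,t)$ is real-analytic on $\mathbb R^d$ for every $t\in(0,T)$; and \[ a_1u\in C^\infty\big((0,T)\times\mathbb R^d\big)^d,\qquad \sup_{0<t<T}\|a_1(t)u(t)\|_{L^\infty(\mathbb R^d)}<\infty . \] -/

import Mathlib

open MeasureTheory Set Filter Topology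
open scoped ENNReal ContDiff

noncomputable section

/-- The space `ℝ^d` with its Euclidean norm. -/
abbrev Space (d : ℕ) : Type := EuclideanSpace ℝ (Fin d)

/-- The average over the ball `B(x, r)` of `|g - g_B|`, where `g_B` is the average of `g` over
that ball. -/
def meanOsc {d : ℕ} (g : Space d → ℝ) (x : Space d) (r : ℝ) : ℝ≥0∞ :=
  ⨍⁻ y in Metric.ball x r, ‖g y - ⨍ z in Metric.ball x r, g z ∂volume‖ₑ ∂volume

/-- The `BMO(ℝ^d)` seminorm: the supremum of the mean oscillation over all balls. -/
def bmoSeminorm {d : ℕ} (g : Space d → ℝ) : ℝ≥0∞ :=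
  ⨆ (x : Space d) (r : ℝ) (_ : 0 < r), meanOsc g x r

/-- The norm of the local space `bmo(ℝ^d)`: mean oscillation over balls of radius less than one,
mean absolute value over balls of radius at least one. -/
def localBMONorm {d : ℕ} (g : Space d → ℝ) : ℝ≥0∞ :=
  (⨆ (x : Space d) (r : ℝ) (_ : 0 < r) (_ : r < 1), meanOsc g x r) +
    ⨆ (x : Space d) (r : ℝ) (_ : 1 ≤ r), ⨍⁻ y in Metric.ball x r, ‖g y‖ₑ ∂volume

/-- `g ∈ bmo(ℝ^d)`. -/
def MemLocalBMO {d : ℕ} (g : Space d → ℝ) : Prop :=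
  LocallyIntegrable g volume ∧ localBMONorm g < ⊤

/-- `j`-th partial derivative. -/
def partialDeriv {d : ℕ} (j : Fin d) (g : Space d → ℝ) (x : Space d) : ℝ :=
  fderiv ℝ g x (EuclideanSpace.single j 1)

/-- The Gauss-Weierstrass kernel `(4πt)^{-d/2} exp(-|x|²/(4t))`, used for `t > 0`. -/
def heatKernel {d : ℕ} (t : ℝ) (x : Space d) : ℝ :=
  (4 * Real.pi * t) ^ (-(d : ℝ) / 2) * Real.exp (-‖x‖ ^ 2 / (4 * t))

/-- The heat semigroup `e^{tΔ} g`, used for `t > 0`. -/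
def heatSemigroup {d : ℕ} (t : ℝ) (g : Space d → ℝ) (x : Space d) : ℝ :=
  ∫ y, heatKernel t (x - y) * g y

/-- The row-wise divergence of a tensor field: `(∇ · f)_i = ∑_j ∂_j f_{ij}`. -/
def tensorDiv {d : ℕ} (f : Space d → Matrix (Fin d) (Fin d) ℝ) (x : Space d) : Space d :=
  WithLp.toLp 2 fun i => ∑ j, partialDeriv j (fun y => f y i j) x

/-- The Duhamel formula `e^{tΔ} u₀ + ∫_0^t ∇ · e^{(t-s)Δ} f(s) ds`. -/
def duhamel {d : ℕ} (u₀ : Space d → Space d) (f : ℝ → Space d → Matrix (Fin d) (Fin d) ℝ)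
    (t : ℝ) (x : Space d) : Space d :=
  WithLp.toLp 2 fun i =>
    heatSemigroup t (fun y => u₀ y i) x +
      ∫ s in (0 : ℝ)..t, ∑ j, partialDeriv j (heatSemigroup (t - s) (fun y => f s y i j)) x

/-- Every integral and derivative in the Duhamel formula exists, for all times in `(0, T)`. -/
def DuhamelWellDefined {d : ℕ} (T : ℝ) (u₀ : Space d → Space d)
    (f : ℝ → Space d → Matrix (Fin d) (Fin d) ℝ) : Prop :=
  (∀ t ∈ Ioo 0 T, ∀ x i, Integrable fun y => heatKernel t (x - y) * u₀ y i) ∧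
  (∀ s ∈ Ioo 0 T, ∀ τ : ℝ, 0 < τ → ∀ x i j, Integrable fun y => heatKernel τ (x - y) * f s y i j) ∧
  (∀ s ∈ Ioo 0 T, ∀ τ : ℝ, 0 < τ → ∀ i j, Differentiable ℝ (heatSemigroup τ fun y => f s y i j)) ∧
  (∀ t ∈ Ioo 0 T, ∀ x i j, IntervalIntegrable
    (fun s => partialDeriv j (heatSemigroup (t - s) fun y => f s y i j) x) volume 0 t)

/-- Time weights on `(0, T)`: smooth positive functions, possibly degenerate at the end points,
whose reciprocal is integrable near `0`. -/
def IsTimeWeight (T : ℝ) (a : ℝ → ℝ) : Prop :=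
  ContDiffOn ℝ ∞ a (Ioo 0 T) ∧ (∀ t ∈ Ioo 0 T, 0 < a t) ∧
    ∀ t ∈ Ioo 0 T, IntegrableOn (fun s => (a s)⁻¹) (Ioo 0 t) volume

/-- `g(·, t)` is real-analytic for every `t ∈ (0, T)`, locally uniformly in `(x, t)`: the Cauchy
estimates for its spatial derivatives hold with constants that can be chosen uniform near every
point of `(0, T) × ℝ^d`. -/
def SpaceAnalytic {d : ℕ} (T : ℝ) (g : ℝ → Space d → ℝ) : Prop :=
  ∀ t₀ ∈ Ioo 0 T, ∀ x₀ : Space d, ∃ C R : ℝ, ∀ᶠ p in 𝓝 (t₀, x₀),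
    ∀ n : ℕ, ‖iteratedFDeriv ℝ n (g p.1) p.2‖ ≤ C * R ^ n * n.factorial

/-- `u` is a classical solution of `∂_t u - Δu = ∇ · f` in `ℝ^d × (0, T)`, with initial value `u₀`
attained in the sense of distributions. -/
def SolvesHeat {d : ℕ} (T : ℝ) (u₀ : Space d → Space d)
    (f : ℝ → Space d → Matrix (Fin d) (Fin d) ℝ) (u : ℝ → Space d → Space d) : Prop :=
  (∀ t ∈ Ioo 0 T, ContDiff ℝ 2 (u t)) ∧
  (∀ t ∈ Ioo 0 T, ∀ x,
    HasDerivAt (fun τ => u τ x) (Laplacian.laplacian (u t) x + tensorDiv (f t) x) t) ∧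
  ∀ (i : Fin d) (φ : Space d → ℝ), ContDiff ℝ ∞ φ → HasCompactSupport φ →
    Tendsto (fun t => ∫ x, u t x i * φ x) (𝓝[>] 0) (𝓝 (∫ x, u₀ x i * φ x))

end

/-!
The Duhamel formula solves the heat equation in a weak sense and regularity theory for the heat
operator does the rest.

*Size.* Let `b = 1 / a₀`. The heat kernel at time `t` sees oscillations at scale `√t` only, and the
mean oscillation of `f(s)` is at most a multiple of `b(s)`. Summation over dyadic balls gives
`|∇ e^{(t-s)Δ} f(s)| ≤ C (t - s)^{-1/2} b(s)` (`exists_fderiv_heatSemigroup_le`) and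
`|e^{tΔ} u₀| ≤ C (1 + t^{-1/2})` for `u₀` in `bmo` (`exists_heatSemigroup_le`). Hence
`|u(t)| ≤ C (1 + t^{-1/2} + ∫₀ᵗ (t - s)^{-1/2} b(s) ds)`. The right-hand side is continuous on
`(0, T)` and, the last term being a convolution of integrable functions, integrable near `0`. The
weight `a₁` is the reciprocal of a smooth majorant of it, so `a₁` depends on `a₀` only
(`IsTimeDensity.exists_isTimeWeight`).

*Weak solution.* The heat kernel is a fundamental solution (`integral_heatKernel_mul_heatOp`): after
parabolic scaling, `t ↦ ∫ K(t, x) φ(t, x) dx` becomes a mean against a fixed Gaussian and can be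
differentiated. By Fubini, `e^{tΔ} u₀` and the Duhamel integral satisfy the weak formulation of the
heat equation (`IsDuhamelSource.integral_duhamelTerm_mul_heatOp`), and the latter vanishes as
`t → 0` when tested against a fixed function, because the derivative can be moved to that function.

*Smoothness.* A continuous weak solution with smooth right-hand side is smooth and solves the
equation classically (`contDiffOn_of_weak_solution`). The heat kernel, extended by zero to
nonpositive times, is smooth away from the origin of space-time, so that a cutoff makes it a
compactly supported parametrix with smooth error, and convolution with the parametrix represents the
solution locally by smooth functions.

*Analyticity.* The maximum principle, applied to the odd part of a solution under reflection in a
hyperplane and an explicit supersolution, gives the interior gradient estimate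
`|∂_e v| ≤ (d + 1) M / r + N r / 2` in terms of bounds `M` for `v` and `N` for the right-hand side on
a ball of radius `r` (`abs_spaceDeriv_le`). Spatial derivatives commute with the heat operator, so
the estimate can be iterated, the `k`-th step using the `k`-th part of the distance to the boundary.
Together with the Cauchy estimates for `f` this yields Cauchy estimates for `u`
(`exists_cauchy_estimate`), which mean that `u(t)` is analytic.
-/

/-! ### The heat kernel -/

lemma heatKernel_nonneg {d : ℕ} {t : ℝ} (ht : 0 ≤ t) (z : Space d) : 0 ≤ heatKernel t z := by
  unfold heatKernel
  positivity

lemma heatKernel_neg {d : ℕ} (t : ℝ) (z : Space d) : heatKernel t (-z) = heatKernel t z := by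
  simp [heatKernel]

lemma heatKernel_sub_comm {d : ℕ} (t : ℝ) (x y : Space d) :
    heatKernel t (x - y) = heatKernel t (y - x) := by
  rw [← heatKernel_neg, neg_sub]

lemma measurable_heatKernel {d : ℕ} : Measurable fun p : ℝ × Space d => heatKernel p.1 p.2 := by
  unfold heatKernel
  fun_prop

lemma contDiffOn_heatKernel {d : ℕ} :
    ContDiffOn ℝ ∞ (fun p : ℝ × Space d => heatKernel p.1 p.2) (Ioi 0 ×ˢ univ) := by
  unfold heatKernel
  have h : ∀ p ∈ (Ioi (0 : ℝ) ×ˢ (univ : Set (Space d))), p.1 ≠ 0 := fun p hp => (mem_Ioi.1 hp.1).ne'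
  refine ContDiffOn.mul ?_ ?_
  · refine ContDiffOn.rpow_const_of_ne (by fun_prop) fun p hp => ?_
    have := h p hp
    positivity
  · refine Real.contDiff_exp.comp_contDiffOn ?_
    refine ContDiffOn.div ?_ (by fun_prop) fun p hp => mul_ne_zero four_ne_zero (h p hp)
    exact ((contDiff_snd.norm_sq ℝ).neg).contDiffOn

lemma continuousOn_heatKernel {d : ℕ} :
    ContinuousOn (fun p : ℝ × Space d => heatKernel p.1 p.2) (Ioi 0 ×ˢ univ) :=
  contDiffOn_heatKernel.continuousOn

lemma continuous_heatKernel {d : ℕ} (t : ℝ) : Continuous (heatKernel t : Space d → ℝ) := by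
  unfold heatKernel
  fun_prop

lemma integral_heatKernel {d : ℕ} {t : ℝ} (ht : 0 < t) : ∫ z : Space d, heatKernel t z = 1 := by
  unfold heatKernel
  rw [integral_const_mul]
  have h := GaussianFourier.integral_rexp_neg_mul_sq_norm (V := Space d)
    (b := 1 / (4 * t)) (by positivity)
  have h2 : ∀ v : Space d, -‖v‖ ^ 2 / (4 * t) = -(1 / (4 * t)) * ‖v‖ ^ 2 := fun v => by ring
  simp_rw [h2, h]
  rw [finrank_euclideanSpace_fin, show Real.pi / (1 / (4 * t)) = 4 * Real.pi * t by field_simp,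
    ← Real.rpow_add (by positivity)]
  rw [show -(d : ℝ) / 2 + d / 2 = 0 by ring, Real.rpow_zero]

lemma integrable_heatKernel {d : ℕ} {t : ℝ} (ht : 0 < t) :
    Integrable (heatKernel t : Space d → ℝ) := by
  by_contra h
  have := integral_heatKernel (d := d) ht
  rw [integral_undef h] at this
  exact zero_ne_one this

/-- The derivative of the heat kernel in the direction `e`. -/
noncomputable def heatKernelDir {d : ℕ} (e : Space d) (t : ℝ) (z : Space d) : ℝ :=
  -(inner ℝ z e / (2 * t)) * heatKernel t z

lemma hasFDerivAt_heatKernel {d : ℕ} {t : ℝ} (ht : 0 < t) (z : Space d) :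
    HasFDerivAt (heatKernel t) ((-(1 / (2 * t)) * heatKernel t z) • innerSL ℝ z) z := by
  have h1 : HasFDerivAt (fun z : Space d => -‖z‖ ^ 2 / (4 * t))
      ((-(1 / (4 * t))) • (2 • innerSL ℝ z)) z := by
    have := ((hasStrictFDerivAt_norm_sq z).hasFDerivAt).const_mul (-(1 / (4 * t)))
    refine this.congr_of_eventuallyEq (Eventually.of_forall fun y => ?_)
    ring
  have h2 := (h1.exp).const_mul ((4 * Real.pi * t) ^ (-(d : ℝ) / 2))
  refine h2.congr_fderiv ?_
  ext e
  simp [heatKernel]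
  field_simp
  ring

lemma fderiv_heatKernel_apply {d : ℕ} {t : ℝ} (ht : 0 < t) (z e : Space d) :
    fderiv ℝ (heatKernel t) z e = heatKernelDir e t z := by
  rw [(hasFDerivAt_heatKernel ht z).fderiv]
  simp [heatKernelDir]
  ring

lemma measurable_heatKernelDir {d : ℕ} (e : Space d) :
    Measurable fun p : ℝ × Space d => heatKernelDir e p.1 p.2 := by
  unfold heatKernelDir
  have := measurable_heatKernel (d := d)
  fun_prop

lemma continuousOn_heatKernelDir {d : ℕ} (e : Space d) :
    ContinuousOn (fun p : ℝ × Space d => heatKernelDir e p.1 p.2) (Ioi 0 ×ˢ univ) := by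
  unfold heatKernelDir
  refine ContinuousOn.mul (ContinuousOn.neg (ContinuousOn.div (by fun_prop) (by fun_prop)
    fun p hp => mul_ne_zero two_ne_zero (mem_Ioi.1 hp.1).ne')) continuousOn_heatKernel

lemma pow_mul_exp_neg_sq_le (m : ℕ) {c : ℝ} (hc : 0 < c) :
    ∃ C, 0 ≤ C ∧ ∀ r : ℝ, 0 ≤ r → (1 + r) ^ m * Real.exp (-(c * r ^ 2)) ≤ C := by
  refine ⟨m.factorial * Real.exp (1 + 1 / (4 * c)), by positivity, fun r hr => ?_⟩
  have h1 : (1 + r) ^ m ≤ m.factorial * Real.exp (1 + r) := by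
    have := Real.pow_div_factorial_le_exp (1 + r) (by positivity) m
    rwa [div_le_iff₀' (by positivity)] at this
  calc (1 + r) ^ m * Real.exp (-(c * r ^ 2))
      ≤ (m.factorial * Real.exp (1 + r)) * Real.exp (-(c * r ^ 2)) := by gcongr
    _ = m.factorial * Real.exp (1 + r - c * r ^ 2) := by
        rw [mul_assoc, ← Real.exp_add]; ring_nf
    _ ≤ _ := by
        gcongr
        have : 1 + 1 / (4 * c) - (1 + r - c * r ^ 2) = c * (r - 1 / (2 * c)) ^ 2 := by
          field_simp; ring
        nlinarith [mul_nonneg hc.le (sq_nonneg (r - 1 / (2 * c)))]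

/-- Half of the Gaussian decay is traded for a factor that is bounded by the other half. -/
lemma heatKernel_eq_two_mul {d : ℕ} {t : ℝ} (ht : 0 < t) (z : Space d) :
    heatKernel t z =
      2 ^ ((d : ℝ) / 2) * Real.exp (-(‖z‖ ^ 2 / (8 * t))) * heatKernel (2 * t) z := by
  unfold heatKernel
  have h0 : (4 * Real.pi * (2 * t)) ^ (-(d : ℝ) / 2) =
      2 ^ (-(d : ℝ) / 2) * (4 * Real.pi * t) ^ (-(d : ℝ) / 2) := by
    rw [← Real.mul_rpow (by norm_num) (by have := Real.pi_pos; positivity)]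
    ring_nf
  rw [h0]
  have h1 : (2 : ℝ) ^ ((d : ℝ) / 2) * 2 ^ (-(d : ℝ) / 2) = 1 := by
    rw [← Real.rpow_add (by norm_num), show (d : ℝ) / 2 + -(d : ℝ) / 2 = 0 by ring, Real.rpow_zero]
  have h2 : Real.exp (-‖z‖ ^ 2 / (4 * t)) =
      Real.exp (-(‖z‖ ^ 2 / (8 * t))) * Real.exp (-‖z‖ ^ 2 / (4 * (2 * t))) := by
    rw [← Real.exp_add]
    congr 1
    field_simp
    ring
  rw [h2]
  linear_combination (-(4 * Real.pi * t) ^ (-(d : ℝ) / 2) * Real.exp (-(‖z‖ ^ 2 / (8 * t))) *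
    Real.exp (-‖z‖ ^ 2 / (4 * (2 * t)))) * h1

/-- Polynomial moments of the heat kernel are absorbed by doubling the time. -/
lemma pow_mul_heatKernel_le (d m : ℕ) (T : ℝ) :
    ∃ C, 0 ≤ C ∧ ∀ t, 0 < t → t ≤ T → ∀ z : Space d,
      (1 + ‖z‖) ^ m * heatKernel t z ≤ C * heatKernel (2 * t) z := by
  rcases le_or_gt T 0 with hT | hT
  · exact ⟨0, le_rfl, fun t h1 h2 => by linarith⟩
  obtain ⟨C, hC, h⟩ := pow_mul_exp_neg_sq_le m (c := 1 / (8 * T)) (by positivity)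
  refine ⟨2 ^ ((d : ℝ) / 2) * C, by positivity, fun t ht htT z => ?_⟩
  rw [heatKernel_eq_two_mul ht z]
  have hk := heatKernel_nonneg (t := 2 * t) (by positivity) z
  have h3 : (1 + ‖z‖) ^ m * Real.exp (-(‖z‖ ^ 2 / (8 * t))) ≤ C := by
    refine le_trans ?_ (h ‖z‖ (norm_nonneg z))
    gcongr
    rw [one_div_mul_eq_div]
    gcongr
  calc (1 + ‖z‖) ^ m * (2 ^ ((d : ℝ) / 2) * Real.exp (-(‖z‖ ^ 2 / (8 * t))) * heatKernel (2 * t) z)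
      = 2 ^ ((d : ℝ) / 2) * ((1 + ‖z‖) ^ m * Real.exp (-(‖z‖ ^ 2 / (8 * t)))) *
        heatKernel (2 * t) z := by ring
    _ ≤ _ := by gcongr

/-- A derivative of the heat kernel costs a factor `t^{-1/2}` and a doubling of the time. -/
lemma abs_heatKernelDir_le (d : ℕ) :
    ∃ C, 0 ≤ C ∧ ∀ t, 0 < t → ∀ e z : Space d,
      |heatKernelDir e t z| ≤ C * ‖e‖ * (√t)⁻¹ * heatKernel (2 * t) z := by
  obtain ⟨C, hC, h⟩ := pow_mul_exp_neg_sq_le 1 (c := 1 / 8) (by positivity)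
  refine ⟨2 ^ ((d : ℝ) / 2) * C, by positivity, fun t ht e z => ?_⟩
  have hst : 0 < √t := Real.sqrt_pos.2 ht
  have hk := heatKernel_nonneg (t := 2 * t) (by positivity) z
  have h3 : ‖z‖ / √t * Real.exp (-(‖z‖ ^ 2 / (8 * t))) ≤ C := by
    refine le_trans ?_ (h (‖z‖ / √t) (by positivity))
    rw [div_pow, Real.sq_sqrt ht.le, pow_one, show 1 / 8 * (‖z‖ ^ 2 / t) = ‖z‖ ^ 2 / (8 * t) by
      field_simp]
    gcongr
    linarith
  rw [heatKernelDir, abs_mul, abs_of_nonneg (heatKernel_nonneg ht.le z), abs_neg, abs_div,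
    abs_of_pos (by positivity : 0 < 2 * t), heatKernel_eq_two_mul ht z]
  have h4 : |inner ℝ z e| / (2 * t) ≤ ‖e‖ * (√t)⁻¹ * (‖z‖ / √t) := by
    have h5 : ‖e‖ * (√t)⁻¹ * (‖z‖ / √t) = ‖z‖ * ‖e‖ / t := by
      have := Real.mul_self_sqrt ht.le
      field_simp
      rw [Real.sq_sqrt ht.le]
      ring
    rw [h5, div_le_div_iff₀ (by positivity) ht]
    have := abs_real_inner_le_norm z e
    nlinarith [mul_le_mul_of_nonneg_right this ht.le, mul_nonneg (norm_nonneg z) (norm_nonneg e),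
      mul_nonneg (mul_nonneg (norm_nonneg z) (norm_nonneg e)) ht.le]
  calc _ ≤ (‖e‖ * (√t)⁻¹ * (‖z‖ / √t)) *
        (2 ^ ((d : ℝ) / 2) * Real.exp (-(‖z‖ ^ 2 / (8 * t))) * heatKernel (2 * t) z) := by gcongr
    _ = 2 ^ ((d : ℝ) / 2) * (‖z‖ / √t * Real.exp (-(‖z‖ ^ 2 / (8 * t)))) * ‖e‖ * (√t)⁻¹ *
        heatKernel (2 * t) z := by ring
    _ ≤ _ := by gcongr

/-! ### Polynomially decaying weights -/

/-- The weight `(1 + |z|)^{-(d+1)}`, which is integrable on `ℝ^d` and against which every function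
of bounded mean oscillation is integrable. -/
noncomputable def decay {d : ℕ} (z : Space d) : ℝ := ((1 + ‖z‖) ^ (d + 1))⁻¹

lemma decay_pos {d : ℕ} (z : Space d) : 0 < decay z := by
  unfold decay
  positivity

lemma decay_le_one {d : ℕ} (z : Space d) : decay z ≤ 1 := by
  unfold decay
  refine inv_le_one_of_one_le₀ (one_le_pow₀ ?_)
  linarith [norm_nonneg z]

lemma continuous_decay {d : ℕ} : Continuous (decay : Space d → ℝ) := by
  unfold decay
  refine Continuous.inv₀ (by fun_prop) fun z => ?_
  positivity

lemma decay_le_mul_decay_add {d : ℕ} (x z : Space d) :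
    decay x ≤ (1 + ‖z‖) ^ (d + 1) * decay (x + z) := by
  unfold decay
  rw [← div_eq_mul_inv, le_div_iff₀ (by positivity), inv_mul_le_iff₀ (by positivity), ← mul_pow]
  gcongr
  nlinarith [norm_add_le x z, norm_nonneg x, norm_nonneg z]

/-- The heat kernel is dominated by the weight rescaled to the parabolic length `√t`. -/
lemma heatKernel_le_decay (d : ℕ) :
    ∃ C, 0 ≤ C ∧ ∀ t, 0 < t → ∀ z : Space d,
      heatKernel t z ≤ C * ((√t) ^ d)⁻¹ * decay ((√t)⁻¹ • z) := by
  obtain ⟨C, hC, h⟩ := pow_mul_exp_neg_sq_le (d + 1) (c := 1 / 4) (by positivity)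
  refine ⟨(4 * Real.pi) ^ (-(d : ℝ) / 2) * C, by positivity, fun t ht z => ?_⟩
  have hst : 0 < √t := Real.sqrt_pos.2 ht
  have h1 : t ^ (-(d : ℝ) / 2) = ((√t) ^ d)⁻¹ := by
    rw [Real.sqrt_eq_rpow, ← Real.rpow_natCast, ← Real.rpow_mul ht.le, ← Real.rpow_neg ht.le]
    congr 1
    ring
  have h2 : Real.exp (-‖z‖ ^ 2 / (4 * t)) ≤ C * decay ((√t)⁻¹ • z) := by
    unfold decay
    rw [← div_eq_mul_inv, le_div_iff₀ (by positivity), mul_comm]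
    refine le_of_eq_of_le ?_ (h ‖(√t)⁻¹ • z‖ (norm_nonneg _))
    congr 3
    rw [norm_smul, norm_inv, Real.norm_of_nonneg hst.le, mul_pow, inv_pow, Real.sq_sqrt ht.le]
    field_simp
  unfold heatKernel
  rw [Real.mul_rpow (by positivity) ht.le, h1]
  calc _ ≤ (4 * Real.pi) ^ (-(d : ℝ) / 2) * ((√t) ^ d)⁻¹ * (C * decay ((√t)⁻¹ • z)) := by gcongr
    _ = _ := by ring

/-- A weight on the starting point of a heat kernel can be moved to its end point. -/
lemma decay_mul_heatKernel_le (d : ℕ) (T : ℝ) :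
    ∃ C, 0 ≤ C ∧ ∀ t, 0 < t → t ≤ T → ∀ x y : Space d,
      decay x * heatKernel t (x - y) ≤ C * heatKernel (2 * t) (x - y) * decay y := by
  obtain ⟨C, hC, h⟩ := pow_mul_heatKernel_le d (d + 1) T
  refine ⟨C, hC, fun t ht htT x y => ?_⟩
  have h1 := decay_le_mul_decay_add x (y - x)
  rw [add_sub_cancel, norm_sub_rev] at h1
  have h2 := h t ht htT (x - y)
  have hk := heatKernel_nonneg ht.le (x - y)
  calc decay x * heatKernel t (x - y)
      ≤ ((1 + ‖x - y‖) ^ (d + 1) * decay y) * heatKernel t (x - y) := by gcongr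
    _ = ((1 + ‖x - y‖) ^ (d + 1) * heatKernel t (x - y)) * decay y := by ring
    _ ≤ _ := by gcongr; exact (decay_pos y).le

/-- On compact time intervals in `(0, ∞)` and for bounded `x` the heat kernel and its first
derivatives are dominated by the weight. -/
lemma heatKernel_le_decay_of_compact (d : ℕ) {a b ρ : ℝ} (ha : 0 < a) :
    ∃ C, 0 ≤ C ∧ ∀ t ∈ Icc a b, ∀ x y : Space d, ‖x‖ ≤ ρ →
      heatKernel t (x - y) ≤ C * decay y ∧
      ∀ e : Space d, |heatKernelDir e t (x - y)| ≤ C * ‖e‖ * decay y := by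
  obtain ⟨C₁, hC₁, h₁⟩ := decay_mul_heatKernel_le d (2 * b)
  obtain ⟨C₂, hC₂, h₂⟩ := heatKernel_le_decay d
  obtain ⟨C₃, hC₃, h₃⟩ := abs_heatKernelDir_le d
  have hsa : 0 < √a := Real.sqrt_pos.2 ha
  have key : ∃ C, 0 ≤ C ∧ ∀ t, a ≤ t → t ≤ 2 * b → ∀ x y : Space d, ‖x‖ ≤ ρ →
      heatKernel t (x - y) ≤ C * decay y := by
    refine ⟨(1 + |ρ|) ^ (d + 1) * (C₁ * (C₂ * ((√a) ^ d)⁻¹)), by positivity,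
      fun t hta htb x y hx => ?_⟩
    have ht : 0 < t := ha.trans_le hta
    have hk : heatKernel (2 * t) (x - y) ≤ C₂ * ((√a) ^ d)⁻¹ := by
      refine (h₂ (2 * t) (by positivity) _).trans ?_
      have : decay ((√(2 * t))⁻¹ • (x - y)) ≤ 1 := decay_le_one _
      calc _ ≤ C₂ * ((√(2 * t)) ^ d)⁻¹ * 1 := by gcongr
        _ ≤ _ := by
          rw [mul_one]
          gcongr
          linarith
    have hd : 1 ≤ (1 + |ρ|) ^ (d + 1) * decay x := by
      unfold decay
      rw [← div_eq_mul_inv, one_le_div (by positivity)]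
      gcongr
      exact hx.trans (le_abs_self ρ)
    have hy := decay_pos y
    have hk0 := heatKernel_nonneg ht.le (x - y)
    calc heatKernel t (x - y) ≤ ((1 + |ρ|) ^ (d + 1) * decay x) * heatKernel t (x - y) :=
          le_mul_of_one_le_left hk0 hd
      _ = (1 + |ρ|) ^ (d + 1) * (decay x * heatKernel t (x - y)) := by ring
      _ ≤ (1 + |ρ|) ^ (d + 1) * (C₁ * heatKernel (2 * t) (x - y) * decay y) :=
          mul_le_mul_of_nonneg_left (h₁ t ht htb x y) (by positivity)
      _ ≤ (1 + |ρ|) ^ (d + 1) * (C₁ * (C₂ * ((√a) ^ d)⁻¹) * decay y) := by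
          gcongr
      _ = _ := by ring
  obtain ⟨C, hC, h⟩ := key
  refine ⟨max C (C₃ * (√a)⁻¹ * C), le_max_of_le_left hC, fun t ht x y hx => ⟨?_, fun e => ?_⟩⟩
  · have ht0 : 0 < t := ha.trans_le ht.1
    refine (h t ht.1 (by linarith [ht.2]) x y hx).trans ?_
    gcongr
    · exact (decay_pos y).le
    · exact le_max_left _ _
  · have ht0 : 0 < t := ha.trans_le ht.1
    have hy := (decay_pos y).le
    have h4 := h (2 * t) (by linarith [ht.1]) (by linarith [ht.2]) x y hx
    calc _ ≤ C₃ * ‖e‖ * (√t)⁻¹ * heatKernel (2 * t) (x - y) := h₃ t ht0 e _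
      _ ≤ C₃ * ‖e‖ * (√a)⁻¹ * (C * decay y) := by
          gcongr
          · exact heatKernel_nonneg (by positivity) _
          · exact ht.1
      _ = (C₃ * (√a)⁻¹ * C) * ‖e‖ * decay y := by ring
      _ ≤ _ := by gcongr; exact le_max_right _ _

lemma heatKernel_sqrt_smul {d : ℕ} {t : ℝ} (ht : 0 < t) (z : Space d) :
    heatKernel t (√t • z) = ((√t) ^ d)⁻¹ * heatKernel 1 z := by
  have h1 : t ^ (-(d : ℝ) / 2) = ((√t) ^ d)⁻¹ := by
    rw [Real.sqrt_eq_rpow, ← Real.rpow_natCast, ← Real.rpow_mul ht.le, ← Real.rpow_neg ht.le]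
    congr 1
    ring
  have h2 : -‖√t • z‖ ^ 2 / (4 * t) = -‖z‖ ^ 2 / (4 * 1) := by
    rw [norm_smul, Real.norm_of_nonneg (Real.sqrt_nonneg t), mul_pow, Real.sq_sqrt ht.le]
    field_simp
  unfold heatKernel
  rw [h2, Real.mul_rpow (by positivity) ht.le, h1, mul_one]
  ring_nf

/-- Parabolic scaling turns every heat kernel into the one at time `1`. -/
lemma integral_heatKernel_mul_eq_scaled {d : ℕ} {t : ℝ} (ht : 0 < t) (ψ : Space d → ℝ) :
    ∫ z, heatKernel t z * ψ z = ∫ z, heatKernel 1 z * ψ (√t • z) := by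
  have hst : 0 < √t := Real.sqrt_pos.2 ht
  have h := Measure.integral_comp_smul_of_nonneg (volume : Measure (Space d))
    (fun z => heatKernel t z * ψ z) (√t) (hR := hst.le)
  simp only [heatKernel_sqrt_smul ht, mul_assoc, integral_const_mul, finrank_euclideanSpace_fin,
    smul_eq_mul] at h
  exact (mul_left_cancel₀ (by positivity) h).symm

lemma integrable_decay {d : ℕ} : Integrable (decay : Space d → ℝ) := by
  have h := integrable_one_add_norm (E := Space d) (μ := volume) (r := d + 1)
    (by rw [finrank_euclideanSpace_fin]; linarith)
  refine h.congr (Eventually.of_forall fun z => ?_)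
  simp only [decay]
  rw [Real.rpow_neg (by positivity), ← Real.rpow_natCast]
  push_cast
  rfl

/-! ### The heat semigroup on functions of moderate growth -/

/-- Functions that are integrable against the weight `decay`. This class contains the functions of
bounded mean oscillation, and the heat semigroup is well behaved on it. -/
def HeatIntegrable {d : ℕ} (g : Space d → ℝ) : Prop := Integrable fun y => decay y * g y

namespace HeatIntegrable

variable {d : ℕ} {g h : Space d → ℝ}

lemma aestronglyMeasurable (hg : HeatIntegrable g) : AEStronglyMeasurable g := by
  have h1 : Continuous fun y : Space d => (decay y)⁻¹ :=
    continuous_decay.inv₀ fun y => (decay_pos y).ne'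
  refine (h1.aestronglyMeasurable.mul hg.1).congr (Eventually.of_forall fun y => ?_)
  simp only [Pi.mul_apply]
  rw [inv_mul_cancel_left₀ (decay_pos y).ne']

lemma const (c : ℝ) : HeatIntegrable fun _ : Space d => c := integrable_decay.mul_const c

lemma sub (hg : HeatIntegrable g) (hh : HeatIntegrable h) : HeatIntegrable fun y => g y - h y := by
  refine (Integrable.sub hg hh).congr (Eventually.of_forall fun y => ?_)
  simp only [Pi.sub_apply]
  ring

lemma integrable_of_le_decay (hg : HeatIntegrable g) {k : Space d → ℝ} {C : ℝ}
    (hk : AEStronglyMeasurable k) (hkC : ∀ y, |k y| ≤ C * decay y) :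
    Integrable fun y => k y * g y := by
  refine (hg.norm.const_mul C).mono' (hk.mul hg.aestronglyMeasurable)
    (Eventually.of_forall fun y => ?_)
  rw [norm_mul, norm_mul, Real.norm_eq_abs, Real.norm_of_nonneg (decay_pos y).le, ← mul_assoc]
  gcongr
  exact hkC y

lemma integrable_heatKernel_mul (hg : HeatIntegrable g) {t : ℝ} (ht : 0 < t) (x : Space d) :
    Integrable fun y => heatKernel t (x - y) * g y := by
  obtain ⟨C, -, h⟩ := heatKernel_le_decay_of_compact d (a := t) (b := t) (ρ := ‖x‖) ht
  refine hg.integrable_of_le_decay (C := C)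
    ((continuous_heatKernel t).comp (by fun_prop)).aestronglyMeasurable fun y => ?_
  rw [abs_of_nonneg (heatKernel_nonneg ht.le _)]
  exact (h t ⟨le_rfl, le_rfl⟩ x y le_rfl).1

lemma hasFDerivAt_heatSemigroup (hg : HeatIntegrable g) {t : ℝ} (ht : 0 < t) (x : Space d) :
    Integrable (fun y => g y • fderiv ℝ (heatKernel t) (x - y)) ∧
    HasFDerivAt (heatSemigroup t g) (∫ y, g y • fderiv ℝ (heatKernel t) (x - y)) x := by
  obtain ⟨C, hC, h⟩ := heatKernel_le_decay_of_compact d (a := t) (b := t) (ρ := ‖x‖ + 1) ht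
  have hcont : Continuous (fderiv ℝ (heatKernel t : Space d → ℝ)) := by
    have : fderiv ℝ (heatKernel t : Space d → ℝ) =
        fun z => (-(1 / (2 * t)) * heatKernel t z) • innerSL ℝ z :=
      funext fun z => (hasFDerivAt_heatKernel ht z).fderiv
    rw [this]
    have := continuous_heatKernel (d := d) t
    fun_prop
  have hbd : ∀ z ∈ Metric.ball x 1, ∀ y,
      ‖g y • fderiv ℝ (heatKernel t) (z - y)‖ ≤ C * ‖decay y * g y‖ := by
    intro z hz y
    have hz' : ‖z‖ ≤ ‖x‖ + 1 := by
      have := norm_le_norm_add_norm_sub' z x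
      rw [Metric.mem_ball, dist_eq_norm] at hz
      linarith
    have h3 : ‖fderiv ℝ (heatKernel t) (z - y)‖ ≤ C * decay y := by
      refine ContinuousLinearMap.opNorm_le_bound _ (mul_nonneg hC (decay_pos y).le) fun e => ?_
      rw [fderiv_heatKernel_apply ht, Real.norm_eq_abs]
      refine ((h t ⟨le_rfl, le_rfl⟩ z y hz').2 e).trans (le_of_eq (by ring))
    rw [norm_smul, norm_mul, Real.norm_of_nonneg (decay_pos y).le]
    calc _ ≤ ‖g y‖ * (C * decay y) := by gcongr
      _ = _ := by ring
  have hmeas : AEStronglyMeasurable (fun y => g y • fderiv ℝ (heatKernel t) (x - y)) :=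
    hg.aestronglyMeasurable.smul (hcont.comp (by fun_prop)).aestronglyMeasurable
  refine ⟨(hg.norm.const_mul C).mono' hmeas
    (Eventually.of_forall (hbd x (Metric.mem_ball_self one_pos))), ?_⟩
  unfold heatSemigroup
  refine hasFDerivAt_integral_of_dominated_of_fderiv_le (bound := fun y => C * ‖decay y * g y‖)
    (F' := fun z y => g y • fderiv ℝ (heatKernel t) (z - y))
    (Metric.ball_mem_nhds x one_pos) ?_ (hg.integrable_heatKernel_mul ht x) hmeas ?_
    (hg.norm.const_mul C) ?_
  · exact Eventually.of_forall fun z => (hg.integrable_heatKernel_mul ht z).1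
  · exact Eventually.of_forall fun y z hz => hbd z hz y
  · refine Eventually.of_forall fun y z _ => ?_
    have h1 := (hasFDerivAt_heatKernel ht (z - y)).differentiableAt.hasFDerivAt
    have h2 := h1.comp z ((hasFDerivAt_id z).sub_const y)
    refine (h2.mul_const (g y)).congr_fderiv ?_
    ext e
    simp

lemma differentiable_heatSemigroup (hg : HeatIntegrable g) {t : ℝ} (ht : 0 < t) :
    Differentiable ℝ (heatSemigroup t g) :=
  fun x => (hg.hasFDerivAt_heatSemigroup ht x).2.differentiableAt

lemma fderiv_heatSemigroup_apply (hg : HeatIntegrable g) {t : ℝ} (ht : 0 < t) (x e : Space d) :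
    fderiv ℝ (heatSemigroup t g) x e = ∫ y, heatKernelDir e t (x - y) * g y := by
  obtain ⟨h1, h2⟩ := hg.hasFDerivAt_heatSemigroup ht x
  rw [h2.fderiv, ContinuousLinearMap.integral_apply h1]
  refine integral_congr_ae (Eventually.of_forall fun y => ?_)
  simp [fderiv_heatKernel_apply ht, mul_comm]

/-- Convolutions with a kernel that is locally uniformly dominated by the weight are continuous in
space-time. -/
lemma continuousOn_integral (hg : HeatIntegrable g) {k : ℝ → Space d → ℝ}
    (hk : ContinuousOn (fun p : ℝ × Space d => k p.1 p.2) (Ioi 0 ×ˢ univ))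
    (hkb : ∀ a b ρ : ℝ, 0 < a → ∃ C, ∀ t ∈ Icc a b, ∀ x y : Space d, ‖x‖ ≤ ρ →
      |k t (x - y)| ≤ C * decay y) :
    ContinuousOn (fun p : ℝ × Space d => ∫ y, k p.1 (p.2 - y) * g y) (Ioi 0 ×ˢ univ) := by
  rintro ⟨t, x⟩ ⟨ht, -⟩
  replace ht : 0 < t := ht
  refine ContinuousAt.continuousWithinAt ?_
  obtain ⟨C, hC⟩ := hkb (t / 2) (2 * t) (‖x‖ + 1) (by positivity)
  have hev : ∀ᶠ p : ℝ × Space d in 𝓝 (t, x), p.1 ∈ Icc (t / 2) (2 * t) ∧ ‖p.2‖ ≤ ‖x‖ + 1 := by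
    have h1 : ∀ᶠ s in 𝓝 t, s ∈ Icc (t / 2) (2 * t) :=
      Icc_mem_nhds (by linarith) (by linarith)
    have h2 : ∀ᶠ z in 𝓝 x, ‖z‖ ≤ ‖x‖ + 1 :=
      continuous_norm.continuousAt.eventually_le_const (by linarith)
    exact (h1.prod_inl_nhds x).and (h2.prod_inr_nhds t)
  refine continuousAt_of_dominated (bound := fun y => C * ‖decay y * g y‖) ?_ ?_
    (hg.norm.const_mul C) ?_
  · filter_upwards [hev] with p hp
    refine AEStronglyMeasurable.mul ?_ hg.aestronglyMeasurable
    refine Continuous.aestronglyMeasurable ?_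
    refine hk.comp_continuous (f := fun y => (p.1, p.2 - y)) (by fun_prop) fun y => ?_
    exact ⟨by have := hp.1.1; simp only [mem_Ioi]; linarith, mem_univ _⟩
  · filter_upwards [hev] with p hp
    refine Eventually.of_forall fun y => ?_
    rw [norm_mul, norm_mul, Real.norm_of_nonneg (decay_pos y).le, ← mul_assoc]
    gcongr
    exact hC p.1 hp.1 p.2 y hp.2
  · refine Eventually.of_forall fun y => ContinuousAt.mul ?_ continuousAt_const
    have h1 : ContinuousAt (fun p : ℝ × Space d => k p.1 p.2) (t, x - y) :=
      hk.continuousAt ((isOpen_Ioi.prod isOpen_univ).mem_nhds ⟨ht, mem_univ _⟩)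
    exact ContinuousAt.comp (x := (t, x)) (f := fun p : ℝ × Space d => (p.1, p.2 - y)) h1
      (by fun_prop)

lemma continuousOn_heatSemigroup (hg : HeatIntegrable g) :
    ContinuousOn (fun p : ℝ × Space d => heatSemigroup p.1 g p.2) (Ioi 0 ×ˢ univ) := by
  refine hg.continuousOn_integral continuousOn_heatKernel fun a b ρ ha => ?_
  obtain ⟨C, -, h⟩ := heatKernel_le_decay_of_compact d (a := a) (b := b) (ρ := ρ) ha
  refine ⟨C, fun t ht x y hx => ?_⟩
  rw [abs_of_nonneg (heatKernel_nonneg (ha.le.trans ht.1) _)]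
  exact (h t ht x y hx).1

lemma continuousOn_fderiv_heatSemigroup (hg : HeatIntegrable g) (e : Space d) :
    ContinuousOn (fun p : ℝ × Space d => fderiv ℝ (heatSemigroup p.1 g) p.2 e)
      (Ioi 0 ×ˢ univ) := by
  refine (hg.continuousOn_integral (continuousOn_heatKernelDir e) fun a b ρ ha => ?_).congr
    fun p hp => hg.fderiv_heatSemigroup_apply hp.1 p.2 e
  obtain ⟨C, -, h⟩ := heatKernel_le_decay_of_compact d (a := a) (b := b) (ρ := ρ) ha
  exact ⟨C * ‖e‖, fun t ht x y hx => (h t ht x y hx).2 e⟩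

lemma heatSemigroup_sub_const (hg : HeatIntegrable g) {t : ℝ} (ht : 0 < t) (c : ℝ) (x : Space d) :
    heatSemigroup t (fun y => g y - c) x = heatSemigroup t g x - c := by
  unfold heatSemigroup
  simp_rw [mul_sub]
  rw [integral_sub (hg.integrable_heatKernel_mul ht x)
    ((HeatIntegrable.const c).integrable_heatKernel_mul ht x), integral_mul_const,
    integral_sub_left_eq_self (heatKernel t), integral_heatKernel ht, one_mul]

/-- Constants do not contribute to the derivatives of `e^{tΔ} g`. -/
lemma fderiv_heatSemigroup_sub_const (hg : HeatIntegrable g) {t : ℝ} (ht : 0 < t) (c : ℝ)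
    (x : Space d) :
    fderiv ℝ (heatSemigroup t fun y => g y - c) x = fderiv ℝ (heatSemigroup t g) x := by
  rw [funext (hg.heatSemigroup_sub_const ht c), fderiv_sub_const]

end HeatIntegrable

lemma integrable_heatKernel_slice {d : ℕ} {h : Space d → ℝ} (hh : Integrable h) {t : ℝ}
    (ht : 0 < t) :
    Integrable (fun q : Space d × Space d => heatKernel t (q.2 - q.1) * h q.1)
      (volume.prod volume) ∧
    ∫ q : Space d × Space d, ‖heatKernel t (q.2 - q.1) * h q.1‖ ∂(volume.prod volume) =
      ∫ y, ‖h y‖ := by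
  have hin : ∀ y : Space d, Integrable (fun x => heatKernel t (x - y)) :=
    fun y => (integrable_heatKernel ht).comp_sub_right y
  have hone : ∀ y : Space d, ∫ x, heatKernel t (x - y) = 1 := fun y => by
    rw [integral_sub_right_eq_self (heatKernel t), integral_heatKernel ht]
  have hnorm : ∀ y x : Space d, ‖heatKernel t (x - y) * h y‖ =
      heatKernel t (x - y) * ‖h y‖ := fun y x => by
    rw [norm_mul, Real.norm_of_nonneg (heatKernel_nonneg ht.le _)]
  have h1 : Integrable (fun q : Space d × Space d => heatKernel t (q.2 - q.1) * h q.1)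
      (volume.prod volume) := by
    refine (integrable_prod_iff ?_).2 ⟨?_, ?_⟩
    · refine AEStronglyMeasurable.mul ?_ hh.1.comp_fst
      exact ((continuous_heatKernel t).comp (by fun_prop)).aestronglyMeasurable
    · exact Eventually.of_forall fun y => (hin y).mul_const (h y)
    · simp_rw [hnorm, integral_mul_const, hone, one_mul]
      exact hh.norm
  refine ⟨h1, ?_⟩
  rw [integral_prod _ h1.norm]
  simp_rw [hnorm, integral_mul_const, hone, one_mul]

/-- Convolutions with the heat kernels are integrable over bounded time intervals. -/
lemma integrable_heatKernel_prod {d : ℕ} {h : Space d → ℝ} (hh : Integrable h) (R : ℝ) :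
    Integrable (fun q : ℝ × Space d × Space d => heatKernel (2 * q.1) (q.2.2 - q.2.1) * h q.2.1)
      ((volume.restrict (Ioc 0 R)).prod (volume.prod volume)) := by
  refine (integrable_prod_iff ?_).2 ⟨?_, ?_⟩
  · refine AEStronglyMeasurable.mul ?_ hh.1.comp_fst.comp_snd
    exact (measurable_heatKernel.comp (f := fun q : ℝ × Space d × Space d =>
      (2 * q.1, q.2.2 - q.2.1)) (by fun_prop)).aestronglyMeasurable
  · exact (ae_restrict_mem measurableSet_Ioc).mono fun t ht =>
      (integrable_heatKernel_slice hh (mul_pos two_pos ht.1)).1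
  · refine (integrable_const (∫ y, ‖h y‖)).congr ?_
    exact (ae_restrict_mem measurableSet_Ioc).mono fun t ht =>
      (integrable_heatKernel_slice hh (mul_pos two_pos ht.1)).2.symm

/-! ### Pairing the heat semigroup with test functions -/

namespace HeatIntegrable

variable {d : ℕ} {g : Space d → ℝ}

/-- The joint integrability that justifies exchanging the order of integration when `e^{tΔ} g` is
tested against a function on space-time. -/
lemma integrable_kernel_mul_pairing (hg : HeatIntegrable g) {ψ : ℝ × Space d → ℝ}
    (hψ : Continuous ψ) {M : ℝ} (hM : ∀ p, |ψ p| ≤ M * decay p.2) (R : ℝ) :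
    Integrable (fun q : ℝ × Space d × Space d =>
        heatKernel q.1 (q.2.2 - q.2.1) * g q.2.1 * ψ (q.1, q.2.2))
      ((volume.restrict (Ioc 0 R)).prod (volume.prod volume)) := by
  obtain ⟨C, hC, h⟩ := decay_mul_heatKernel_le d R
  have hM0 : 0 ≤ M := by
    have := (abs_nonneg _).trans (hM 0)
    exact nonneg_of_mul_nonneg_left this (decay_pos _)
  refine ((integrable_heatKernel_prod hg.norm R).const_mul (M * C)).mono' ?_ ?_
  · refine AEStronglyMeasurable.mul (AEStronglyMeasurable.mul ?_
      hg.aestronglyMeasurable.comp_fst.comp_snd) (hψ.comp (by fun_prop)).aestronglyMeasurable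
    exact (measurable_heatKernel.comp (f := fun q : ℝ × Space d × Space d =>
      (q.1, q.2.2 - q.2.1)) (by fun_prop)).aestronglyMeasurable
  · have hae : ∀ᵐ q ∂((volume.restrict (Ioc 0 R)).prod
        (volume.prod volume : Measure (Space d × Space d))), q.1 ∈ Ioc 0 R :=
      Measure.quasiMeasurePreserving_fst.ae (ae_restrict_mem measurableSet_Ioc)
    filter_upwards [hae] with q hq
    have hk := heatKernel_nonneg hq.1.le (q.2.2 - q.2.1)
    rw [norm_mul, norm_mul, Real.norm_of_nonneg hk, norm_mul, Real.norm_of_nonneg (decay_pos _).le]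
    calc heatKernel q.1 (q.2.2 - q.2.1) * ‖g q.2.1‖ * ‖ψ (q.1, q.2.2)‖
        ≤ heatKernel q.1 (q.2.2 - q.2.1) * ‖g q.2.1‖ * (M * decay q.2.2) := by
          gcongr
          exact hM (q.1, q.2.2)
      _ = M * ‖g q.2.1‖ * (decay q.2.2 * heatKernel q.1 (q.2.2 - q.2.1)) := by ring
      _ ≤ M * ‖g q.2.1‖ * (C * heatKernel (2 * q.1) (q.2.2 - q.2.1) * decay q.2.1) := by
          refine mul_le_mul_of_nonneg_left (h q.1 hq.1 hq.2 _ _) (by positivity)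
      _ = _ := by ring

end HeatIntegrable

/-- The heat semigroup preserves the decay of the weight, locally uniformly in time. -/
lemma abs_heatSemigroup_le_decay (d : ℕ) (T : ℝ) : ∃ C, 0 ≤ C ∧ ∀ (φ : Space d → ℝ) (M : ℝ),
    Continuous φ → (∀ x, |φ x| ≤ M * decay x) → ∀ t, 0 < t → t ≤ T → ∀ y,
      |heatSemigroup t φ y| ≤ C * M * decay y := by
  obtain ⟨C, hC, h⟩ := decay_mul_heatKernel_le d T
  refine ⟨C, hC, fun φ M hφ hM t ht htT y => ?_⟩
  have hM0 : 0 ≤ M := nonneg_of_mul_nonneg_left ((abs_nonneg _).trans (hM 0)) (decay_pos _)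
  have hi : Integrable fun x => heatKernel (2 * t) (y - x) :=
    (integrable_heatKernel (by positivity)).comp_sub_left y
  unfold heatSemigroup
  rw [← Real.norm_eq_abs]
  refine (norm_integral_le_of_norm_le (hi.const_mul (C * M * decay y))
    (Eventually.of_forall fun x => ?_)).trans (le_of_eq ?_)
  · have hk := heatKernel_nonneg ht.le (y - x)
    rw [norm_mul, Real.norm_of_nonneg hk]
    calc heatKernel t (y - x) * ‖φ x‖ ≤ heatKernel t (y - x) * (M * decay x) := by
          gcongr
          exact hM x
      _ = M * (decay x * heatKernel t (x - y)) := by rw [heatKernel_sub_comm t x y]; ring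
      _ ≤ M * (C * heatKernel (2 * t) (x - y) * decay y) :=
          mul_le_mul_of_nonneg_left (h t ht htT x y) hM0
      _ = _ := by rw [heatKernel_sub_comm (2 * t) x y]; ring
  · rw [integral_const_mul, integral_sub_left_eq_self (heatKernel (2 * t)),
      integral_heatKernel (by positivity), mul_one]

lemma exists_le_decay_of_hasCompactSupport {d : ℕ} {φ : Space d → ℝ} (hφ : Continuous φ)
    (hc : HasCompactSupport φ) : ∃ M, ∀ x, |φ x| ≤ M * decay x := by
  have h1 : Continuous fun x => (decay x)⁻¹ * φ x :=
    (continuous_decay.inv₀ fun y => (decay_pos y).ne').mul hφ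
  obtain ⟨M, hM⟩ := h1.bounded_above_of_compact_support hc.mul_left
  refine ⟨M, fun x => ?_⟩
  have := hM x
  rw [norm_mul, norm_inv, Real.norm_of_nonneg (decay_pos x).le, inv_mul_le_iff₀ (decay_pos x),
    mul_comm] at this
  exact this

/-- The heat semigroup converges to the identity pointwise on bounded continuous functions. -/
lemma tendsto_heatSemigroup {d : ℕ} {φ : Space d → ℝ} (hφ : Continuous φ) {M : ℝ}
    (hM : ∀ x, |φ x| ≤ M) (y : Space d) :
    Tendsto (fun t => heatSemigroup t φ y) (𝓝[>] 0) (𝓝 (φ y)) := by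
  have h1 : ∀ t, 0 < t → heatSemigroup t φ y = ∫ z, heatKernel 1 z * φ (y - √t • z) := by
    intro t ht
    rw [← integral_heatKernel_mul_eq_scaled ht fun z => φ (y - z)]
    unfold heatSemigroup
    rw [← integral_sub_left_eq_self (fun z => heatKernel t z * φ (y - z)) volume y]
    simp
  have h2 : φ y = ∫ z, heatKernel 1 z * φ (y - √0 • z) := by
    simp [integral_mul_const, integral_heatKernel]
  rw [h2]
  have h3 : Continuous fun t => ∫ z : Space d, heatKernel 1 z * φ (y - √t • z) := by
    refine continuous_of_dominated (bound := fun z => heatKernel 1 z * M) (fun t => ?_)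
      (fun t => Eventually.of_forall fun z => ?_) ((integrable_heatKernel one_pos).mul_const M)
      (Eventually.of_forall fun z => by fun_prop)
    · exact ((continuous_heatKernel 1).mul (by fun_prop)).aestronglyMeasurable
    · rw [norm_mul, Real.norm_of_nonneg (heatKernel_nonneg zero_le_one _)]
      gcongr
      · exact heatKernel_nonneg zero_le_one _
      · exact hM _
  refine (h3.continuousAt.tendsto.mono_left nhdsWithin_le_nhds).congr' ?_
  filter_upwards [self_mem_nhdsWithin] with t ht
  exact (h1 t ht).symm

namespace HeatIntegrable

variable {d : ℕ} {g : Space d → ℝ}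

/-- The heat semigroup is symmetric. -/
lemma integral_heatSemigroup_mul (hg : HeatIntegrable g) {φ : Space d → ℝ} (hφ : Continuous φ)
    {M : ℝ} (hM : ∀ x, |φ x| ≤ M * decay x) {t : ℝ} (ht : 0 < t) :
    ∫ x, heatSemigroup t g x * φ x = ∫ y, g y * heatSemigroup t φ y := by
  obtain ⟨C, hC, h⟩ := decay_mul_heatKernel_le d t
  have hM0 : 0 ≤ M := nonneg_of_mul_nonneg_left ((abs_nonneg _).trans (hM 0)) (decay_pos _)
  have hint : Integrable (fun q : Space d × Space d => heatKernel t (q.2 - q.1) * g q.1 * φ q.2)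
      (volume.prod volume) := by
    refine ((integrable_heatKernel_slice hg.norm (t := 2 * t) (by positivity)).1.const_mul
      (M * C)).mono' ?_ (Eventually.of_forall fun q => ?_)
    · refine AEStronglyMeasurable.mul (AEStronglyMeasurable.mul ?_
        hg.aestronglyMeasurable.comp_fst) (hφ.comp (by fun_prop)).aestronglyMeasurable
      exact ((continuous_heatKernel t).comp (by fun_prop)).aestronglyMeasurable
    · have hk := heatKernel_nonneg ht.le (q.2 - q.1)
      rw [norm_mul, norm_mul, Real.norm_of_nonneg hk, norm_mul,
        Real.norm_of_nonneg (decay_pos _).le]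
      calc heatKernel t (q.2 - q.1) * ‖g q.1‖ * ‖φ q.2‖
          ≤ heatKernel t (q.2 - q.1) * ‖g q.1‖ * (M * decay q.2) := by
            gcongr
            exact hM q.2
        _ = M * ‖g q.1‖ * (decay q.2 * heatKernel t (q.2 - q.1)) := by ring
        _ ≤ M * ‖g q.1‖ * (C * heatKernel (2 * t) (q.2 - q.1) * decay q.1) :=
            mul_le_mul_of_nonneg_left (h t ht le_rfl _ _) (by positivity)
        _ = _ := by ring
  calc ∫ x, heatSemigroup t g x * φ x
      = ∫ x, ∫ y, heatKernel t (x - y) * g y * φ x := by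
        unfold heatSemigroup
        simp_rw [integral_mul_const]
    _ = ∫ y, ∫ x, heatKernel t (x - y) * g y * φ x := (integral_integral_swap hint).symm
    _ = _ := by
        unfold heatSemigroup
        refine integral_congr_ae (Eventually.of_forall fun y => ?_)
        simp only
        rw [← integral_const_mul]
        refine integral_congr_ae (Eventually.of_forall fun x => ?_)
        simp only
        rw [heatKernel_sub_comm]
        ring

lemma continuous_heatSemigroup (hg : HeatIntegrable g) {t : ℝ} (ht : 0 < t) :
    Continuous (heatSemigroup t g) :=
  (hg.differentiable_heatSemigroup ht).continuous

lemma continuous_fderiv_heatSemigroup (hg : HeatIntegrable g) {t : ℝ} (ht : 0 < t) (e : Space d) :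
    Continuous fun x => fderiv ℝ (heatSemigroup t g) x e :=
  (hg.continuousOn_fderiv_heatSemigroup e).comp_continuous (f := fun x => (t, x)) (by fun_prop)
    fun _ => ⟨ht, mem_univ _⟩

lemma integral_fderiv_heatSemigroup_mul (hg : HeatIntegrable g) {φ : Space d → ℝ}
    (hφ : ContDiff ℝ 1 φ) (hc : HasCompactSupport φ) {t : ℝ} (ht : 0 < t) (e : Space d) :
    ∫ x, fderiv ℝ (heatSemigroup t g) x e * φ x =
      -∫ x, heatSemigroup t g x * fderiv ℝ φ x e := by
  have hcont := hg.continuous_heatSemigroup ht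
  have hcont' := hg.continuous_fderiv_heatSemigroup ht e
  have hφ' : Continuous fun x => fderiv ℝ φ x e := (hφ.continuous_fderiv one_ne_zero).clm_apply
    continuous_const
  have hc' : HasCompactSupport fun x => fderiv ℝ φ x e := hc.fderiv_apply ℝ e
  rw [integral_mul_fderiv_eq_neg_fderiv_mul_of_integrable, neg_neg]
  · exact (hcont'.mul hφ.continuous).integrable_of_hasCompactSupport hc.mul_left
  · exact (hcont.mul hφ').integrable_of_hasCompactSupport hc'.mul_left
  · exact (hcont.mul hφ.continuous).integrable_of_hasCompactSupport hc.mul_left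
  · exact fun x _ => hg.differentiable_heatSemigroup ht x
  · exact fun x _ => hφ.differentiable one_ne_zero x

/-- The initial value of `e^{tΔ} g` is attained in the sense of distributions. -/
lemma tendsto_integral_heatSemigroup_mul (hg : HeatIntegrable g) {φ : Space d → ℝ}
    (hφ : Continuous φ) (hc : HasCompactSupport φ) :
    Tendsto (fun t => ∫ x, heatSemigroup t g x * φ x) (𝓝[>] 0) (𝓝 (∫ x, g x * φ x)) := by
  obtain ⟨M, hM⟩ := exists_le_decay_of_hasCompactSupport hφ hc
  have hM0 : 0 ≤ M := nonneg_of_mul_nonneg_left ((abs_nonneg _).trans (hM 0)) (decay_pos _)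
  obtain ⟨C, hC, h⟩ := abs_heatSemigroup_le_decay d 1
  have hev : ∀ᶠ t in 𝓝[>] (0 : ℝ), 0 < t ∧ t ≤ 1 := by
    filter_upwards [Ioc_mem_nhdsGT (zero_lt_one (α := ℝ))] with t ht using ht
  have h1 : Tendsto (fun t => ∫ y, g y * heatSemigroup t φ y) (𝓝[>] 0) (𝓝 (∫ x, g x * φ x)) := by
    refine tendsto_integral_filter_of_dominated_convergence (fun y => C * M * ‖decay y * g y‖) ?_ ?_
      (hg.norm.const_mul _) ?_
    · filter_upwards [hev] with t ht
      refine hg.aestronglyMeasurable.mul (Continuous.aestronglyMeasurable ?_)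
      refine HeatIntegrable.continuous_heatSemigroup ?_ ht.1
      exact (continuous_decay.mul hφ).integrable_of_hasCompactSupport hc.mul_left
    · filter_upwards [hev] with t ht
      refine Eventually.of_forall fun y => ?_
      rw [norm_mul, norm_mul, Real.norm_of_nonneg (decay_pos y).le]
      calc ‖g y‖ * ‖heatSemigroup t φ y‖ ≤ ‖g y‖ * (C * M * decay y) := by
            gcongr
            exact h φ M hφ hM t ht.1 ht.2 y
        _ = _ := by ring
    · refine Eventually.of_forall fun y => (tendsto_heatSemigroup hφ (M := M) ?_ y).const_mul _
      exact fun x => (hM x).trans (mul_le_of_le_one_right hM0 (decay_le_one x))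
  refine h1.congr' ?_
  filter_upwards [hev] with t ht
  exact (hg.integral_heatSemigroup_mul hφ hM ht.1).symm

end HeatIntegrable

/-! ### The heat operator in space-time -/

/-- The time derivative of a function on space-time. -/
noncomputable def timeDeriv {d : ℕ} (φ : ℝ × Space d → ℝ) (p : ℝ × Space d) : ℝ :=
  fderiv ℝ φ p (1, 0)

/-- The derivative of a function on space-time in the spatial direction `e`. -/
noncomputable def spaceDeriv {d : ℕ} (e : Space d) (φ : ℝ × Space d → ℝ) (p : ℝ × Space d) : ℝ :=
  fderiv ℝ φ p (0, e)

/-- The operator `c ∂_t - Δ`: the heat operator for `c = 1`, its formal adjoint for `c = -1`. -/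
noncomputable def heatOp {d : ℕ} (c : ℝ) (φ : ℝ × Space d → ℝ) (p : ℝ × Space d) : ℝ :=
  c * timeDeriv φ p -
    ∑ j, spaceDeriv (EuclideanSpace.single j 1) (spaceDeriv (EuclideanSpace.single j 1) φ) p

section HeatOp

variable {d : ℕ} {φ ψ : ℝ × Space d → ℝ} {U : Set (ℝ × Space d)}

lemma contDiffOn_fderiv_apply {F : Type*} [NormedAddCommGroup F] [NormedSpace ℝ F] {f : F → ℝ}
    {s : Set F} (hs : IsOpen s) (hf : ContDiffOn ℝ ∞ f s) (v : F) :
    ContDiffOn ℝ ∞ (fun p => fderiv ℝ f p v) s :=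
  (hf.fderiv_of_isOpen hs (m := ∞) (by simp)).clm_apply contDiffOn_const

lemma ContDiffOn.timeDeriv (hφ : ContDiffOn ℝ ∞ φ U) (hU : IsOpen U) :
    ContDiffOn ℝ ∞ (timeDeriv φ) U := contDiffOn_fderiv_apply hU hφ _

lemma ContDiffOn.spaceDeriv (hφ : ContDiffOn ℝ ∞ φ U) (hU : IsOpen U) (e : Space d) :
    ContDiffOn ℝ ∞ (spaceDeriv e φ) U := contDiffOn_fderiv_apply hU hφ _

lemma ContDiffOn.heatOp (hφ : ContDiffOn ℝ ∞ φ U) (hU : IsOpen U) (c : ℝ) :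
    ContDiffOn ℝ ∞ (heatOp c φ) U :=
  (contDiffOn_const.mul (hφ.timeDeriv hU)).sub
    (ContDiffOn.sum fun _ _ => (hφ.spaceDeriv hU _).spaceDeriv hU _)

lemma ContDiff.spaceDeriv (hφ : ContDiff ℝ ∞ φ) (e : Space d) : ContDiff ℝ ∞ (spaceDeriv e φ) :=
  contDiffOn_univ.1 (hφ.contDiffOn.spaceDeriv isOpen_univ e)

lemma ContDiff.timeDeriv (hφ : ContDiff ℝ ∞ φ) : ContDiff ℝ ∞ (timeDeriv φ) :=
  contDiffOn_univ.1 (hφ.contDiffOn.timeDeriv isOpen_univ)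

lemma ContDiff.heatOp (hφ : ContDiff ℝ ∞ φ) (c : ℝ) : ContDiff ℝ ∞ (heatOp c φ) :=
  contDiffOn_univ.1 (hφ.contDiffOn.heatOp isOpen_univ c)

lemma tsupport_spaceDeriv_subset (e : Space d) (φ : ℝ × Space d → ℝ) :
    tsupport (spaceDeriv e φ) ⊆ tsupport φ := tsupport_fderiv_apply_subset ℝ _

lemma tsupport_heatOp_subset (c : ℝ) (φ : ℝ × Space d → ℝ) :
    tsupport (heatOp c φ) ⊆ tsupport φ := by
  refine closure_minimal (fun p hp => ?_) (isClosed_tsupport φ)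
  by_contra h
  refine hp ?_
  have h1 : timeDeriv φ p = 0 := by
    by_contra h'
    exact h (tsupport_fderiv_apply_subset ℝ _ (subset_tsupport _ h'))
  have h2 : ∀ e, spaceDeriv e (spaceDeriv e φ) p = 0 := by
    intro e
    by_contra h'
    exact h (tsupport_spaceDeriv_subset e _ (tsupport_spaceDeriv_subset e _ (subset_tsupport _ h')))
  simp [heatOp, h1, h2]

lemma HasCompactSupport.spaceDeriv (hφ : HasCompactSupport φ) (e : Space d) :
    HasCompactSupport (spaceDeriv e φ) := hφ.fderiv_apply ℝ _

lemma HasCompactSupport.heatOp (hφ : HasCompactSupport φ) (c : ℝ) :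
    HasCompactSupport (heatOp c φ) :=
  hφ.of_isClosed_subset (isClosed_tsupport _) (tsupport_heatOp_subset c φ)

lemma fderiv_fderiv_comm {F : Type*} [NormedAddCommGroup F] [NormedSpace ℝ F] {f : F → ℝ}
    {s : Set F} (hs : IsOpen s) (hf : ContDiffOn ℝ ∞ f s) {p : F} (hp : p ∈ s) (v w : F) :
    fderiv ℝ (fun q => fderiv ℝ f q v) p w = fderiv ℝ (fun q => fderiv ℝ f q w) p v := by
  have h1 : ContDiffAt ℝ ∞ f p := hf.contDiffAt (hs.mem_nhds hp)
  have hd : DifferentiableAt ℝ (fderiv ℝ f) p :=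
    (h1.fderiv_right (m := ∞) (by simp)).differentiableAt (by simp)
  have hsym : IsSymmSndFDerivAt ℝ f p :=
    h1.isSymmSndFDerivAt (by rw [minSmoothness_of_isRCLikeNormedField]; exact ENat.LEInfty.out)
  rw [fderiv_clm_apply hd (differentiableAt_const v), fderiv_clm_apply hd (differentiableAt_const w)]
  simpa using hsym w v

lemma heatOp_congr_of_eventuallyEq {p : ℝ × Space d} (h : φ =ᶠ[𝓝 p] ψ) (c : ℝ) :
    heatOp c φ p = heatOp c ψ p := by
  have h1 : ∀ e : Space d, spaceDeriv e φ =ᶠ[𝓝 p] spaceDeriv e ψ := fun e => by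
    filter_upwards [h.fderiv (𝕜 := ℝ)] with q hq
    simp [spaceDeriv, hq]
  have h2 : timeDeriv φ p = timeDeriv ψ p := by simp [timeDeriv, h.fderiv_eq (𝕜 := ℝ)]
  have h3 : ∀ e : Space d, spaceDeriv e (spaceDeriv e φ) p = spaceDeriv e (spaceDeriv e ψ) p :=
    fun e => by
      rw [spaceDeriv, (h1 e).fderiv_eq (𝕜 := ℝ)]
      rfl
  simp [heatOp, h2, h3]

/-- The heat operator commutes with spatial derivatives. -/
lemma heatOp_spaceDeriv (hU : IsOpen U) (hφ : ContDiffOn ℝ ∞ φ U) (c : ℝ) (e : Space d)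
    {p : ℝ × Space d} (hp : p ∈ U) : heatOp c (spaceDeriv e φ) p = spaceDeriv e (heatOp c φ) p := by
  have hdiff : ∀ {f : ℝ × Space d → ℝ}, ContDiffOn ℝ ∞ f U → DifferentiableAt ℝ f p := fun hf =>
    (hf.contDiffAt (hU.mem_nhds hp)).differentiableAt (by simp)
  have h1 : timeDeriv (spaceDeriv e φ) p = spaceDeriv e (timeDeriv φ) p :=
    fderiv_fderiv_comm hU hφ hp _ _
  have h2 : ∀ a : Space d, spaceDeriv a (spaceDeriv a (spaceDeriv e φ)) p =
      spaceDeriv e (spaceDeriv a (spaceDeriv a φ)) p := by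
    intro a
    have h3 : spaceDeriv a (spaceDeriv e φ) =ᶠ[𝓝 p] spaceDeriv e (spaceDeriv a φ) := by
      filter_upwards [hU.mem_nhds hp] with q hq
      exact fderiv_fderiv_comm hU hφ hq _ _
    rw [spaceDeriv, h3.fderiv_eq (𝕜 := ℝ)]
    exact fderiv_fderiv_comm hU (hφ.spaceDeriv hU a) hp _ _
  have h4 : spaceDeriv e (heatOp c φ) p = c * spaceDeriv e (timeDeriv φ) p -
      ∑ j, spaceDeriv e (spaceDeriv (EuclideanSpace.single j 1)
        (spaceDeriv (EuclideanSpace.single j 1) φ)) p := by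
    unfold heatOp
    rw [spaceDeriv, fderiv_fun_sub ((hdiff (hφ.timeDeriv hU)).const_mul c)
      (DifferentiableAt.fun_sum fun j _ => hdiff ((hφ.spaceDeriv hU _).spaceDeriv hU _)),
      fderiv_const_mul (hdiff (hφ.timeDeriv hU)),
      fderiv_fun_sum fun j _ => hdiff ((hφ.spaceDeriv hU _).spaceDeriv hU _)]
    simp [spaceDeriv]
  rw [h4, heatOp, h1]
  simp_rw [h2]

lemma fderiv_comp_add_right' {F : Type*} [NormedAddCommGroup F] [NormedSpace ℝ F] (f : F → ℝ)
    (a : F) (v : F) :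
    (fun p => fderiv ℝ (fun q => f (q + a)) p v) = fun p => fderiv ℝ f (p + a) v := by
  funext p
  rw [fderiv_comp_add_right]

lemma heatOp_comp_add_right (c : ℝ) (φ : ℝ × Space d → ℝ) (a p : ℝ × Space d) :
    heatOp c (fun q => φ (q + a)) p = heatOp c φ (p + a) := by
  have h1 : ∀ e : Space d, ∀ f : ℝ × Space d → ℝ,
      spaceDeriv e (fun q => f (q + a)) = fun q => spaceDeriv e f (q + a) :=
    fun e f => fderiv_comp_add_right' f a _
  have h2 : timeDeriv (fun q => φ (q + a)) p = timeDeriv φ (p + a) :=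
    congrFun (fderiv_comp_add_right' φ a _) p
  unfold heatOp
  simp_rw [h1, h2]

lemma fderiv_slice {p : ℝ × Space d} (h : DifferentiableAt ℝ φ p) (e : Space d) :
    fderiv ℝ (fun x => φ (p.1, x)) p.2 e = spaceDeriv e φ p := by
  have h1 : HasFDerivAt (fun x : Space d => (p.1, x)) (ContinuousLinearMap.inr ℝ ℝ (Space d)) p.2 :=
    hasFDerivAt_prodMk_right p.1 p.2
  have h2 : HasFDerivAt φ (fderiv ℝ φ p) (p.1, p.2) := h.hasFDerivAt
  have h3 : fderiv ℝ (fun x => φ (p.1, x)) p.2 = _ := (h2.comp p.2 h1).fderiv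
  rw [h3]
  simp [spaceDeriv]

lemma hasDerivAt_slice {p : ℝ × Space d} (h : DifferentiableAt ℝ φ p) :
    HasDerivAt (fun t => φ (t, p.2)) (timeDeriv φ p) p.1 := by
  have h1 : HasDerivAt (fun t : ℝ => (t, p.2)) ((1 : ℝ), (0 : Space d)) p.1 :=
    (hasDerivAt_id p.1).prodMk (hasDerivAt_const p.1 p.2)
  have h2 : HasFDerivAt φ (fderiv ℝ φ p) (p.1, p.2) := h.hasFDerivAt
  exact h2.comp_hasDerivAt p.1 h1

end HeatOp

/-! ### The heat kernel is a fundamental solution -/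

section FundamentalSolution

variable {d : ℕ} {φ : ℝ × Space d → ℝ}

lemma integral_heatKernel_one_mul_inner (e : Space d) {χ : Space d → ℝ} (hχ : ContDiff ℝ 1 χ)
    (hc : HasCompactSupport χ) :
    ∫ z, heatKernel 1 z * (inner ℝ z e / 2 * χ z) = ∫ z, heatKernel 1 z * fderiv ℝ χ z e := by
  have hK : ∀ z : Space d, DifferentiableAt ℝ (heatKernel 1) z := fun z =>
    (hasFDerivAt_heatKernel one_pos z).differentiableAt
  have hKc := continuous_heatKernel (d := d) 1
  have hK' : (fun z => fderiv ℝ (heatKernel 1) z e) = heatKernelDir e 1 :=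
    funext fun z => fderiv_heatKernel_apply one_pos z e
  have hK'c : Continuous (heatKernelDir e 1) := by
    unfold heatKernelDir
    fun_prop
  rw [integral_mul_fderiv_eq_neg_fderiv_mul_of_integrable _ _ _ (fun z _ => hK z)
    fun z _ => hχ.differentiable one_ne_zero z]
  · rw [← integral_neg]
    refine integral_congr_ae (Eventually.of_forall fun z => ?_)
    simp only
    rw [fderiv_heatKernel_apply one_pos, heatKernelDir]
    ring
  · simp_rw [fun z => congrFun hK' z]
    exact (hK'c.mul hχ.continuous).integrable_of_hasCompactSupport hc.mul_left
  · exact (hKc.mul ((hχ.continuous_fderiv one_ne_zero).clm_apply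
      continuous_const)).integrable_of_hasCompactSupport (hc.fderiv_apply ℝ e).mul_left
  · exact (hKc.mul hχ.continuous).integrable_of_hasCompactSupport hc.mul_left

lemma integrable_heatKernel_one_mul_norm :
    Integrable fun z : Space d => heatKernel 1 z * (1 + ‖z‖) := by
  obtain ⟨C, hC, h⟩ := pow_mul_heatKernel_le d 1 1
  refine ((integrable_heatKernel (t := 2 * 1) (by norm_num)).const_mul C).mono'
    ((continuous_heatKernel 1).mul (by fun_prop)).aestronglyMeasurable
    (Eventually.of_forall fun z => ?_)
  have hk := heatKernel_nonneg zero_le_one z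
  rw [Real.norm_of_nonneg (by positivity)]
  have := h 1 one_pos le_rfl z
  rw [pow_one] at this
  linarith

lemma continuous_integral_scaled {ψ : ℝ × Space d → ℝ} (hψ : Continuous ψ)
    (hc : HasCompactSupport ψ) :
    Continuous fun t => ∫ z : Space d, heatKernel 1 z * ψ (t, √t • z) := by
  obtain ⟨M, hM⟩ := hψ.bounded_above_of_compact_support hc
  refine continuous_of_dominated (bound := fun z => heatKernel 1 z * M) (fun t => ?_)
      (fun t => Eventually.of_forall fun z => ?_) ((integrable_heatKernel one_pos).mul_const M)
      (Eventually.of_forall fun z => by fun_prop)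
  · exact ((continuous_heatKernel 1).mul (by fun_prop)).aestronglyMeasurable
  · rw [norm_mul, Real.norm_of_nonneg (heatKernel_nonneg zero_le_one _)]
    gcongr
    · exact heatKernel_nonneg zero_le_one _
    · exact hM _

lemma hasCompactSupport_slice {ψ : ℝ × Space d → ℝ} (hc : HasCompactSupport ψ) (t : ℝ) :
    HasCompactSupport fun x => ψ (t, x) := by
  refine HasCompactSupport.intro (hc.isCompact.image continuous_snd) fun x hx => ?_
  by_contra h
  exact hx ⟨(t, x), subset_tsupport _ h, rfl⟩

/-- The rescaled mean `∫ K(1, z) φ(t, √t z) dz` of a test function has derivative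
`∫ K(1, z) (∂_t φ + Δφ)(t, √t z) dz`: the drift produced by the scaling is turned into the
Laplacian by an integration by parts. -/
lemma hasDerivAt_integral_scaled (hφ : ContDiff ℝ ∞ φ) (hc : HasCompactSupport φ) {t : ℝ}
    (ht : 0 < t) :
    HasDerivAt (fun s => ∫ z : Space d, heatKernel 1 z * φ (s, √s • z))
      (∫ z : Space d, heatKernel 1 z * -heatOp (-1) φ (t, √t • z)) t := by
  have hst : 0 < √t := Real.sqrt_pos.2 ht
  have hdiff : Differentiable ℝ φ := hφ.differentiable (by simp)
  have hcd : Continuous (fderiv ℝ φ) := hφ.continuous_fderiv (by simp)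
  obtain ⟨M, hM⟩ := hcd.bounded_above_of_compact_support (hc.fderiv (𝕜 := ℝ))
  have hM0 : 0 ≤ M := (norm_nonneg _).trans (hM 0)
  have hKc := continuous_heatKernel (d := d) 1
  set F' : ℝ → Space d → ℝ := fun s z =>
    heatKernel 1 z * fderiv ℝ φ (s, √s • z) (1, (1 / (2 * √s)) • z) with hF'
  have key : HasDerivAt (fun s => ∫ z : Space d, heatKernel 1 z * φ (s, √s • z))
      (∫ z, F' t z) t := by
    have hq : 0 < √(t / 2) := Real.sqrt_pos.2 (by positivity)
    refine (hasDerivAt_integral_of_dominated_loc_of_deriv_le (s := Ioi (t / 2))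
      (bound := fun z => (M * (1 + 1 / (2 * √(t / 2)))) * (heatKernel 1 z * (1 + ‖z‖)))
      (Ioi_mem_nhds (by linarith)) ?_ ?_ ?_ ?_
      (integrable_heatKernel_one_mul_norm.const_mul _) ?_).2
    · exact Eventually.of_forall fun s =>
        (hKc.mul (hφ.continuous.comp (by fun_prop))).aestronglyMeasurable
    · obtain ⟨B, hB⟩ := hφ.continuous.bounded_above_of_compact_support hc
      refine ((integrable_heatKernel one_pos).mul_const B).mono'
        (hKc.mul (hφ.continuous.comp (by fun_prop))).aestronglyMeasurable
        (Eventually.of_forall fun z => ?_)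
      rw [norm_mul, Real.norm_of_nonneg (heatKernel_nonneg zero_le_one z)]
      exact mul_le_mul_of_nonneg_left (hB _) (heatKernel_nonneg zero_le_one z)
    · refine (hKc.mul ?_).aestronglyMeasurable
      exact (hcd.comp (by fun_prop)).clm_apply (by fun_prop)
    · refine Eventually.of_forall fun z s hs => ?_
      have hs' : t / 2 < s := hs
      rw [hF', norm_mul, Real.norm_of_nonneg (heatKernel_nonneg zero_le_one z)]
      have h1 : ‖((1 : ℝ), (1 / (2 * √s)) • z)‖ ≤ (1 + 1 / (2 * √(t / 2))) * (1 + ‖z‖) := by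
        have h2 : 1 / (2 * √s) ≤ 1 / (2 * √(t / 2)) := by gcongr
        have h3 : 0 < 1 / (2 * √(t / 2)) := by positivity
        rw [Prod.norm_def, norm_smul, norm_one, Real.norm_of_nonneg (by positivity)]
        refine max_le ?_ ?_
        · nlinarith [norm_nonneg z, mul_nonneg h3.le (norm_nonneg z)]
        · nlinarith [norm_nonneg z, mul_nonneg h3.le (norm_nonneg z),
            mul_le_mul_of_nonneg_right h2 (norm_nonneg z)]
      calc heatKernel 1 z * ‖fderiv ℝ φ (s, √s • z) (1, (1 / (2 * √s)) • z)‖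
          ≤ heatKernel 1 z * (M * ((1 + 1 / (2 * √(t / 2))) * (1 + ‖z‖))) := by
            refine mul_le_mul_of_nonneg_left ?_ (heatKernel_nonneg zero_le_one z)
            exact ContinuousLinearMap.le_of_opNorm_le_of_le _ (hM _) h1
        _ = _ := by ring
    · refine Eventually.of_forall fun z s hs => ?_
      have hs0 : 0 < s := lt_trans (by positivity) (mem_Ioi.1 hs)
      have h1 : HasDerivAt (fun s : ℝ => (s, √s • z)) ((1 : ℝ), (1 / (2 * √s)) • z) s :=
        (hasDerivAt_id s).prodMk ((Real.hasDerivAt_sqrt hs0.ne').smul_const z)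
      exact ((hdiff _).hasFDerivAt.comp_hasDerivAt s h1).const_mul _
  convert key using 1
  have hdec : ∀ z : Space d, F' t z = heatKernel 1 z * timeDeriv φ (t, √t • z) +
      ∑ j, heatKernel 1 z * (inner ℝ z (EuclideanSpace.single j 1) / 2 *
        ((√t)⁻¹ * spaceDeriv (EuclideanSpace.single j 1) φ (t, √t • z))) := by
    intro z
    have hz : z = ∑ j, z j • (EuclideanSpace.single j (1 : ℝ) : Space d) := by
      have := (EuclideanSpace.basisFun (Fin d) ℝ).sum_repr z
      simpa using this.symm
    have h1 : ((1 : ℝ), (1 / (2 * √t)) • z) = (1, 0) +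
        ∑ j, (1 / (2 * √t) * z j) • ((0 : ℝ), (EuclideanSpace.single j (1 : ℝ) : Space d)) := by
      have h2 : ∑ j, (1 / (2 * √t) * z j) • ((0 : ℝ), (EuclideanSpace.single j (1 : ℝ) : Space d)) =
          (0, (1 / (2 * √t)) • z) := by
        ext1
        · simp [Prod.fst_sum]
        · rw [Prod.snd_sum]
          conv_rhs => rw [hz, Finset.smul_sum]
          refine Finset.sum_congr rfl fun j _ => ?_
          rw [Prod.smul_snd, smul_smul]
      rw [h2]
      simp
    simp only [hF']
    rw [h1, map_add, map_sum, mul_add, Finset.mul_sum]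
    congr 1
    refine Finset.sum_congr rfl fun j _ => ?_
    rw [map_smul, smul_eq_mul, EuclideanSpace.inner_single_right]
    simp only [spaceDeriv, conj_trivial]
    field_simp
  have hcomp : ∀ f : ℝ × Space d → ℝ, HasCompactSupport f →
      HasCompactSupport fun z => f (t, √t • z) := fun f hf =>
    (hasCompactSupport_slice hf t).comp_homeomorph (Homeomorph.smulOfNeZero (√t) hst.ne')
  have hsD : ∀ e, ContDiff ℝ ∞ (spaceDeriv e φ) := fun e => hφ.spaceDeriv e
  have hin : ∀ f : Space d → ℝ, Continuous f → HasCompactSupport f →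
      Integrable fun z => heatKernel 1 z * f z := fun f hf hfc =>
    (hKc.mul hf).integrable_of_hasCompactSupport hfc.mul_left
  have hi1 : Integrable fun z => heatKernel 1 z * timeDeriv φ (t, √t • z) :=
    hin _ (hφ.timeDeriv.continuous.comp (by fun_prop)) (hcomp _ (hc.fderiv_apply ℝ _))
  have hi2 : ∀ j, Integrable fun z : Space d =>
      heatKernel 1 z * (inner ℝ z (EuclideanSpace.single j 1) / 2 *
        ((√t)⁻¹ * spaceDeriv (EuclideanSpace.single j 1) φ (t, √t • z))) := by
    intro j
    refine hin _ (Continuous.mul (by fun_prop) (continuous_const.mul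
      ((hsD _).continuous.comp (by fun_prop)))) ?_
    exact (hcomp _ (hc.spaceDeriv _)).mul_left.mul_left
  have hi3 : ∀ j : Fin d, Integrable fun z : Space d => heatKernel 1 z *
      spaceDeriv (EuclideanSpace.single j 1) (spaceDeriv (EuclideanSpace.single j 1) φ)
        (t, √t • z) := fun j =>
    hin _ (((hsD _).spaceDeriv _).continuous.comp (by fun_prop))
      (hcomp _ ((hc.spaceDeriv _).spaceDeriv _))
  have hparts : ∀ j : Fin d, ∫ z : Space d,
      heatKernel 1 z * (inner ℝ z (EuclideanSpace.single j 1) / 2 *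
        ((√t)⁻¹ * spaceDeriv (EuclideanSpace.single j 1) φ (t, √t • z))) =
      ∫ z : Space d, heatKernel 1 z *
        spaceDeriv (EuclideanSpace.single j 1) (spaceDeriv (EuclideanSpace.single j 1) φ)
          (t, √t • z) := by
    intro j
    set e : Space d := EuclideanSpace.single j 1
    have hlin : ContDiff ℝ ∞ fun z : Space d => (t, √t • z) := by fun_prop
    rw [integral_heatKernel_one_mul_inner e (χ := fun z => (√t)⁻¹ * spaceDeriv e φ (t, √t • z))]
    · refine integral_congr_ae (Eventually.of_forall fun z => ?_)
      simp only
      congr 1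
      have hd1 : HasFDerivAt (fun z : Space d => (t, √t • z))
          ((0 : Space d →L[ℝ] ℝ).prod (√t • ContinuousLinearMap.id ℝ (Space d))) z :=
        (hasFDerivAt_const t z).prodMk ((hasFDerivAt_id z).const_smul (√t))
      have hd2 := (((hsD e).differentiable (by simp) (t, √t • z)).hasFDerivAt.comp z hd1).const_mul
        ((√t)⁻¹)
      have hd3 : fderiv ℝ (fun z => (√t)⁻¹ * spaceDeriv e φ (t, √t • z)) z = _ := hd2.fderiv
      rw [hd3]
      have : ((0 : ℝ), √t • e) = √t • ((0 : ℝ), e) := by simp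
      simp only [_root_.smul_apply, ContinuousLinearMap.comp_apply,
        ContinuousLinearMap.prod_apply, _root_.zero_apply,
        ContinuousLinearMap.id_apply, smul_eq_mul, this, map_smul]
      rw [inv_mul_cancel_left₀ hst.ne']
      rfl
    · exact ((contDiff_const.mul ((hsD e).comp hlin))).of_le (by simp)
    · exact (hcomp _ (hc.spaceDeriv _)).mul_left
  simp_rw [hdec]
  rw [integral_add hi1 (integrable_finsetSum _ fun j _ => hi2 j),
    integral_finsetSum _ fun j _ => hi2 j]
  simp_rw [hparts]
  rw [← integral_finsetSum _ fun j _ => hi3 j,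
    ← integral_add hi1 (integrable_finsetSum _ fun j _ => hi3 j)]
  refine integral_congr_ae (Eventually.of_forall fun z => ?_)
  simp only [heatOp]
  rw [← Finset.mul_sum]
  ring

/-- The heat kernel, extended by zero to negative times, is a fundamental solution of the heat
operator. -/
lemma integral_heatKernel_mul_heatOp (hφ : ContDiff ℝ ∞ φ) (hc : HasCompactSupport φ) {R : ℝ}
    (hR : 0 ≤ R) (hφR : ∀ x, φ (R, x) = 0) :
    ∫ t in (0 : ℝ)..R, ∫ x, heatKernel t x * heatOp (-1) φ (t, x) = φ 0 := by
  have hop : Continuous (heatOp (-1) φ) := (hφ.heatOp (-1)).continuous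
  have h1 := intervalIntegral.integral_eq_sub_of_hasDerivAt_of_le hR
    (continuous_integral_scaled hφ.continuous hc).continuousOn
    (fun t ht => hasDerivAt_integral_scaled hφ hc ht.1)
    ((continuous_integral_scaled hop.neg (hc.heatOp (-1)).neg).intervalIntegrable 0 R)
  simp only [Real.sqrt_zero, zero_smul, hφR, mul_zero, integral_zero, integral_mul_const,
    integral_heatKernel one_pos, one_mul, mul_neg, zero_sub, integral_neg,
    intervalIntegral.integral_neg, neg_inj] at h1
  refine Eq.trans ?_ h1
  refine intervalIntegral.integral_congr_ae (Eventually.of_forall fun t ht => ?_)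
  rw [uIoc_of_le hR] at ht
  exact integral_heatKernel_mul_eq_scaled ht.1 _

end FundamentalSolution

namespace HeatIntegrable

variable {d : ℕ} {g : Space d → ℝ} {φ : ℝ × Space d → ℝ}

lemma exists_le_decay_of_hasCompactSupport_prod {ψ : ℝ × Space d → ℝ} (hψ : Continuous ψ)
    (hc : HasCompactSupport ψ) : ∃ M, ∀ p, |ψ p| ≤ M * decay p.2 := by
  have h1 : Continuous fun p : ℝ × Space d => (decay p.2)⁻¹ * ψ p :=
    ((continuous_decay.comp continuous_snd).inv₀ fun p => (decay_pos p.2).ne').mul hψ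
  obtain ⟨M, hM⟩ := h1.bounded_above_of_compact_support hc.mul_left
  refine ⟨M, fun p => ?_⟩
  have := hM p
  rw [norm_mul, norm_inv, Real.norm_of_nonneg (decay_pos _).le, inv_mul_le_iff₀ (decay_pos _),
    mul_comm] at this
  exact this

lemma integral_heatSemigroup_mul_heatOp_zero (hg : HeatIntegrable g) (hφ : ContDiff ℝ ∞ φ)
    (hc : HasCompactSupport φ) {R : ℝ} (hR : 0 ≤ R) (hφR : ∀ x, φ (R, x) = 0) :
    ∫ t in (0 : ℝ)..R, ∫ x, heatSemigroup t g x * heatOp (-1) φ (t, x) =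
      ∫ y, g y * φ (0, y) := by
  set ψ := heatOp (-1) φ with hψdef
  have hψ : Continuous ψ := (hφ.heatOp (-1)).continuous
  obtain ⟨M, hM⟩ := exists_le_decay_of_hasCompactSupport_prod hψ (hc.heatOp (-1))
  have hint := hg.integrable_kernel_mul_pairing hψ hM R
  have hint' : Integrable (fun q : (ℝ × Space d) × Space d =>
      heatKernel q.1.1 (q.2 - q.1.2) * g q.1.2 * ψ (q.1.1, q.2))
      (((volume.restrict (Ioc 0 R)).prod volume).prod volume) :=
    (measurePreserving_prodAssoc (volume.restrict (Ioc 0 R)) (volume : Measure (Space d))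
      (volume : Measure (Space d))).integrable_comp_of_integrable hint
  have h1 : ∀ᵐ t ∂(volume.restrict (Ioc 0 R)), ∫ x, heatSemigroup t g x * ψ (t, x) =
      ∫ y, ∫ x, heatKernel t (x - y) * g y * ψ (t, x) := by
    filter_upwards [hint.prod_right_ae] with t ht
    rw [integral_integral_swap ht]
    refine integral_congr_ae (Eventually.of_forall fun x => ?_)
    simp only [heatSemigroup]
    rw [integral_mul_const]
  rw [intervalIntegral.integral_of_le hR, integral_congr_ae h1,
    integral_integral_swap hint'.integral_prod_left]
  refine integral_congr_ae (Eventually.of_forall fun y => ?_)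
  simp only
  have h2 : ∀ t, ∫ x, heatKernel t (x - y) * g y * ψ (t, x) =
      g y * ∫ x, heatKernel t x * heatOp (-1) (fun q => φ (q + (0, y))) (t, x) := by
    intro t
    rw [← integral_const_mul, ← integral_add_right_eq_self _ y]
    refine integral_congr_ae (Eventually.of_forall fun x => ?_)
    simp only
    rw [heatOp_comp_add_right, add_sub_cancel_right, Prod.mk_add_mk, add_zero]
    ring
  simp_rw [h2]
  rw [integral_const_mul, ← intervalIntegral.integral_of_le hR,
    integral_heatKernel_mul_heatOp _ _ hR]
  · simp
  · intro x
    simp [hφR]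
  · fun_prop
  · exact hc.comp_homeomorph (Homeomorph.addRight ((0 : ℝ), y))

/-- The function `(t, x) ↦ e^{(t-s)Δ} g (x)`, `t > s`, solves the heat equation in the sense of
distributions, with initial value `g` at time `s`. -/
lemma integral_heatSemigroup_mul_heatOp (hg : HeatIntegrable g) (hφ : ContDiff ℝ ∞ φ)
    (hc : HasCompactSupport φ) {s R : ℝ} (hR : s ≤ R) (hφR : ∀ x, φ (R, x) = 0) :
    ∫ t in s..R, ∫ x, heatSemigroup (t - s) g x * heatOp (-1) φ (t, x) = ∫ y, g y * φ (s, y) := by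
  have hφ' : ContDiff ℝ ∞ fun q : ℝ × Space d => φ (q + (s, 0)) :=
    hφ.comp (contDiff_id.add contDiff_const)
  have hc' : HasCompactSupport fun q : ℝ × Space d => φ (q + (s, 0)) :=
    hc.comp_homeomorph (Homeomorph.addRight (s, (0 : Space d)))
  have h := hg.integral_heatSemigroup_mul_heatOp_zero hφ' hc' (R := R - s) (sub_nonneg.2 hR)
    (fun x => by rw [Prod.mk_add_mk, sub_add_cancel]; exact hφR _)
  simp only [heatOp_comp_add_right, Prod.mk_add_mk, add_zero, zero_add] at h
  set F : ℝ → ℝ := fun t => ∫ x, heatSemigroup (t - s) g x * heatOp (-1) φ (t, x) with hF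
  have h2 : ∫ t in (0 : ℝ)..(R - s), F (t + s) = ∫ t in s..R, F t := by
    rw [intervalIntegral.integral_comp_add_right, zero_add, sub_add_cancel]
  rw [← h, ← h2]
  simp only [hF, add_sub_cancel_right]

/-- The weak formulation of the heat equation for `∂_e e^{(t-s)Δ} g`. -/
lemma integral_fderiv_heatSemigroup_mul_heatOp (hg : HeatIntegrable g) (hφ : ContDiff ℝ ∞ φ)
    (hc : HasCompactSupport φ) {s R : ℝ} (hR : s ≤ R) (hφR : ∀ x, φ (R, x) = 0) (e : Space d) :
    ∫ t in s..R, ∫ x, fderiv ℝ (heatSemigroup (t - s) g) x e * heatOp (-1) φ (t, x) =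
      -∫ y, g y * spaceDeriv e φ (s, y) := by
  have hd : ∀ {f : ℝ × Space d → ℝ}, ContDiff ℝ ∞ f → ∀ t x,
      fderiv ℝ (fun x => f (t, x)) x e = spaceDeriv e f (t, x) := fun hf t x =>
    fderiv_slice (p := (t, x)) (hf.differentiable (by simp) _) e
  rw [← hg.integral_heatSemigroup_mul_heatOp (hφ.spaceDeriv e) (hc.spaceDeriv e) hR,
    ← intervalIntegral.integral_neg]
  · refine intervalIntegral.integral_congr_ae (Eventually.of_forall fun t ht => ?_)
    rw [uIoc_of_le hR] at ht
    have hop := hφ.heatOp (-1)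
    rw [hg.integral_fderiv_heatSemigroup_mul (φ := fun x => heatOp (-1) φ (t, x))
      (by have : ContDiff ℝ ∞ fun x => heatOp (-1) φ (t, x) := by fun_prop
          exact this.of_le (by simp))
      (hasCompactSupport_slice (hc.heatOp (-1)) t) (sub_pos.2 ht.1)]
    congr 1
    refine integral_congr_ae (Eventually.of_forall fun x => ?_)
    simp only
    rw [hd hop, heatOp_spaceDeriv isOpen_univ hφ.contDiffOn _ _ (mem_univ _)]
  · intro x
    rw [← hd hφ]
    simp [hφR]

end HeatIntegrable

/-! ### Smoothness of the heat kernel away from the origin -/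

section FlatFunctions

/-- The function `s^α e^{-c/s}` for `s > 0`, extended by zero. -/
noncomputable def rpowMulExpNegInv (c α s : ℝ) : ℝ :=
  if 0 < s then s ^ α * Real.exp (-c / s) else 0

variable {c : ℝ}

lemma tendsto_rpowMulExpNegInv (hc : 0 < c) (α : ℝ) :
    Tendsto (rpowMulExpNegInv c α) (𝓝[≠] 0) (𝓝 0) := by
  rw [← Iio_union_Ioi, nhdsWithin_union]
  refine Tendsto.sup ?_ ?_
  · refine tendsto_const_nhds.congr' ?_
    filter_upwards [self_mem_nhdsWithin] with s hs
    rw [rpowMulExpNegInv, if_neg (not_lt.2 (mem_Iio.1 hs).le)]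
  · refine ((tendsto_rpow_mul_exp_neg_mul_atTop_nhds_zero (-α) c hc).comp
      tendsto_inv_nhdsGT_zero).congr' ?_
    filter_upwards [self_mem_nhdsWithin] with s hs
    have hs' : 0 < s := hs
    rw [rpowMulExpNegInv, if_pos hs', Function.comp_apply, Real.inv_rpow hs'.le,
      Real.rpow_neg hs'.le, inv_inv, div_eq_mul_inv]

lemma hasDerivAt_rpowMulExpNegInv (hc : 0 < c) (α s : ℝ) :
    HasDerivAt (rpowMulExpNegInv c α)
      (α * rpowMulExpNegInv c (α - 1) s + c * rpowMulExpNegInv c (α - 2) s) s := by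
  rcases lt_trichotomy s 0 with hs | rfl | hs
  · have h0 : ∀ β, rpowMulExpNegInv c β s = 0 := fun β => if_neg (not_lt.2 hs.le)
    rw [h0, h0, mul_zero, mul_zero, add_zero]
    refine (hasDerivAt_const s (0 : ℝ)).congr_of_eventuallyEq ?_
    filter_upwards [Iio_mem_nhds hs] with r hr
    exact if_neg (not_lt.2 (mem_Iio.1 hr).le)
  · have h0 : ∀ β, rpowMulExpNegInv c β 0 = 0 := fun β => if_neg (lt_irrefl _)
    rw [h0, h0, mul_zero, mul_zero, add_zero, hasDerivAt_iff_tendsto_slope]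
    refine (tendsto_rpowMulExpNegInv hc (α - 1)).congr' ?_
    filter_upwards [self_mem_nhdsWithin] with r hr
    rw [slope_def_field, h0, sub_zero, sub_zero]
    unfold rpowMulExpNegInv
    split_ifs with h
    · rw [Real.rpow_sub_one h.ne']
      ring
    · simp
  · have h0 : ∀ β, rpowMulExpNegInv c β s = s ^ β * Real.exp (-c / s) := fun β => if_pos hs
    have h1 : HasDerivAt (fun r : ℝ => r ^ α) (α * s ^ (α - 1)) s :=
      Real.hasDerivAt_rpow_const (Or.inl hs.ne')
    have h2 : HasDerivAt (fun r : ℝ => -c / r) (c / s ^ 2) s := by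
      have := (hasDerivAt_inv hs.ne').const_mul (-c)
      refine (this.congr_deriv ?_).congr_of_eventuallyEq
        (Eventually.of_forall fun r => div_eq_mul_inv _ _)
      field_simp
    have h3 := h1.mul h2.exp
    rw [h0, h0]
    refine (h3.congr_deriv ?_).congr_of_eventuallyEq ?_
    · rw [Real.rpow_sub hs α 2, show ((2 : ℝ)) = ((2 : ℕ) : ℝ) by norm_num, Real.rpow_natCast]
      field_simp
    · filter_upwards [Ioi_mem_nhds hs] with r hr
      exact if_pos hr

/-- The family is closed under differentiation up to linear combinations, so all its members are
smooth. -/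
lemma contDiff_rpowMulExpNegInv (hc : 0 < c) (α : ℝ) : ContDiff ℝ ∞ (rpowMulExpNegInv c α) := by
  rw [contDiff_infty]
  intro n
  induction n generalizing α with
  | zero =>
    refine contDiff_zero.2 (continuous_iff_continuousAt.2 fun s => ?_)
    exact (hasDerivAt_rpowMulExpNegInv hc α s).continuousAt
  | succ n ih =>
    push_cast
    refine contDiff_succ_iff_deriv.2 ⟨fun s => (hasDerivAt_rpowMulExpNegInv hc α s).differentiableAt,
      fun h => absurd h (by simp), ?_⟩
    rw [funext fun s => (hasDerivAt_rpowMulExpNegInv hc α s).deriv]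
    exact (contDiff_const.mul (ih _)).add (contDiff_const.mul (ih _))

end FlatFunctions

/-- The heat kernel on space-time, extended by zero to nonpositive times. -/
noncomputable def causalKernel {d : ℕ} (p : ℝ × Space d) : ℝ :=
  if 0 < p.1 then heatKernel p.1 p.2 else 0

/-- Self-similarity of the heat kernel: away from the time axis it is a smooth factor times a
function of `t / |x|²` that is flat at `0`. -/
lemma causalKernel_eq {d : ℕ} {p : ℝ × Space d} (hp : p.2 ≠ 0) :
    causalKernel p = (4 * Real.pi * ‖p.2‖ ^ 2) ^ (-(d : ℝ) / 2) *
      rpowMulExpNegInv (1 / 4) (-(d : ℝ) / 2) (p.1 / ‖p.2‖ ^ 2) := by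
  have hn : 0 < ‖p.2‖ := norm_pos_iff.2 hp
  unfold causalKernel rpowMulExpNegInv
  by_cases h : 0 < p.1
  · rw [if_pos h, if_pos (by positivity), ← mul_assoc,
      ← Real.mul_rpow (by positivity) (by positivity), heatKernel]
    congr 2 <;> field_simp
  · rw [if_neg h, if_neg, mul_zero]
    rw [div_pos_iff]
    push Not
    exact ⟨fun h' => absurd h' h, fun _ => by positivity⟩

lemma contDiffAt_causalKernel {d : ℕ} {p : ℝ × Space d} (hp : p ≠ 0) :
    ContDiffAt ℝ ∞ causalKernel p := by
  by_cases h2 : p.2 = 0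
  · have h1 : p.1 ≠ 0 := fun h => hp (Prod.ext h h2)
    rcases h1.lt_or_gt with h | h
    · refine contDiffAt_const (c := (0 : ℝ)) |>.congr_of_eventuallyEq ?_
      filter_upwards [continuous_fst.continuousAt.eventually_lt_const h] with q hq
      exact if_neg (not_lt.2 hq.le)
    · refine (contDiffOn_heatKernel.contDiffAt
        ((isOpen_Ioi.prod isOpen_univ).mem_nhds ⟨h, mem_univ _⟩)).congr_of_eventuallyEq ?_
      filter_upwards [continuous_fst.continuousAt.eventually_const_lt h] with q hq
      exact if_pos hq
  · have h3 : ∀ᶠ q in 𝓝 p, q.2 ≠ 0 := continuous_snd.continuousAt.eventually_ne h2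
    have hn : 0 < ‖p.2‖ := norm_pos_iff.2 h2
    refine ContDiffAt.congr_of_eventuallyEq ?_ (h3.mono fun q hq => causalKernel_eq hq)
    have hsq : ContDiff ℝ ∞ fun q : ℝ × Space d => ‖q.2‖ ^ 2 := contDiff_snd.norm_sq ℝ
    refine ContDiffAt.mul ?_ ?_
    · refine ContDiffAt.rpow_const_of_ne (contDiffAt_const.mul hsq.contDiffAt) ?_
      positivity
    · refine ContDiffAt.comp p (contDiff_rpowMulExpNegInv (by norm_num) _).contDiffAt ?_
      exact contDiffAt_fst.div hsq.contDiffAt (by positivity)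

/-! ### A parametrix for the heat operator -/

section Parametrix

variable {d : ℕ}

instance : (volume : Measure (ℝ × Space d)).IsAddHaarMeasure :=
  Measure.prod.instIsAddHaarMeasure _ _

lemma measurable_causalKernel : Measurable (causalKernel : ℝ × Space d → ℝ) :=
  Measurable.ite (measurableSet_lt measurable_const measurable_fst) measurable_heatKernel
    measurable_const

lemma integrableOn_causalKernel (R : ℝ) :
    IntegrableOn (causalKernel : ℝ × Space d → ℝ) (Iic R ×ˢ univ) := by
  have h1 : Integrable (causalKernel : ℝ × Space d → ℝ)
      ((volume.restrict (Ioc 0 R)).prod volume) := by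
    refine (integrable_prod_iff measurable_causalKernel.aestronglyMeasurable).2 ⟨?_, ?_⟩
    · filter_upwards [ae_restrict_mem measurableSet_Ioc] with t ht
      simpa [causalKernel, ht.1] using integrable_heatKernel ht.1
    · refine (integrable_const (1 : ℝ)).congr ?_
      filter_upwards [ae_restrict_mem measurableSet_Ioc] with t ht
      simp only [causalKernel, ht.1, if_true]
      simp_rw [fun x : Space d => Real.norm_of_nonneg (heatKernel_nonneg ht.1.le x)]
      rw [integral_heatKernel ht.1]
  have h2 : IntegrableOn (causalKernel : ℝ × Space d → ℝ) (Ioc 0 R ×ˢ univ) := by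
    rw [IntegrableOn, Measure.volume_eq_prod, ← Measure.prod_restrict, Measure.restrict_univ]
    exact h1
  refine h2.of_forall_sdiff_eq_zero (measurableSet_Iic.prod MeasurableSet.univ) ?_
  rintro ⟨t, x⟩ ⟨⟨h3, -⟩, h4⟩
  refine if_neg fun h5 => h4 ⟨⟨h5, h3⟩, mem_univ _⟩

lemma HasCompactSupport.exists_time_bound {φ : ℝ × Space d → ℝ} (hc : HasCompactSupport φ) :
    ∃ R, 0 ≤ R ∧ ∀ p, R ≤ p.1 → φ p = 0 := by
  obtain ⟨R, hR⟩ := (hc.isCompact.image continuous_fst).bddAbove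
  refine ⟨max R 0 + 1, by positivity, fun p hp => ?_⟩
  by_contra h
  have := hR ⟨p, subset_tsupport _ h, rfl⟩
  linarith [le_max_left R 0]

lemma integrable_causalKernel_mul {ψ : ℝ × Space d → ℝ} (hψ : Continuous ψ)
    (hc : HasCompactSupport ψ) : Integrable fun p => causalKernel p * ψ p := by
  obtain ⟨R, -, hR⟩ := hc.exists_time_bound
  obtain ⟨M, hM⟩ := hψ.bounded_above_of_compact_support hc
  have h1 : IntegrableOn (fun p => causalKernel p * ψ p) (Iic R ×ˢ univ) :=
    Integrable.mul_bdd (integrableOn_causalKernel R) hψ.aestronglyMeasurable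
      (Eventually.of_forall hM)
  refine (integrableOn_iff_integrable_of_support_subset fun p hp => ?_).1 h1
  refine ⟨?_, mem_univ _⟩
  by_contra h
  exact hp (by simp [hR p (not_le.1 h).le])

/-- The distributional identity `(∂_t - Δ) K = δ`. -/
lemma integral_causalKernel_mul_heatOp {φ : ℝ × Space d → ℝ} (hφ : ContDiff ℝ ∞ φ)
    (hc : HasCompactSupport φ) : ∫ p, causalKernel p * heatOp (-1) φ p = φ 0 := by
  obtain ⟨R, hR0, hR⟩ := hc.exists_time_bound
  have hψ : Continuous (heatOp (-1) φ) := (hφ.heatOp (-1)).continuous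
  have hψR : ∀ p, R < p.1 → heatOp (-1) φ p = 0 := by
    intro p hp
    have h1 : φ =ᶠ[𝓝 p] fun _ => 0 := by
      filter_upwards [continuous_fst.continuousAt.eventually_const_lt hp] with q hq
      exact hR q hq.le
    by_contra h
    exact notMem_tsupport_iff_eventuallyEq.2 h1
      (tsupport_heatOp_subset (-1) φ (subset_tsupport _ h))
  rw [← integral_heatKernel_mul_heatOp hφ hc hR0 fun x => hR _ le_rfl,
    intervalIntegral.integral_of_le hR0, Measure.volume_eq_prod,
    integral_prod _ (integrable_causalKernel_mul hψ (hc.heatOp (-1)))]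
  rw [← integral_indicator measurableSet_Ioc]
  congr 1
  ext t
  by_cases ht : t ∈ Ioc 0 R
  · simp only [indicator_of_mem ht, causalKernel, if_pos ht.1]
  · rw [indicator_of_notMem ht]
    refine integral_eq_zero_of_ae (Eventually.of_forall fun x => ?_)
    by_cases h0 : 0 < t
    · have : R < t := not_le.1 fun h => ht ⟨h0, h⟩
      simp [hψR (t, x) this]
    · simp [causalKernel, h0]

lemma integral_mul_fderiv_eq {F : Type*} [NormedAddCommGroup F] [NormedSpace ℝ F]
    [FiniteDimensional ℝ F] [MeasurableSpace F] [BorelSpace F] {μ : Measure F} [μ.IsAddHaarMeasure]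
    {f φ : F → ℝ} (hf : ContDiff ℝ 1 f) (hφ : ContDiff ℝ 1 φ) (hc : HasCompactSupport φ) (v : F) :
    ∫ p, f p * fderiv ℝ φ p v ∂μ = -∫ p, fderiv ℝ f p v * φ p ∂μ := by
  have hf' : Continuous fun p => fderiv ℝ f p v :=
    (hf.continuous_fderiv one_ne_zero).clm_apply continuous_const
  have hφ' : Continuous fun p => fderiv ℝ φ p v :=
    (hφ.continuous_fderiv one_ne_zero).clm_apply continuous_const
  refine integral_mul_fderiv_eq_neg_fderiv_mul_of_integrable ?_ ?_ ?_
    (fun p _ => hf.differentiable one_ne_zero p) fun p _ => hφ.differentiable one_ne_zero p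
  · exact (hf'.mul hφ.continuous).integrable_of_hasCompactSupport hc.mul_left
  · exact (hf.continuous.mul hφ').integrable_of_hasCompactSupport (hc.fderiv_apply ℝ v).mul_left
  · exact (hf.continuous.mul hφ.continuous).integrable_of_hasCompactSupport hc.mul_left

lemma integral_mul_heatOp {f φ : ℝ × Space d → ℝ} (hf : ContDiff ℝ ∞ f) (hφ : ContDiff ℝ ∞ φ)
    (hc : HasCompactSupport φ) (c : ℝ) :
    ∫ p, f p * heatOp (-c) φ p = ∫ p, heatOp c f p * φ p := by
  have h1 : ∫ p, f p * timeDeriv φ p = -∫ p, timeDeriv f p * φ p :=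
    integral_mul_fderiv_eq (hf.of_le (by simp)) (hφ.of_le (by simp)) hc _
  have h2 : ∀ e : Space d, ∫ p, f p * spaceDeriv e (spaceDeriv e φ) p =
      ∫ p, spaceDeriv e (spaceDeriv e f) p * φ p := by
    intro e
    have h3 : ∫ p, f p * spaceDeriv e (spaceDeriv e φ) p =
        -∫ p, spaceDeriv e f p * spaceDeriv e φ p :=
      integral_mul_fderiv_eq (hf.of_le (by simp)) ((hφ.spaceDeriv e).of_le (by simp))
        (hc.spaceDeriv e) _
    have h4 : ∫ p, spaceDeriv e f p * spaceDeriv e φ p =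
        -∫ p, spaceDeriv e (spaceDeriv e f) p * φ p :=
      integral_mul_fderiv_eq ((hf.spaceDeriv e).of_le (by simp)) (hφ.of_le (by simp)) hc _
    rw [h3, h4, neg_neg]
  have hi : ∀ g k : ℝ × Space d → ℝ, ContDiff ℝ ∞ g → ContDiff ℝ ∞ k → HasCompactSupport k →
      Integrable fun p => g p * k p := fun g k hg hk hkc =>
    (hg.continuous.mul hk.continuous).integrable_of_hasCompactSupport hkc.mul_left
  have hit : HasCompactSupport (timeDeriv φ) := hc.fderiv_apply ℝ _
  have e1 : ∀ p, f p * heatOp (-c) φ p = -c * (f p * timeDeriv φ p) -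
      ∑ j, f p * spaceDeriv (EuclideanSpace.single j 1)
        (spaceDeriv (EuclideanSpace.single j 1) φ) p := fun p => by
    rw [heatOp, ← Finset.mul_sum]
    ring
  have e2 : ∀ p, heatOp c f p * φ p = c * (timeDeriv f p * φ p) -
      ∑ j, spaceDeriv (EuclideanSpace.single j 1)
        (spaceDeriv (EuclideanSpace.single j 1) f) p * φ p := fun p => by
    rw [heatOp, ← Finset.sum_mul]
    ring
  simp_rw [e1, e2]
  rw [integral_sub ((hi _ _ hf hφ.timeDeriv hit).const_mul _)
      (integrable_finsetSum _ fun j _ => hi _ _ hf ((hφ.spaceDeriv _).spaceDeriv _)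
        ((hc.spaceDeriv _).spaceDeriv _)),
    integral_sub ((hi _ _ hf.timeDeriv hφ hc).const_mul _)
      (integrable_finsetSum _ fun j _ => hi _ _ ((hf.spaceDeriv _).spaceDeriv _) hφ hc),
    integral_const_mul, integral_const_mul, h1,
    integral_finsetSum _ fun j _ => hi _ _ hf ((hφ.spaceDeriv _).spaceDeriv _)
        ((hc.spaceDeriv _).spaceDeriv _),
    integral_finsetSum _ fun j _ => hi _ _ ((hf.spaceDeriv _).spaceDeriv _) hφ hc]
  simp_rw [h2]
  ring

/-- The fundamental lemma of the calculus of variations for continuous functions. -/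
lemma eqOn_zero_of_integral_mul_eq_zero {F : Type*} [NormedAddCommGroup F] [NormedSpace ℝ F]
    [FiniteDimensional ℝ F] [MeasurableSpace F] [BorelSpace F] {μ : Measure F} [μ.IsAddHaarMeasure]
    {U : Set F} (hU : IsOpen U) {f : F → ℝ} (hf : ContinuousOn f U)
    (h : ∀ φ : F → ℝ, ContDiff ℝ ∞ φ → HasCompactSupport φ → tsupport φ ⊆ U →
      ∫ p, f p * φ p ∂μ = 0) : ∀ p ∈ U, f p = 0 := by
  have h1 := hU.ae_eq_zero_of_integral_contDiff_smul_eq_zero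
    (hf.locallyIntegrableOn hU.measurableSet (μ := μ)) fun φ h1 h2 h3 => by
      simpa only [smul_eq_mul, mul_comm] using h φ h1 h2 h3
  have h2 : f =ᵐ[μ.restrict U] fun _ => (0 : ℝ) := (ae_restrict_iff' hU.measurableSet).2 h1
  exact Measure.eqOn_open_of_ae_eq h2 hU hf continuousOn_const

/-- A parametrix: cutting off the heat kernel outside a small ball produces a fundamental solution
with support in this ball, up to a smooth error. -/
lemma exists_parametrix {ρ : ℝ} (hρ : 0 < ρ) : ∃ Q κ : ℝ × Space d → ℝ,
    Integrable Q ∧ (∀ p, ρ < ‖p‖ → Q p = 0) ∧ ContDiff ℝ ∞ κ ∧ (∀ p, ρ < ‖p‖ → κ p = 0) ∧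
    ∀ φ : ℝ × Space d → ℝ, ContDiff ℝ ∞ φ → HasCompactSupport φ →
      ∫ p, Q p * heatOp (-1) φ p = φ 0 + ∫ p, κ p * φ p := by
  let η : ContDiffBump (0 : ℝ × Space d) := ⟨ρ / 2, ρ, by positivity, by linarith⟩
  have hη : ContDiff ℝ ∞ η := η.contDiff
  have hηρ : ∀ p : ℝ × Space d, ρ ≤ ‖p‖ → η p = 0 := fun p hp =>
    η.zero_of_le_dist (by simpa [dist_zero_right] using hp)
  set S : ℝ × Space d → ℝ := fun p => causalKernel p - causalKernel p * η p with hS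
  have hSs : ContDiff ℝ ∞ S := by
    rw [contDiff_iff_contDiffAt]
    intro p
    by_cases hp : p = 0
    · refine (contDiffAt_const (c := (0 : ℝ))).congr_of_eventuallyEq ?_
      rw [hp]
      filter_upwards [η.eventuallyEq_one] with q hq
      simp [hS, hq]
    · exact (contDiffAt_causalKernel hp).sub ((contDiffAt_causalKernel hp).mul hη.contDiffAt)
  have hid : ∀ φ : ℝ × Space d → ℝ, ContDiff ℝ ∞ φ → HasCompactSupport φ →
      ∫ p, (causalKernel p * η p) * heatOp (-1) φ p = φ 0 + ∫ p, -heatOp 1 S p * φ p := by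
    intro φ hφ hc
    have hψ : Continuous (heatOp (-1) φ) := (hφ.heatOp (-1)).continuous
    have h1 := integral_mul_heatOp hSs hφ hc 1
    have h2 := integral_causalKernel_mul_heatOp hφ hc
    have h3 : ∀ p, (causalKernel p * η p) * heatOp (-1) φ p =
        causalKernel p * heatOp (-1) φ p - S p * heatOp (-1) φ p := fun p => by
      simp only [hS]
      ring
    simp_rw [h3, neg_mul]
    have h4 : Integrable fun p => S p * heatOp (-1) φ p :=
      (hSs.continuous.mul hψ).integrable_of_hasCompactSupport (hc.heatOp (-1)).mul_left
    rw [integral_sub (integrable_causalKernel_mul hψ (hc.heatOp (-1))) h4, h1, h2, integral_neg]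
    ring
  refine ⟨fun p => causalKernel p * η p, fun p => -heatOp 1 S p,
    integrable_causalKernel_mul hη.continuous η.hasCompactSupport, fun p hp => ?_,
    (hSs.heatOp 1).neg, fun p hp => ?_, hid⟩
  · simp [hηρ p hp.le]
  · have hU : IsOpen {p : ℝ × Space d | ρ < ‖p‖} := isOpen_lt continuous_const continuous_norm
    -- the error term vanishes where the cutoff does, because the heat kernel is caloric there
    refine eqOn_zero_of_integral_mul_eq_zero (μ := volume) hU (hSs.heatOp 1).neg.continuous.continuousOn
      (fun φ hφ hc hsupp => ?_) p hp
    have h1 := hid φ hφ hc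
    have h0 : φ 0 = 0 := by
      by_contra h
      have : (0 : ℝ × Space d) ∈ {p : ℝ × Space d | ρ < ‖p‖} := hsupp (subset_tsupport _ h)
      simp only [mem_ofPred_eq, norm_zero] at this
      linarith
    have h2 : ∀ p, (causalKernel p * η p) * heatOp (-1) φ p = 0 := by
      intro p
      by_cases hp : ρ ≤ ‖p‖
      · simp [hηρ p hp]
      · have : heatOp (-1) φ p = 0 := by
          by_contra h
          have h3 := hsupp (tsupport_heatOp_subset (-1) φ (subset_tsupport _ h))
          exact hp (le_of_lt h3)
        rw [this, mul_zero]
    simp_rw [h2] at h1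
    rw [integral_zero, h0, zero_add] at h1
    exact h1.symm

end Parametrix

/-! ### Hypoellipticity of the heat operator -/

section Hypoelliptic

variable {d : ℕ}

/-- The correlation `q ↦ ∫ k(p) φ(q + p) dp` of an integrable function with a test function. -/
noncomputable def correlation (k φ : ℝ × Space d → ℝ) (q : ℝ × Space d) : ℝ :=
  ∫ p, k p * φ (q + p)

lemma correlation_eq_convolution (k φ : ℝ × Space d → ℝ) :
    correlation k φ = convolution (fun p => k (-p)) φ (ContinuousLinearMap.mul ℝ ℝ) volume := by
  funext q
  rw [convolution_mul, correlation, ← integral_neg_eq_self]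
  simp [sub_eq_add_neg]

section

variable {k φ : ℝ × Space d → ℝ}

lemma contDiff_correlation (hk : Integrable k) (hφ : ContDiff ℝ ∞ φ) (hc : HasCompactSupport φ) :
    ContDiff ℝ ∞ (correlation k φ) := by
  rw [correlation_eq_convolution]
  exact hc.contDiff_convolution_right _ hk.comp_neg.locallyIntegrable hφ

lemma fderiv_correlation_apply (hk : Integrable k) (hφ : ContDiff ℝ ∞ φ) (hc : HasCompactSupport φ)
    (v : ℝ × Space d) :
    (fun q => fderiv ℝ (correlation k φ) q v) = correlation k fun q => fderiv ℝ φ q v := by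
  funext q
  rw [correlation_eq_convolution, correlation_eq_convolution,
    (hc.hasFDerivAt_convolution_right _ hk.comp_neg.locallyIntegrable (hφ.of_le (by simp)) q).fderiv,
    convolution_precompR_apply _ hk.comp_neg.locallyIntegrable (hc.fderiv (𝕜 := ℝ))
      (hφ.continuous_fderiv (by simp))]

lemma integrable_correlation (hk : Integrable k) (hφ : Continuous φ) (hc : HasCompactSupport φ)
    (q : ℝ × Space d) : Integrable fun p => k p * φ (q + p) := by
  obtain ⟨M, hM⟩ := hφ.bounded_above_of_compact_support hc
  exact hk.mul_bdd (by fun_prop : Continuous fun p => φ (q + p)).aestronglyMeasurable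
    (Eventually.of_forall fun p => hM _)

lemma heatOp_correlation (hk : Integrable k) (hφ : ContDiff ℝ ∞ φ) (hc : HasCompactSupport φ)
    (c : ℝ) (q : ℝ × Space d) :
    heatOp c (correlation k φ) q = ∫ p, k p * heatOp c φ (q + p) := by
  have h1 : ∀ e : Space d, spaceDeriv e (spaceDeriv e (correlation k φ)) q =
      ∫ p, k p * spaceDeriv e (spaceDeriv e φ) (q + p) := by
    intro e
    have h2 : spaceDeriv e (correlation k φ) = correlation k (spaceDeriv e φ) :=
      fderiv_correlation_apply hk hφ hc _
    rw [h2]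
    exact congrFun (fderiv_correlation_apply hk (hφ.spaceDeriv e) (hc.spaceDeriv e) _) q
  have h2 : timeDeriv (correlation k φ) q = ∫ p, k p * timeDeriv φ (q + p) :=
    congrFun (fderiv_correlation_apply hk hφ hc _) q
  have hi : ∀ j : Fin d, Integrable fun p => k p * spaceDeriv (EuclideanSpace.single j 1)
      (spaceDeriv (EuclideanSpace.single j 1) φ) (q + p) := fun j =>
    integrable_correlation hk ((hφ.spaceDeriv _).spaceDeriv _).continuous
      ((hc.spaceDeriv _).spaceDeriv _) q
  have hit : Integrable fun p => k p * timeDeriv φ (q + p) :=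
    integrable_correlation hk hφ.timeDeriv.continuous (hc.fderiv_apply ℝ _) q
  unfold heatOp
  simp_rw [h1, h2, mul_sub, Finset.mul_sum]
  have hit' : Integrable fun p => k p * (c * timeDeriv φ (q + p)) := by
    simpa only [mul_left_comm] using hit.const_mul c
  rw [integral_sub hit' (integrable_finsetSum _ fun j _ => hi j),
    integral_finsetSum _ fun j _ => hi j, ← integral_const_mul]
  simp only [mul_left_comm]

/-- Correlation is the adjoint of convolution. -/
lemma integral_mul_correlation {h : ℝ × Space d → ℝ} (hh : Integrable h) (hk : Integrable k)
    (hφ : Continuous φ) (hc : HasCompactSupport φ) :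
    ∫ q, h q * correlation k φ q =
      ∫ q, convolution k h (ContinuousLinearMap.mul ℝ ℝ) volume q * φ q := by
  obtain ⟨M, hM⟩ := hφ.bounded_above_of_compact_support hc
  have h1 : Integrable (fun z : (ℝ × Space d) × (ℝ × Space d) => h z.1 * k z.2 * φ (z.1 + z.2))
      (volume.prod volume) :=
    (hh.mul_prod hk).mul_bdd (by fun_prop : Continuous fun z : (ℝ × Space d) × (ℝ × Space d) =>
      φ (z.1 + z.2)).aestronglyMeasurable (Eventually.of_forall fun z => hM _)
  have h2 : Integrable (fun z : (ℝ × Space d) × (ℝ × Space d) => k z.2 * h (z.1 - z.2) * φ z.1)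
      (volume.prod volume) :=
    (hk.convolution_integrand (ContinuousLinearMap.mul ℝ ℝ) hh).mul_bdd
      (by fun_prop : Continuous fun z : (ℝ × Space d) × (ℝ × Space d) =>
        φ z.1).aestronglyMeasurable (Eventually.of_forall fun z => hM _)
  calc ∫ q, h q * correlation k φ q = ∫ q, ∫ p, h q * k p * φ (q + p) := by
        simp_rw [correlation, ← integral_const_mul, mul_assoc]
    _ = ∫ p, ∫ q, h q * k p * φ (q + p) := integral_integral_swap h1
    _ = ∫ p, ∫ q, k p * h (q - p) * φ q := by
        refine integral_congr_ae (Eventually.of_forall fun p => ?_)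
        simp only
        rw [← integral_sub_right_eq_self _ p]
        simp only [sub_add_cancel, mul_comm (k p)]
    _ = ∫ q, ∫ p, k p * h (q - p) * φ q := (integral_integral_swap h2).symm
    _ = _ := by simp_rw [convolution_mul, integral_mul_const]

end

/-- A continuous distributional solution of the heat equation with smooth right-hand side is a
smooth classical solution. Testing with the correlation of a test function and the parametrix
represents the solution locally by convolutions with smooth functions. -/
theorem contDiffOn_of_weak_solution {U : Set (ℝ × Space d)} (hU : IsOpen U)
    {u F : ℝ × Space d → ℝ} (hu : ContinuousOn u U) (hF : ContDiffOn ℝ ∞ F U)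
    (hweak : ∀ φ : ℝ × Space d → ℝ, ContDiff ℝ ∞ φ → HasCompactSupport φ → tsupport φ ⊆ U →
      ∫ p, u p * heatOp (-1) φ p = ∫ p, F p * φ p) :
    ContDiffOn ℝ ∞ u U ∧ ∀ p ∈ U, heatOp 1 u p = F p := by
  suffices h : ∀ p₀ ∈ U, ContDiffAt ℝ ∞ u p₀ ∧ heatOp 1 u p₀ = F p₀ from
    ⟨fun p hp => (h p hp).1.contDiffWithinAt, fun p hp => (h p hp).2⟩
  intro p₀ hp₀
  obtain ⟨r, hr, hrU⟩ := Metric.isOpen_iff.1 hU p₀ hp₀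
  obtain ⟨ρ, hρ, hρr⟩ : ∃ ρ > 0, 4 * ρ = r := ⟨r / 4, by positivity, by ring⟩
  obtain ⟨Q, κ, hQ, hQs, hκ, hκs, hpar⟩ := exists_parametrix (d := d) hρ
  have hκc : HasCompactSupport κ :=
    HasCompactSupport.intro (isCompact_closedBall (0 : ℝ × Space d) ρ) fun p hp =>
      hκs p (by simpa using hp)
  have hκi : Integrable κ := hκ.continuous.integrable_of_hasCompactSupport hκc
  let ζ : ContDiffBump p₀ := ⟨2 * ρ, 3 * ρ, by positivity, by linarith⟩
  have hζ : ContDiff ℝ ∞ ζ := ζ.contDiff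
  have hζsupp : ∀ p ∈ tsupport ζ, p ∈ U := fun p hp => hrU <| by
    have : dist p p₀ ≤ 3 * ρ := by simpa [ζ.tsupport_eq] using hp
    rw [Metric.mem_ball]
    linarith
  have hζ1 : ∀ p, dist p p₀ ≤ 2 * ρ → ζ p = 1 := fun p hp =>
    ζ.one_of_mem_closedBall (by simpa using hp)
  set u₁ : ℝ × Space d → ℝ := fun p => ζ p * u p with hu₁
  set F₁ : ℝ × Space d → ℝ := fun p => ζ p * F p with hF₁
  have hu₁c : HasCompactSupport u₁ := ζ.hasCompactSupport.mul_right
  have hF₁c : HasCompactSupport F₁ := ζ.hasCompactSupport.mul_right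
  have hu₁cont : Continuous u₁ := continuous_of_tsupport fun p hp => by
    have hpU := hζsupp p (tsupport_mul_subset_left hp)
    exact hζ.continuous.continuousAt.mul (hu.continuousAt (hU.mem_nhds hpU))
  have hF₁s : ContDiff ℝ ∞ F₁ := by
    rw [contDiff_iff_contDiffAt]
    intro p
    by_cases hp : p ∈ tsupport ζ
    · exact hζ.contDiffAt.mul (hF.contDiffAt (hU.mem_nhds (hζsupp p hp)))
    · refine (contDiffAt_const (c := (0 : ℝ))).congr_of_eventuallyEq ?_
      filter_upwards [notMem_tsupport_iff_eventuallyEq.1 hp] with q hq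
      simp [hF₁, hq]
  have hu₁i : Integrable u₁ := hu₁cont.integrable_of_hasCompactSupport hu₁c
  have hF₁i : Integrable F₁ := hF₁s.continuous.integrable_of_hasCompactSupport hF₁c
  set v : ℝ × Space d → ℝ := fun p =>
    convolution Q F₁ (ContinuousLinearMap.mul ℝ ℝ) volume p -
      convolution κ u₁ (ContinuousLinearMap.mul ℝ ℝ) volume p with hv
  have hvs : ContDiff ℝ ∞ v :=
    (hF₁c.contDiff_convolution_right _ hQ.locallyIntegrable hF₁s).sub
      (hκc.contDiff_convolution_left _ hκ hu₁i.locallyIntegrable)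
  have hball : Metric.ball p₀ ρ ⊆ U := (Metric.ball_subset_ball (by linarith)).trans hrU
  have hrep : ∀ φ : ℝ × Space d → ℝ, ContDiff ℝ ∞ φ → HasCompactSupport φ →
      tsupport φ ⊆ Metric.ball p₀ ρ → ∫ p, (u₁ p - v p) * φ p = 0 := by
    intro φ hφ hc hsupp
    set Φ := correlation Q φ with hΦ
    have hΦs : ContDiff ℝ ∞ Φ := contDiff_correlation hQ hφ hc
    have hΦ0 : ∀ q, 2 * ρ < dist q p₀ → Φ q = 0 := by
      intro q hq
      refine integral_eq_zero_of_ae (Eventually.of_forall fun p => ?_)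
      by_cases hp : ρ < ‖p‖
      · simp [hQs p hp]
      · have : φ (q + p) = 0 := by
          by_contra h
          have h1 : dist (q + p) p₀ < ρ := hsupp (subset_tsupport _ h)
          have h2 : dist q p₀ ≤ dist q (q + p) + dist (q + p) p₀ := dist_triangle _ _ _
          rw [dist_self_add_right] at h2
          linarith
        simp [this]
    have hΦt : tsupport Φ ⊆ Metric.closedBall p₀ (2 * ρ) := by
      refine closure_minimal (fun q hq => ?_) Metric.isClosed_closedBall
      by_contra h
      exact hq (hΦ0 q (by simpa using h))
    have hΦc : HasCompactSupport Φ :=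
      (isCompact_closedBall p₀ (2 * ρ)).of_isClosed_subset (isClosed_tsupport _) hΦt
    have hΦU : tsupport Φ ⊆ U :=
      hΦt.trans ((Metric.closedBall_subset_ball (by linarith)).trans hrU)
    have hLΦ : ∀ q, heatOp (-1) Φ q = φ q + correlation κ φ q := by
      intro q
      have hφq : ContDiff ℝ ∞ fun p => φ (p + q) := hφ.comp (contDiff_id.add contDiff_const)
      have h1 := hpar _ hφq (hc.comp_homeomorph (Homeomorph.addRight q))
      simp only [heatOp_comp_add_right, zero_add] at h1
      rw [hΦ, heatOp_correlation hQ hφ hc, correlation]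
      simpa only [add_comm q] using h1
    have e1 : ∀ p, u p * heatOp (-1) Φ p = u₁ p * (φ p + correlation κ φ p) := by
      intro p
      rw [← hLΦ]
      by_cases hp : dist p p₀ ≤ 2 * ρ
      · simp [hu₁, hζ1 p hp]
      · have : heatOp (-1) Φ p = 0 := by
          by_contra h
          exact hp (by simpa using hΦt (tsupport_heatOp_subset _ _ (subset_tsupport _ h)))
        simp [this]
    have e2 : ∀ p, F p * Φ p = F₁ p * Φ p := by
      intro p
      by_cases hp : dist p p₀ ≤ 2 * ρ
      · simp [hF₁, hζ1 p hp]
      · simp [hΦ0 p (not_le.1 hp)]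
    have h1 := hweak Φ hΦs hΦc hΦU
    simp_rw [e1, e2, mul_add] at h1
    have i1 : Integrable fun p => u₁ p * φ p :=
      (hu₁cont.mul hφ.continuous).integrable_of_hasCompactSupport hc.mul_left
    have i2 : Integrable fun p => u₁ p * correlation κ φ p :=
      (hu₁cont.mul (contDiff_correlation hκi hφ hc).continuous).integrable_of_hasCompactSupport
        hu₁c.mul_right
    have i3 : Integrable fun p => convolution Q F₁ (ContinuousLinearMap.mul ℝ ℝ) volume p * φ p :=
      ((hF₁c.contDiff_convolution_right (ContinuousLinearMap.mul ℝ ℝ) hQ.locallyIntegrable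
        hF₁s).continuous.mul hφ.continuous).integrable_of_hasCompactSupport hc.mul_left
    have i4 : Integrable fun p => convolution κ u₁ (ContinuousLinearMap.mul ℝ ℝ) volume p * φ p :=
      ((hκc.contDiff_convolution_left (ContinuousLinearMap.mul ℝ ℝ) hκ
        hu₁i.locallyIntegrable).continuous.mul hφ.continuous).integrable_of_hasCompactSupport
          hc.mul_left
    rw [integral_add i1 i2, integral_mul_correlation hu₁i hκi hφ.continuous hc, hΦ,
      integral_mul_correlation hF₁i hQ hφ.continuous hc] at h1
    have e3 : ∀ p, (u₁ p - v p) * φ p = u₁ p * φ p -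
        (convolution Q F₁ (ContinuousLinearMap.mul ℝ ℝ) volume p * φ p -
          convolution κ u₁ (ContinuousLinearMap.mul ℝ ℝ) volume p * φ p) := fun p => by
      simp only [hv]
      ring
    simp_rw [e3]
    have i5 : Integrable fun p =>
        convolution Q F₁ (ContinuousLinearMap.mul ℝ ℝ) volume p * φ p -
          convolution κ u₁ (ContinuousLinearMap.mul ℝ ℝ) volume p * φ p := i3.sub i4
    rw [integral_sub i1 i5, integral_sub i3 i4]
    linarith
  have huv : ∀ p ∈ Metric.ball p₀ ρ, u p = v p := by
    intro p hp
    have h1 : u₁ p - v p = 0 := eqOn_zero_of_integral_mul_eq_zero (μ := volume) Metric.isOpen_ball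
      (hu₁cont.sub hvs.continuous).continuousOn hrep p hp
    have h2 : u₁ p = u p := by
      have : dist p p₀ ≤ 2 * ρ := by
        have := Metric.mem_ball.1 hp
        linarith
      simp [hu₁, hζ1 p this]
    linarith
  have hev : u =ᶠ[𝓝 p₀] v := by
    filter_upwards [Metric.ball_mem_nhds p₀ hρ] with p hp using huv p hp
  refine ⟨hvs.contDiffAt.congr_of_eventuallyEq hev, ?_⟩
  rw [heatOp_congr_of_eventuallyEq hev]
  have h1 := eqOn_zero_of_integral_mul_eq_zero (μ := volume) (f := fun p => heatOp 1 v p - F p)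
    Metric.isOpen_ball ((hvs.heatOp 1).continuous.continuousOn.sub (hF.continuousOn.mono hball))
    (fun φ hφ hc hsupp => ?_) p₀ (Metric.mem_ball_self hρ)
  · exact sub_eq_zero.1 h1
  · have h2 := hweak φ hφ hc (hsupp.trans hball)
    have h3 : ∀ p, u p * heatOp (-1) φ p = v p * heatOp (-1) φ p := by
      intro p
      by_cases hp : p ∈ Metric.ball p₀ ρ
      · rw [huv p hp]
      · have : heatOp (-1) φ p = 0 := by
          by_contra h
          exact hp (hsupp (tsupport_heatOp_subset _ _ (subset_tsupport _ h)))
        simp [this]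
    simp_rw [h3] at h2
    rw [integral_mul_heatOp hvs hφ hc 1] at h2
    have i1 : Integrable fun p => heatOp 1 v p * φ p :=
      ((hvs.heatOp 1).continuous.mul hφ.continuous).integrable_of_hasCompactSupport hc.mul_left
    have i2 : Integrable fun p => F p * φ p := by
      refine Continuous.integrable_of_hasCompactSupport (continuous_of_tsupport fun p hp => ?_)
        hc.mul_left
      have hpU := hball (hsupp (tsupport_mul_subset_right hp))
      exact (hF.continuousOn.continuousAt (hU.mem_nhds hpU)).mul hφ.continuous.continuousAt
    simp_rw [sub_mul]
    rw [integral_sub i1 i2, h2, sub_self]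

end Hypoelliptic

/-! ### The interior gradient estimate -/

section GradientEstimate

lemma second_deriv_nonpos_of_isLocalMax {f f' : ℝ → ℝ} {f'' a : ℝ}
    (h1 : ∀ᶠ s in 𝓝 a, HasDerivAt f (f' s) s) (h2 : HasDerivAt f' f'' a) (hmax : IsLocalMax f a) :
    f'' ≤ 0 := by
  by_contra! hpos
  have hd : deriv f =ᶠ[𝓝 a] f' := h1.mono fun s hs => hs.deriv
  have hdd : deriv (deriv f) a = f'' := by rw [hd.deriv_eq, h2.deriv]
  have hmin : IsLocalMin f a := isLocalMin_of_deriv_deriv_pos (by rw [hdd]; exact hpos)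
    hmax.deriv_eq_zero h1.self_of_nhds.continuousAt
  have hconst : f =ᶠ[𝓝 a] fun _ => f a := by
    filter_upwards [hmax, hmin] with s h h' using le_antisymm h h'
  have h0 : deriv f =ᶠ[𝓝 a] fun _ => 0 := by
    refine hconst.deriv.trans (Eventually.of_forall fun s => ?_)
    simp
  rw [h0.deriv_eq, deriv_const] at hdd
  exact hpos.ne hdd

lemma deriv_nonneg_of_le_left {f : ℝ → ℝ} {f' a : ℝ} (h : HasDerivAt f f' a)
    (hle : ∀ᶠ s in 𝓝[<] a, f s ≤ f a) : 0 ≤ f' := by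
  have h1 : Tendsto (slope f a) (𝓝[<] a) (𝓝 f') :=
    (hasDerivAt_iff_tendsto_slope.1 h).mono_left (nhdsWithin_mono a fun s hs => (mem_Iio.1 hs).ne)
  refine ge_of_tendsto h1 ?_
  filter_upwards [hle, self_mem_nhdsWithin] with s hs hsa
  rw [slope_def_field]
  exact div_nonneg_of_nonpos (by linarith) (by linarith [mem_Iio.1 hsa])

lemma deriv_le_of_le_mul {f : ℝ → ℝ} {f' K : ℝ} (h : HasDerivAt f f' 0)
    (hle : ∀ᶠ s in 𝓝[>] (0 : ℝ), f s - f 0 ≤ K * s) : f' ≤ K := by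
  have h1 : Tendsto (slope f 0) (𝓝[>] 0) (𝓝 f') :=
    (hasDerivAt_iff_tendsto_slope.1 h).mono_left (nhdsWithin_mono 0 fun s hs => (mem_Ioi.1 hs).ne')
  refine le_of_tendsto h1 ?_
  filter_upwards [hle, self_mem_nhdsWithin] with s hs hs0
  rw [slope_def_field, sub_zero, div_le_iff₀ hs0]
  exact hs

variable {d : ℕ} {U : Set (ℝ × Space d)} {v : ℝ × Space d → ℝ}

lemma hasDerivAt_line {p : ℝ × Space d} (h : DifferentiableAt ℝ v p) {s : ℝ} {x a : Space d}
    (hp : p = (p.1, x + s • a)) :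
    HasDerivAt (fun r : ℝ => v (p.1, x + r • a)) (spaceDeriv a v p) s := by
  have h1 : HasDerivAt (fun r : ℝ => (p.1, x + r • a)) ((0 : ℝ), a) s := by
    refine (hasDerivAt_const s p.1).prodMk ?_
    simpa using ((hasDerivAt_id s).smul_const a).const_add x
  have h2 : HasFDerivAt v (fderiv ℝ v p) (p.1, x + s • a) := by
    rw [← hp]
    exact h.hasFDerivAt
  exact h2.comp_hasDerivAt s h1

/-- The Laplacian of a time slice, computed in any orthonormal basis. -/
lemma laplacian_slice {ι : Type*} [Fintype ι] (b : OrthonormalBasis ι ℝ (Space d)) (hU : IsOpen U)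
    (hv : ContDiffOn ℝ ∞ v U) {p : ℝ × Space d} (hp : p ∈ U) :
    Laplacian.laplacian (fun x => v (p.1, x)) p.2 = ∑ i, spaceDeriv (b i) (spaceDeriv (b i) v) p := by
  rw [InnerProductSpace.laplacian_eq_iteratedFDeriv_orthonormalBasis _ b]
  refine Finset.sum_congr rfl fun i _ => ?_
  have hcont : ContinuousAt (fun x : Space d => (p.1, x)) p.2 := by fun_prop
  have hev : ∀ᶠ x in 𝓝 p.2, (p.1, x) ∈ U := hcont.eventually (hU.mem_nhds hp)
  have hsl : ContDiffAt ℝ ∞ (fun x => v (p.1, x)) p.2 :=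
    ContDiffAt.comp p.2 (f := fun x : Space d => (p.1, x)) (hv.contDiffAt (hU.mem_nhds hp))
      (by fun_prop)
  have hdd : DifferentiableAt ℝ (fderiv ℝ fun x => v (p.1, x)) p.2 :=
    (hsl.fderiv_right (m := ∞) (by simp)).differentiableAt (by simp)
  have h1 : (fun x => fderiv ℝ (fun x => v (p.1, x)) x (b i)) =ᶠ[𝓝 p.2]
      fun x => spaceDeriv (b i) v (p.1, x) := by
    filter_upwards [hev] with x hx
    exact fderiv_slice (p := (p.1, x))
      ((hv.contDiffAt (hU.mem_nhds hx)).differentiableAt (by simp)) _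
  have h2 : fderiv ℝ (fun x => fderiv ℝ (fun x => v (p.1, x)) x (b i)) p.2 (b i) =
      spaceDeriv (b i) (spaceDeriv (b i) v) p := by
    rw [h1.fderiv_eq]
    exact fderiv_slice (((hv.spaceDeriv hU _).contDiffAt (hU.mem_nhds hp)).differentiableAt
      (by simp)) _
  rw [iteratedFDeriv_two_apply, ← h2, fderiv_clm_apply hdd (differentiableAt_const _)]
  simp

lemma heatOp_eq_laplacian {ι : Type*} [Fintype ι] (b : OrthonormalBasis ι ℝ (Space d))
    (hU : IsOpen U) (hv : ContDiffOn ℝ ∞ v U) (c : ℝ) {p : ℝ × Space d} (hp : p ∈ U) :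
    heatOp c v p = c * timeDeriv v p - ∑ i, spaceDeriv (b i) (spaceDeriv (b i) v) p := by
  rw [← laplacian_slice b hU hv hp, laplacian_slice (EuclideanSpace.basisFun (Fin d) ℝ) hU hv hp]
  simp [heatOp]

/-- The comparison argument behind the gradient estimate: the odd part of `v` under the reflection
in the hyperplane orthogonal to `e` is dominated by an explicit supersolution. -/
lemma reflection_difference_le (hU : IsOpen U) (hv : ContDiffOn ℝ ∞ v U) {t₀ : ℝ} {x₀ : Space d}
    {r M N : ℝ} (hr : 0 < r) (hM0 : 0 < M)
    (hcyl : ∀ t ∈ Icc (t₀ - r ^ 2) t₀, ∀ z : Space d, ‖z‖ ≤ r → (t, x₀ + z) ∈ U)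
    (hM : ∀ t ∈ Icc (t₀ - r ^ 2) t₀, ∀ z : Space d, ‖z‖ ≤ r → |v (t, x₀ + z)| ≤ M)
    (hN : ∀ t ∈ Icc (t₀ - r ^ 2) t₀, ∀ z : Space d, ‖z‖ ≤ r → |heatOp 1 v (t, x₀ + z)| ≤ N)
    {e : Space d} (he : ‖e‖ = 1) {y : ℝ} (hy0 : 0 ≤ y) (hyr : y ≤ r) :
    (v (t₀, x₀ + y • e) - v (t₀, x₀ - y • e)) / 2 ≤
      M / r ^ 2 * (y ^ 2 + (d + 1) * (y * (r - y))) + N * (y * (r - y)) / 2 := by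
  have hee : inner ℝ e e = (1 : ℝ) := by rw [real_inner_self_eq_norm_sq, he, one_pow]
  have hr2 : 0 < r ^ 2 := by positivity
  set S : Space d ≃ₗᵢ[ℝ] Space d := (ℝ ∙ e)ᗮ.reflection with hS
  have hSz : ∀ z : Space d, S z = z - (2 * inner ℝ z e) • e := by
    intro z
    rw [hS, Submodule.reflection_orthogonal_apply, Submodule.reflection_singleton_apply, he,
      real_inner_comm]
    simp [two_smul, two_mul, add_smul]
  have hSn : ∀ z : Space d, ‖S z‖ = ‖z‖ := S.norm_map
  have hN0 : 0 ≤ N := (abs_nonneg _).trans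
    (hN t₀ ⟨by linarith, le_rfl⟩ 0 (by simpa using hr.le))
  -- the supersolution: the first part absorbs the boundary values, the second the right-hand side
  set ψ : ℝ → Space d → ℝ := fun t z =>
    M / r ^ 2 * (‖z‖ ^ 2 + (t₀ - t) + (d + 1) * (inner ℝ z e * (r - inner ℝ z e))) +
      N * (inner ℝ z e * (r - inner ℝ z e)) / 2 with hψ
  set θ : ℝ × Space d → ℝ := fun q =>
    (v (q.1, x₀ + q.2) - v (q.1, x₀ + S q.2)) / 2 - ψ q.1 q.2 with hθ
  set D : Set (ℝ × Space d) :=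
    (Icc (t₀ - r ^ 2) t₀ ×ˢ Metric.closedBall 0 r) ∩ {q | 0 ≤ inner ℝ q.2 e} with hD
  have hDc : IsCompact D := (isCompact_Icc.prod (isCompact_closedBall 0 r)).inter_right
    (isClosed_le continuous_const (by fun_prop))
  have hDmem : ∀ q, q ∈ D ↔ (q.1 ∈ Icc (t₀ - r ^ 2) t₀ ∧ ‖q.2‖ ≤ r) ∧ 0 ≤ inner ℝ q.2 e := by
    intro q
    simp [hD]
  have hθc : ContinuousOn θ D := by
    have h1 : ∀ L : Space d → Space d, Continuous L → (∀ z, ‖L z‖ = ‖z‖) →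
        ContinuousOn (fun q : ℝ × Space d => v (q.1, x₀ + L q.2)) D := by
      intro L hL hLn
      refine hv.continuousOn.comp (by fun_prop) fun q hq => ?_
      have := (hDmem q).1 hq
      exact hcyl q.1 this.1.1 _ (by rw [hLn]; exact this.1.2)
    have h2 : ContinuousOn (fun q : ℝ × Space d => ψ q.1 q.2) D := by
      simp only [hψ]
      fun_prop
    exact (((h1 id continuous_id fun _ => rfl).sub (h1 S S.continuous hSn)).div_const 2).sub h2
  have hyD : (t₀, y • e) ∈ D := by
    rw [hDmem]
    simp only [norm_smul, he, inner_smul_left, hee, Real.norm_of_nonneg hy0]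
    exact ⟨⟨⟨by linarith, le_rfl⟩, by simpa using hyr⟩, by simpa using hy0⟩
  obtain ⟨⟨t, z⟩, hqD, hqmax⟩ := hDc.exists_isMaxOn ⟨_, hyD⟩ hθc
  obtain ⟨⟨htI, hzr⟩, hze⟩ := (hDmem _).1 hqD
  simp only at htI hzr hze
  have hzer : inner ℝ z e ≤ r := by
    have := real_inner_le_norm z e
    rw [he, mul_one] at this
    linarith
  -- the supersolution is nonnegative, and at least `M` on the lateral and bottom boundary
  have hψ1 : M / r ^ 2 * (‖z‖ ^ 2 + (t₀ - t)) ≤ ψ t z := by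
    have h1 : 0 ≤ inner ℝ z e * (r - inner ℝ z e) := mul_nonneg hze (by linarith)
    simp only [hψ]
    have h2 : 0 ≤ M / r ^ 2 * ((d + 1) * (inner ℝ z e * (r - inner ℝ z e))) := by positivity
    have h3 : 0 ≤ N * (inner ℝ z e * (r - inner ℝ z e)) / 2 := by positivity
    nlinarith
  have hvM : (v (t, x₀ + z) - v (t, x₀ + S z)) / 2 ≤ M := by
    have h1 := (abs_le.1 (hM t htI z hzr)).2
    have h2 := (abs_le.1 (hM t htI (S z) (by rw [hSn]; exact hzr))).1
    linarith
  have hθle : θ (t, z) ≤ 0 := by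
    by_contra! hpos
    have hθz : θ (t, z) = (v (t, x₀ + z) - v (t, x₀ + S z)) / 2 - ψ t z := rfl
    have hMr : M = M / r ^ 2 * r ^ 2 := by field_simp
    have hMr0 : 0 < M / r ^ 2 := by positivity
    have hzr' : ‖z‖ < r := by
      refine lt_of_le_of_ne hzr fun h => ?_
      rw [h] at hψ1
      nlinarith [mul_nonneg hMr0.le (sub_nonneg.2 htI.2)]
    have ht' : t₀ - r ^ 2 < t := by
      refine lt_of_le_of_ne htI.1 fun h => ?_
      have h' : t₀ - t = r ^ 2 := by linarith
      rw [h'] at hψ1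
      nlinarith [mul_nonneg hMr0.le (sq_nonneg ‖z‖)]
    have hze' : 0 < inner ℝ z e := by
      refine lt_of_le_of_ne hze fun h => ?_
      have h1 : S z = z := by rw [hSz, ← h]; simp
      have h2 : 0 ≤ ψ t z := le_trans
        (mul_nonneg hMr0.le (add_nonneg (sq_nonneg _) (sub_nonneg.2 htI.2))) hψ1
      rw [h1, sub_self, zero_div] at hθz
      linarith
    have hp1 : (t, x₀ + z) ∈ U := hcyl t htI z hzr
    have hp2 : (t, x₀ + S z) ∈ U := hcyl t htI (S z) (by rw [hSn]; exact hzr)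
    have hdiff : ∀ {f : ℝ × Space d → ℝ} {p}, ContDiffOn ℝ ∞ f U → p ∈ U →
        DifferentiableAt ℝ f p := fun hf hp =>
      (hf.contDiffAt (hU.mem_nhds hp)).differentiableAt (by simp)
    -- at a positive interior maximum, the time derivative is nonnegative
    have htime : 0 ≤ (timeDeriv v (t, x₀ + z) - timeDeriv v (t, x₀ + S z)) / 2 + M / r ^ 2 := by
      have h1a : HasDerivAt (fun s => v (s, x₀ + z)) (timeDeriv v (t, x₀ + z)) t :=
        hasDerivAt_slice (hdiff hv hp1)
      have h1b : HasDerivAt (fun s => v (s, x₀ + S z)) (timeDeriv v (t, x₀ + S z)) t :=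
        hasDerivAt_slice (hdiff hv hp2)
      have h1 := (h1a.sub h1b).div_const 2
      have h2 : HasDerivAt (fun s => ψ s z) (-(M / r ^ 2)) t := by
        have h3 := (((((hasDerivAt_id t).const_sub t₀).const_add (‖z‖ ^ 2)).add_const
          ((d + 1) * (inner ℝ z e * (r - inner ℝ z e)))).const_mul (M / r ^ 2)).add_const
            (N * (inner ℝ z e * (r - inner ℝ z e)) / 2)
        exact h3.congr_deriv (by ring)
      have h3 := deriv_nonneg_of_le_left (h1.sub h2) ?_
      · linarith
      · filter_upwards [Ioo_mem_nhdsLT ht'] with s hs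
        exact hqmax ((hDmem (s, z)).2 ⟨⟨⟨hs.1.le, hs.2.le.trans htI.2⟩, hzr⟩, hze⟩)
    -- and the pure second derivatives are nonpositive
    have hspace : ∀ a : Space d,
        (spaceDeriv a (spaceDeriv a v) (t, x₀ + z) -
          spaceDeriv (S a) (spaceDeriv (S a) v) (t, x₀ + S z)) / 2 ≤
        M / r ^ 2 * (2 * ‖a‖ ^ 2 - 2 * (d + 1) * inner ℝ a e ^ 2) - N * inner ℝ a e ^ 2 := by
      intro a
      have hline : ∀ x b : Space d, (t, x) ∈ U →
          (∀ᶠ s in 𝓝 (0 : ℝ), HasDerivAt (fun s : ℝ => v (t, x + s • b))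
            (spaceDeriv b v (t, x + s • b)) s) ∧
          HasDerivAt (fun s : ℝ => spaceDeriv b v (t, x + s • b))
            (spaceDeriv b (spaceDeriv b v) (t, x)) 0 := by
        intro x b hx
        refine ⟨?_, hasDerivAt_line (p := (t, x)) (hdiff (hv.spaceDeriv hU b) hx) (by simp)⟩
        have hcont : ContinuousAt (fun s : ℝ => (t, x + s • b)) 0 := by fun_prop
        have hev : ∀ᶠ s in 𝓝 (0 : ℝ), (t, x + s • b) ∈ U :=
          hcont.eventually (hU.mem_nhds (by simpa using hx))
        filter_upwards [hev] with s hs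
        exact hasDerivAt_line (p := (t, x + s • b)) (hdiff hv hs) rfl
      obtain ⟨h1, h1'⟩ := hline (x₀ + z) a hp1
      obtain ⟨h2, h2'⟩ := hline (x₀ + S z) (S a) hp2
      set β : ℝ := M / r ^ 2 * (2 * inner ℝ z a + (d + 1) * (inner ℝ a e * (r - 2 * inner ℝ z e))) +
        N * (inner ℝ a e * (r - 2 * inner ℝ z e)) / 2 with hβ
      set γ : ℝ := M / r ^ 2 * (‖a‖ ^ 2 - (d + 1) * inner ℝ a e ^ 2) - N * inner ℝ a e ^ 2 / 2 with hγ
      have hψs : ∀ s : ℝ, ψ t (z + s • a) = ψ t z + s * β + s ^ 2 * γ := by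
        intro s
        simp only [hψ, hβ, hγ]
        rw [norm_add_sq_real, inner_add_left, inner_smul_left, inner_smul_right, norm_smul, mul_pow,
          Real.norm_eq_abs, sq_abs, conj_trivial]
        ring
      have hψ1 : ∀ s : ℝ, HasDerivAt (fun s : ℝ => ψ t (z + s • a)) (β + 2 * s * γ) s := by
        intro s
        have h3 := (((hasDerivAt_id s).mul_const β).const_add (ψ t z)).add
          (((hasDerivAt_id s).pow 2).mul_const γ)
        refine (h3.congr_deriv ?_).congr_of_eventuallyEq (Eventually.of_forall fun s => ?_)
        · simp
        · simp [hψs s]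
      have hψ2 : HasDerivAt (fun s : ℝ => β + 2 * s * γ) (2 * γ) 0 := by
        have h3 := (((hasDerivAt_id (0 : ℝ)).const_mul 2).mul_const γ).const_add β
        exact h3.congr_deriv (by ring)
      have h4 := second_deriv_nonpos_of_isLocalMax (a := 0)
        (f := fun s : ℝ => θ (t, z + s • a))
        (f' := fun s => (spaceDeriv a v (t, x₀ + z + s • a) -
          spaceDeriv (S a) v (t, x₀ + S z + s • S a)) / 2 - (β + 2 * s * γ)) ?_
        (((h1'.sub h2').div_const 2).sub hψ2) ?_
      · simp only [hγ] at h4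
        linarith
      · filter_upwards [h1, h2] with s hs1 hs2
        have h5 := ((hs1.sub hs2).div_const 2).sub (hψ1 s)
        refine h5.congr_of_eventuallyEq (Eventually.of_forall fun s => ?_)
        simp only [hθ, Pi.sub_apply, map_add, map_smul, add_assoc]
      · have hc1 : ContinuousAt (fun s : ℝ => ‖z + s • a‖) 0 := by fun_prop
        have hc2 : ContinuousAt (fun s : ℝ => inner ℝ (z + s • a) e) 0 := by fun_prop
        filter_upwards [hc1.eventually_lt_const (by simpa using hzr'),
          hc2.eventually_const_lt (by simpa using hze')] with s hs1 hs2
        simp only [zero_smul, add_zero]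
        exact hqmax ((hDmem (t, z + s • a)).2 ⟨⟨htI, hs1.le⟩, hs2.le⟩)
    set b := EuclideanSpace.basisFun (Fin d) ℝ with hb
    have hsum := Finset.sum_le_sum fun j (_ : j ∈ Finset.univ) => hspace (b j)
    have hb1 : ∑ j, inner ℝ (b j) e ^ 2 = 1 := by
      rw [b.sum_sq_inner_right, he, one_pow]
    have hb2 : ∑ j, ‖b j‖ ^ 2 = (d : ℝ) := by
      simp [b.norm_eq_one]
    rw [← Finset.sum_div, Finset.sum_sub_distrib, Finset.sum_sub_distrib, ← Finset.mul_sum,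
      Finset.sum_sub_distrib, ← Finset.mul_sum, ← Finset.mul_sum, ← Finset.mul_sum, hb1, hb2] at hsum
    have hL1 := heatOp_eq_laplacian b hU hv 1 hp1
    have hL2 := heatOp_eq_laplacian (b.map S) hU hv 1 hp2
    simp only [OrthonormalBasis.map_apply] at hL2
    have h5 := (abs_le.1 (hN t htI z hzr)).2
    have h6 := (abs_le.1 (hN t htI (S z) (by rw [hSn]; exact hzr))).1
    nlinarith
  have h1 : θ (t₀, y • e) ≤ 0 := (hqmax hyD).trans hθle
  have h2 : S (y • e) = -(y • e) := by
    rw [hSz, inner_smul_left, hee]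
    simp [two_mul, add_smul]
  have h3 : ψ t₀ (y • e) =
      M / r ^ 2 * (y ^ 2 + (d + 1) * (y * (r - y))) + N * (y * (r - y)) / 2 := by
    simp only [hψ, inner_smul_left, hee, norm_smul, he, Real.norm_eq_abs, mul_one, sq_abs,
      conj_trivial, sub_self, add_zero]
  simp only [hθ, h2, h3] at h1
  rw [← sub_eq_add_neg] at h1
  linarith

/-- The interior gradient estimate for the heat equation. -/
theorem abs_spaceDeriv_le (hU : IsOpen U) (hv : ContDiffOn ℝ ∞ v U) {p₀ : ℝ × Space d}
    {r M N : ℝ} (hr : 0 < r) (hr1 : r ≤ 1) (hM0 : 0 < M) (hball : Metric.closedBall p₀ r ⊆ U)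
    (hM : ∀ p ∈ Metric.closedBall p₀ r, |v p| ≤ M)
    (hN : ∀ p ∈ Metric.closedBall p₀ r, |heatOp 1 v p| ≤ N) {e : Space d} (he : ‖e‖ = 1) :
    |spaceDeriv e v p₀| ≤ (d + 1) * M / r + N * r / 2 := by
  obtain ⟨t₀, x₀⟩ := p₀
  have hmem : ∀ t ∈ Icc (t₀ - r ^ 2) t₀, ∀ z : Space d, ‖z‖ ≤ r →
      (t, x₀ + z) ∈ Metric.closedBall (t₀, x₀) r := by
    intro t ht z hz
    rw [Metric.mem_closedBall, Prod.dist_eq]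
    refine max_le ?_ (by simpa using hz)
    rw [Real.dist_eq, abs_le]
    constructor <;> nlinarith [ht.1, ht.2]
  have key : ∀ e : Space d, ‖e‖ = 1 → spaceDeriv e v (t₀, x₀) ≤ (d + 1) * M / r + N * r / 2 := by
    intro e he
    have hN0 : 0 ≤ N := (abs_nonneg _).trans (hN _ (Metric.mem_closedBall_self hr.le))
    have hd : DifferentiableAt ℝ v (t₀, x₀) := (hv.contDiffAt (hU.mem_nhds
      (hball (Metric.mem_closedBall_self hr.le)))).differentiableAt (by simp)
    have h1 : HasDerivAt (fun s : ℝ => v (t₀, x₀ + s • e)) (spaceDeriv e v (t₀, x₀)) 0 :=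
      hasDerivAt_line (p := (t₀, x₀)) hd (by simp)
    have h2 : HasDerivAt (fun s : ℝ => v (t₀, x₀ + s • -e)) (spaceDeriv (-e) v (t₀, x₀)) 0 :=
      hasDerivAt_line (p := (t₀, x₀)) hd (by simp)
    have h3 : spaceDeriv (-e) v (t₀, x₀) = -spaceDeriv e v (t₀, x₀) := by
      have : ((0 : ℝ), -e) = -((0 : ℝ), e) := by simp
      rw [spaceDeriv, spaceDeriv, this, map_neg]
    have h4 := (h1.sub h2).div_const 2
    rw [h3, sub_neg_eq_add, add_self_div_two] at h4
    refine deriv_le_of_le_mul h4 ?_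
    filter_upwards [Ioc_mem_nhdsGT hr] with s hs
    have h5 := reflection_difference_le hU hv hr hM0 (fun t ht z hz => hball (hmem t ht z hz))
      (fun t ht z hz => hM _ (hmem t ht z hz)) (fun t ht z hz => hN _ (hmem t ht z hz)) he
      hs.1.le hs.2
    simp only [Pi.sub_apply, zero_smul, smul_neg, add_zero, sub_self, zero_div, sub_zero,
      ← sub_eq_add_neg]
    refine h5.trans ?_
    have h6 : M / r ^ 2 * (s ^ 2 + (d + 1) * (s * (r - s))) ≤ (d + 1) * M / r * s := by
      have h7 : (d + 1) * M / r * s = M / r ^ 2 * ((d + 1) * (s * r)) := by field_simp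
      rw [h7]
      have h8 : (0 : ℝ) ≤ d * s ^ 2 := by positivity
      refine mul_le_mul_of_nonneg_left ?_ (by positivity)
      nlinarith
    have h9 : N * (s * (r - s)) / 2 ≤ N * r / 2 * s := by
      nlinarith [mul_nonneg hN0 (sq_nonneg s)]
    linarith
  rw [abs_le]
  refine ⟨?_, key e he⟩
  have h1 := key (-e) (by rwa [norm_neg])
  have h2 : spaceDeriv (-e) v (t₀, x₀) = -spaceDeriv e v (t₀, x₀) := by
    have : ((0 : ℝ), -e) = -((0 : ℝ), e) := by simp
    rw [spaceDeriv, spaceDeriv, this, map_neg]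
  linarith

end GradientEstimate

/-! ### Cauchy estimates and spatial analyticity -/

section Analyticity

variable {d : ℕ} {U : Set (ℝ × Space d)}

/-- The iterated spatial derivative in the directions of a list, the head being the outermost. -/
noncomputable def iterSpaceDeriv (l : List (Space d)) (v : ℝ × Space d → ℝ) : ℝ × Space d → ℝ :=
  l.foldr spaceDeriv v

lemma iterSpaceDeriv_cons (e : Space d) (l : List (Space d)) (v : ℝ × Space d → ℝ) :
    iterSpaceDeriv (e :: l) v = spaceDeriv e (iterSpaceDeriv l v) := rfl

lemma ContDiffOn.iterSpaceDeriv {v : ℝ × Space d → ℝ} (hv : ContDiffOn ℝ ∞ v U) (hU : IsOpen U)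
    (l : List (Space d)) : ContDiffOn ℝ ∞ (iterSpaceDeriv l v) U := by
  induction l with
  | nil => exact hv
  | cons e l ih => exact ih.spaceDeriv hU e

lemma heatOp_iterSpaceDeriv {v : ℝ × Space d → ℝ} (hU : IsOpen U) (hv : ContDiffOn ℝ ∞ v U)
    (c : ℝ) (l : List (Space d)) :
    ∀ p ∈ U, heatOp c (iterSpaceDeriv l v) p = iterSpaceDeriv l (heatOp c v) p := by
  induction l with
  | nil => exact fun p _ => rfl
  | cons e l ih =>
    intro p hp
    rw [iterSpaceDeriv_cons, iterSpaceDeriv_cons,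
      heatOp_spaceDeriv hU (hv.iterSpaceDeriv hU l) c e hp]
    have h1 : heatOp c (iterSpaceDeriv l v) =ᶠ[𝓝 p] iterSpaceDeriv l (heatOp c v) := by
      filter_upwards [hU.mem_nhds hp] with q hq using ih q hq
    rw [spaceDeriv, h1.fderiv_eq]
    rfl

lemma iterSpaceDeriv_congr {v w : ℝ × Space d → ℝ} (hU : IsOpen U) (h : ∀ p ∈ U, v p = w p)
    (l : List (Space d)) : ∀ p ∈ U, iterSpaceDeriv l v p = iterSpaceDeriv l w p := by
  induction l with
  | nil => exact h
  | cons e l ih =>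
    intro p hp
    have h1 : iterSpaceDeriv l v =ᶠ[𝓝 p] iterSpaceDeriv l w := by
      filter_upwards [hU.mem_nhds hp] with q hq using ih q hq
    rw [iterSpaceDeriv_cons, spaceDeriv, h1.fderiv_eq]
    rfl

/-- Cauchy estimates for solutions of the heat equation with analytic right-hand side. The gradient
estimate for the `k`-th derivatives is applied on balls whose radius is the `(k+1)`-st part of the
distance to the boundary. -/
theorem exists_cauchy_estimate (hU : IsOpen U) {v F : ℝ × Space d → ℝ} (hv : ContDiffOn ℝ ∞ v U)
    (hvF : ∀ p ∈ U, heatOp 1 v p = F p) {p₀ : ℝ × Space d} {ρ : ℝ} (hρ : 0 < ρ) (hρ1 : ρ ≤ 1)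
    (hball : Metric.closedBall p₀ ρ ⊆ U) {C₀ R : ℝ}
    (hF : ∀ l : List (Space d), (∀ e ∈ l, ‖e‖ = 1) → ∀ p ∈ Metric.closedBall p₀ ρ,
      |iterSpaceDeriv l F p| ≤ C₀ * R ^ l.length * l.length ^ l.length) :
    ∃ C A : ℝ, 0 ≤ C ∧ 0 ≤ A ∧ ∀ l : List (Space d), (∀ e ∈ l, ‖e‖ = 1) →
      ∀ p ∈ Metric.closedBall p₀ (ρ / 2),
        |iterSpaceDeriv l v p| ≤ C * A ^ l.length * l.length ^ l.length := by
  obtain ⟨M₀, hM₀⟩ := (isCompact_closedBall p₀ ρ).exists_bound_of_continuousOn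
    (hv.continuousOn.mono hball)
  -- each derivative costs a factor `d + 2` from the gradient estimate, or `R` from the source
  set C : ℝ := max (max M₀ |C₀|) 1 with hC
  set A : ℝ := max (d + 2) |R| with hA
  have hC0 : 0 < C := lt_of_lt_of_le one_pos (le_max_right _ _)
  have hA0 : 0 < A := lt_of_lt_of_le (by positivity) (le_max_left _ _)
  have key : ∀ l : List (Space d), (∀ e ∈ l, ‖e‖ = 1) → ∀ p ∈ Metric.closedBall p₀ ρ,
      (ρ - dist p p₀) ^ l.length * |iterSpaceDeriv l v p| ≤
        C * A ^ l.length * l.length ^ l.length := by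
    intro l
    induction l with
    | nil =>
      intro _ p hp
      have h1 : |v p| ≤ C := (hM₀ p hp).trans ((le_max_left _ _).trans (le_max_left _ _))
      simpa [iterSpaceDeriv] using h1
    | cons e l ih =>
      intro hl p hp
      have hl' : ∀ e ∈ l, ‖e‖ = 1 := fun a ha => hl a (List.mem_cons_of_mem _ ha)
      have he : ‖e‖ = 1 := hl e List.mem_cons_self
      set k := l.length with hk
      set δ := ρ - dist p p₀ with hδ
      have hδ0 : 0 ≤ δ := sub_nonneg.2 hp
      have hδ1 : δ ≤ 1 := by have := dist_nonneg (x := p) (y := p₀); linarith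
      rw [List.length_cons, ← hk]
      rcases hδ0.eq_or_lt with h0 | hδpos
      · rw [← h0, zero_pow (Nat.succ_ne_zero k), zero_mul]
        positivity
      set h := δ / (k + 1) with hh
      have hhpos : 0 < h := by positivity
      have hhδ : h ≤ δ := div_le_self hδ0 (by linarith [Nat.cast_nonneg (α := ℝ) k])
      have hk1 : (0 : ℝ) < k + 1 := by positivity
      have hkk : (0 : ℝ) < (k : ℝ) ^ k := by exact_mod_cast Nat.pow_self_pos
      have hsub : Metric.closedBall p h ⊆ Metric.closedBall p₀ ρ :=
        Metric.closedBall_subset_closedBall' (by linarith)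
      have hMk : ∀ q ∈ Metric.closedBall p h,
          |iterSpaceDeriv l v q| ≤ C * A ^ k * ((k + 1) / δ) ^ k := by
        intro q hq
        have h1 := ih hl' q (hsub hq)
        have h2 : δ * (k / (k + 1)) ≤ ρ - dist q p₀ := by
          have h3 : dist q p₀ ≤ h + dist p p₀ := (dist_triangle q p p₀).trans (by
            have := Metric.mem_closedBall.1 hq
            linarith)
          have h4 : δ * (k / (k + 1)) = δ - h := by
            rw [hh]
            field_simp
            ring
          linarith
        have h5 : (δ * (k / (k + 1))) ^ k * |iterSpaceDeriv l v q| ≤ C * A ^ k * k ^ k := by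
          refine le_trans ?_ h1
          gcongr
        have h6 : (δ * (k / (k + 1))) ^ k = k ^ k * (δ / (k + 1)) ^ k := by
          rw [← mul_pow]
          congr 1
          ring
        rw [h6, mul_assoc, mul_comm (C * A ^ k)] at h5
        have h7 := le_of_mul_le_mul_left h5 hkk
        have h8 : ((k + 1) / δ) ^ k = ((δ / (k + 1)) ^ k)⁻¹ := by rw [← inv_pow, inv_div]
        rw [h8, ← div_eq_mul_inv, le_div_iff₀ (by positivity), mul_comm]
        exact h7
      have hNk : ∀ q ∈ Metric.closedBall p h,
          |heatOp 1 (iterSpaceDeriv l v) q| ≤ C * A ^ k * k ^ k := by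
        intro q hq
        have hqU := hball (hsub hq)
        rw [heatOp_iterSpaceDeriv hU hv 1 l q hqU, iterSpaceDeriv_congr hU hvF l q hqU]
        refine (hF l hl' q (hsub hq)).trans ?_
        rw [← hk]
        have h9 : C₀ * R ^ k ≤ C * A ^ k := by
          calc C₀ * R ^ k ≤ |C₀ * R ^ k| := le_abs_self _
            _ = |C₀| * |R| ^ k := by rw [abs_mul, abs_pow]
            _ ≤ _ := by
              gcongr
              · exact (le_max_right _ _).trans (le_max_left _ _)
              · exact le_max_right _ _
        exact mul_le_mul_of_nonneg_right h9 hkk.le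
      have hg := abs_spaceDeriv_le hU (hv.iterSpaceDeriv hU l) hhpos (by linarith)
        (by positivity) (hsub.trans hball) hMk hNk he
      rw [iterSpaceDeriv_cons]
      have e1 : δ ^ (k + 1) * ((d + 1) * (C * A ^ k * ((k + 1) / δ) ^ k) / h) =
          (d + 1) * (C * A ^ k) * (k + 1) ^ (k + 1) := by
        rw [hh, div_pow]
        field_simp
        ring
      have e2 : δ ^ (k + 1) * (C * A ^ k * k ^ k * h / 2) ≤ C * A ^ k * (k + 1) ^ (k + 1) := by
        have h1 : δ ^ (k + 1) ≤ 1 := pow_le_one₀ hδ0 hδ1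
        have h2 : h / 2 ≤ 1 := by linarith
        have h3 : (k : ℝ) ^ k ≤ (k + 1) ^ (k + 1) := by
          calc (k : ℝ) ^ k ≤ (k + 1) ^ k := by gcongr; linarith
            _ ≤ _ := pow_le_pow_right₀ (by linarith [Nat.cast_nonneg (α := ℝ) k]) (Nat.le_succ k)
        calc δ ^ (k + 1) * (C * A ^ k * k ^ k * h / 2)
            = C * A ^ k * k ^ k * (δ ^ (k + 1) * (h / 2)) := by ring
          _ ≤ C * A ^ k * (k + 1) ^ (k + 1) * (1 * 1) := by gcongr
          _ = _ := by ring
      calc δ ^ (k + 1) * |spaceDeriv e (iterSpaceDeriv l v) p|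
          ≤ δ ^ (k + 1) * ((d + 1) * (C * A ^ k * ((k + 1) / δ) ^ k) / h +
            C * A ^ k * k ^ k * h / 2) := by gcongr
        _ ≤ (d + 1) * (C * A ^ k) * (k + 1) ^ (k + 1) + C * A ^ k * (k + 1) ^ (k + 1) := by
            rw [mul_add, e1]
            gcongr
        _ = C * A ^ k * (d + 2) * (k + 1) ^ (k + 1) := by ring
        _ ≤ C * A ^ k * A * (k + 1) ^ (k + 1) := by
            gcongr
            exact le_max_left _ _
        _ = C * A ^ (k + 1) * ((k + 1 : ℕ) : ℝ) ^ (k + 1) := by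
            push_cast
            ring
  refine ⟨C, A * (2 / ρ), hC0.le, by positivity, fun l hl p hp => ?_⟩
  have hp' : dist p p₀ ≤ ρ / 2 := hp
  have h1 := key l hl p (Metric.closedBall_subset_closedBall (by linarith) hp)
  have h2 : (ρ / 2) ^ l.length * |iterSpaceDeriv l v p| ≤ C * A ^ l.length * l.length ^ l.length := by
    refine le_trans ?_ h1
    gcongr
    linarith
  have h3 : (2 / ρ) ^ l.length = ((ρ / 2) ^ l.length)⁻¹ := by rw [← inv_pow, inv_div]
  rw [mul_pow, h3]
  calc |iterSpaceDeriv l v p|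
      = ((ρ / 2) ^ l.length)⁻¹ * ((ρ / 2) ^ l.length * |iterSpaceDeriv l v p|) := by field_simp
    _ ≤ ((ρ / 2) ^ l.length)⁻¹ * (C * A ^ l.length * l.length ^ l.length) := by gcongr
    _ = _ := by ring

/-- Iterated spatial derivatives are the values of the iterated Fréchet derivatives of the time
slices. -/
lemma iteratedFDeriv_slice {I : Set ℝ} (hI : IsOpen I) {v : ℝ × Space d → ℝ}
    (hv : ContDiffOn ℝ ∞ v (I ×ˢ univ)) {t : ℝ} (ht : t ∈ I) (k : ℕ) :
    ∀ (x : Space d) (m : Fin k → Space d),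
      iteratedFDeriv ℝ k (fun x => v (t, x)) x m = iterSpaceDeriv (List.ofFn m) v (t, x) := by
  have hU : IsOpen (I ×ˢ (univ : Set (Space d))) := hI.prod isOpen_univ
  have hsl : ContDiff ℝ ∞ fun x => v (t, x) :=
    hv.comp_contDiff (f := fun x : Space d => (t, x)) (by fun_prop) fun x => ⟨ht, mem_univ _⟩
  induction k with
  | zero =>
    intro x m
    simp [iterSpaceDeriv]
  | succ k ih =>
    intro x m
    have hd : DifferentiableAt ℝ (iteratedFDeriv ℝ k fun x => v (t, x)) x :=
      (hsl.differentiable_iteratedFDeriv (by exact_mod_cast ENat.natCast_lt_top k)) x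
    rw [hd.iteratedFDeriv_succ_apply_left', funext fun y => ih y (Fin.tail m), List.ofFn_succ,
      iterSpaceDeriv_cons]
    exact fderiv_slice (p := (t, x)) (((hv.iterSpaceDeriv hU _).contDiffAt
      (hU.mem_nhds ⟨ht, mem_univ _⟩)).differentiableAt (by simp)) _

lemma norm_le_of_unit_vectors {E : Type*} [NormedAddCommGroup E] [NormedSpace ℝ E] {k : ℕ}
    {f : ContinuousMultilinearMap ℝ (fun _ : Fin k => E) ℝ} {B : ℝ} (hB : 0 ≤ B)
    (h : ∀ m : Fin k → E, (∀ i, ‖m i‖ = 1) → |f m| ≤ B) : ‖f‖ ≤ B := by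
  refine ContinuousMultilinearMap.opNorm_le_bound hB fun m => ?_
  by_cases hm : ∃ i, m i = 0
  · obtain ⟨i, hi⟩ := hm
    rw [f.map_coord_zero i hi, norm_zero]
    positivity
  · push Not at hm
    have h1 : m = fun i => ‖m i‖ • ((‖m i‖)⁻¹ • m i) := by
      funext i
      rw [smul_smul, mul_inv_cancel₀ (norm_ne_zero_iff.2 (hm i)), one_smul]
    have h2 := h (fun i => (‖m i‖)⁻¹ • m i) fun i => by
      rw [norm_smul, norm_inv, norm_norm, inv_mul_cancel₀ (norm_ne_zero_iff.2 (hm i))]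
    rw [h1, f.map_smul_univ, norm_smul, Real.norm_of_nonneg (by positivity), ← h1, mul_comm B]
    exact mul_le_mul_of_nonneg_left h2 (by positivity)

/-- Bounds by `k^k` and by `k!` are equivalent up to geometric factors. -/
lemma natCast_pow_self_le (k : ℕ) : (k : ℝ) ^ k ≤ Real.exp 1 ^ k * k.factorial := by
  have h := Real.pow_div_factorial_le_exp (k : ℝ) (Nat.cast_nonneg k) k
  rw [div_le_iff₀ (by positivity)] at h
  rwa [← Real.exp_nat_mul, mul_one]

/-- A smooth function whose derivatives satisfy Cauchy estimates is analytic. -/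
theorem analyticAt_of_cauchy_estimate {E : Type*} [NormedAddCommGroup E] [NormedSpace ℝ E]
    {f : E → ℝ} (hf : ContDiff ℝ ∞ f) {x₀ : E} {δ C B : ℝ} (hδ : 0 < δ)
    (hB : 0 ≤ B)
    (h : ∀ k : ℕ, ∀ x, dist x x₀ ≤ δ → ‖iteratedFDeriv ℝ k f x‖ ≤ C * B ^ k * k.factorial) :
    AnalyticAt ℝ f x₀ := by
  have hC : 0 ≤ C := by
    have := (norm_nonneg _).trans (h 0 x₀ (by simpa using hδ.le))
    simpa using this
  set r : ℝ := min δ (1 / (2 * (B + 1))) with hr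
  have hr0 : 0 < r := by positivity
  have hBr : B * r ≤ 1 / 2 := by
    calc B * r ≤ (B + 1) * (1 / (2 * (B + 1))) := by
          gcongr
          · linarith
          · exact min_le_right _ _
      _ = 1 / 2 := by field_simp
  let p : FormalMultilinearSeries ℝ E ℝ := fun n => ((n.factorial : ℝ)⁻¹) • iteratedFDeriv ℝ n f x₀
  have hp : ∀ n, ‖p n‖ ≤ C * B ^ n := by
    intro n
    have h1 := h n x₀ (by simpa using hδ.le)
    change ‖((n.factorial : ℝ)⁻¹) • iteratedFDeriv ℝ n f x₀‖ ≤ _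
    rw [norm_smul, norm_inv, Real.norm_natCast, inv_mul_le_iff₀ (by positivity)]
    linarith
  have hpr : ∀ n, ∀ s, 0 ≤ s → s ≤ r → ‖p n‖ * s ^ n ≤ C * (1 / 2) ^ n := by
    intro n s hs hsr
    calc ‖p n‖ * s ^ n ≤ C * B ^ n * r ^ n := by gcongr; exact hp n
      _ = C * (B * r) ^ n := by rw [mul_pow]; ring
      _ ≤ _ := by gcongr
  refine ⟨p, ENNReal.ofReal r, ?_, by simpa using hr0, fun {y} hy => ?_⟩
  · refine p.le_radius_of_bound C (r := r.toNNReal) fun n => ?_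
    rw [Real.coe_toNNReal r hr0.le]
    refine (hpr n r hr0.le le_rfl).trans (mul_le_of_le_one_right hC ?_)
    exact pow_le_one₀ (by norm_num) (by norm_num)
  · have hyr : ‖y‖ < r := by
      have h1 : y ∈ Metric.eball 0 (ENNReal.ofReal r) := hy
      rw [Metric.eball_ofReal] at h1
      simpa using h1
    have hterm : ∀ n, ‖p n fun _ => y‖ ≤ C * (1 / 2) ^ n := by
      intro n
      refine ((p n).le_opNorm _).trans ?_
      rw [Finset.prod_const, Finset.card_univ, Fintype.card_fin]
      exact hpr n _ (norm_nonneg y) hyr.le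
    have hsum : Summable fun n => p n fun _ => y :=
      Summable.of_norm_bounded ((summable_geometric_of_lt_one (by norm_num)
        (by norm_num : (1 / 2 : ℝ) < 1)).mul_left C) hterm
    rw [hsum.hasSum_iff_tendsto_nat, ← tendsto_add_atTop_iff_nat 1, tendsto_iff_norm_sub_tendsto_zero]
    have hlim : Tendsto (fun n : ℕ => C * ((n + 1 : ℕ) * (1 / 2 : ℝ) ^ (n + 1))) atTop (𝓝 0) := by
      have h1 := (tendsto_self_mul_const_pow_of_lt_one (r := 1 / 2) (by norm_num) (by norm_num)).comp
        (tendsto_add_atTop_nat 1)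
      simpa using h1.const_mul C
    refine squeeze_zero (fun n => norm_nonneg _) (fun n => ?_) hlim
    have htay := map_add_eq_sum_add_integral_iteratedFDeriv (f := f) (x := x₀) (y := y) (n := n)
      fun t _ => (hf.of_le (by exact_mod_cast le_top)).contDiffAt
    have hdiff : (∑ i ∈ Finset.range (n + 1), p i fun _ => y) - f (x₀ + y) =
        -((n.factorial : ℝ)⁻¹ • ∫ t in (0 : ℝ)..1,
          (1 - t) ^ n • iteratedFDeriv ℝ (n + 1) f (x₀ + t • y) fun _ => y) := by
      rw [htay]
      simp [p]
    rw [hdiff, norm_neg, norm_smul, norm_inv, Real.norm_natCast, inv_mul_le_iff₀ (by positivity)]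
    have hint := intervalIntegral.norm_integral_le_of_norm_le_const (a := (0 : ℝ)) (b := 1)
      (C := C * B ^ (n + 1) * (n + 1).factorial * r ^ (n + 1))
      (f := fun t => (1 - t) ^ n • iteratedFDeriv ℝ (n + 1) f (x₀ + t • y) fun _ => y) ?_
    · refine hint.trans ?_
      rw [sub_zero, abs_one, mul_one, Nat.factorial_succ]
      have h2 : C * B ^ (n + 1) * ((n + 1) * n.factorial : ℕ) * r ^ (n + 1) =
          n.factorial * (C * ((n + 1 : ℕ) * (B * r) ^ (n + 1))) := by
        push_cast
        rw [mul_pow]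
        ring
      rw [h2]
      gcongr
    · intro t ht
      rw [uIoc_of_le zero_le_one] at ht
      have h3 : ‖(1 - t) ^ n‖ ≤ 1 := by
        rw [norm_pow, Real.norm_of_nonneg (by linarith [ht.2])]
        exact pow_le_one₀ (by linarith [ht.2]) (by linarith [ht.1])
      have h4 : dist (x₀ + t • y) x₀ ≤ δ := by
        rw [dist_self_add_left, norm_smul, Real.norm_of_nonneg ht.1.le]
        calc t * ‖y‖ ≤ 1 * r := by gcongr; exact ht.2
          _ ≤ δ := by rw [one_mul]; exact min_le_left _ _
      have h5 := (iteratedFDeriv ℝ (n + 1) f (x₀ + t • y)).le_opNorm fun _ => y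
      rw [Finset.prod_const, Finset.card_univ, Fintype.card_fin] at h5
      rw [norm_smul]
      calc ‖(1 - t) ^ n‖ * ‖iteratedFDeriv ℝ (n + 1) f (x₀ + t • y) fun _ => y‖
          ≤ 1 * ((C * B ^ (n + 1) * (n + 1).factorial) * r ^ (n + 1)) := by
            refine mul_le_mul h3 (h5.trans ?_) (norm_nonneg _) zero_le_one
            gcongr
            exact h (n + 1) _ h4
        _ = _ := by ring

/-- Solutions of the heat equation with spatially analytic right-hand side are spatially
analytic. -/
theorem analyticAt_slice_of_heat_equation {I : Set ℝ} (hI : IsOpen I) {v F : ℝ × Space d → ℝ}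
    (hv : ContDiffOn ℝ ∞ v (I ×ˢ univ)) (hvF : ∀ p ∈ I ×ˢ univ, heatOp 1 v p = F p)
    {t₀ : ℝ} (ht₀ : t₀ ∈ I) (x₀ : Space d) {C₀ R : ℝ}
    (hF : ∀ᶠ p in 𝓝 (t₀, x₀), ∀ l : List (Space d), (∀ e ∈ l, ‖e‖ = 1) →
      |iterSpaceDeriv l F p| ≤ C₀ * R ^ l.length * l.length ^ l.length) :
    AnalyticAt ℝ (fun x => v (t₀, x)) x₀ := by
  have hU : IsOpen (I ×ˢ (univ : Set (Space d))) := hI.prod isOpen_univ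
  obtain ⟨ε, hε, hεF⟩ := Metric.eventually_nhds_iff.1
    (hF.and (hU.mem_nhds (⟨ht₀, mem_univ _⟩ : (t₀, x₀) ∈ I ×ˢ univ)))
  set ρ := min (ε / 2) 1 with hρ
  have hρ0 : 0 < ρ := by positivity
  have hρε : ρ < ε := lt_of_le_of_lt (min_le_left _ _) (by linarith)
  obtain ⟨C, A, hC, hA, h⟩ := exists_cauchy_estimate hU hv hvF hρ0 (min_le_right _ _)
    (fun p hp => (hεF (lt_of_le_of_lt hp hρε)).2)
    (fun l hl p hp => (hεF (lt_of_le_of_lt hp hρε)).1 l hl)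
  have hsl : ContDiff ℝ ∞ fun x => v (t₀, x) :=
    hv.comp_contDiff (f := fun x : Space d => (t₀, x)) (by fun_prop) fun x => ⟨ht₀, mem_univ _⟩
  refine analyticAt_of_cauchy_estimate hsl (δ := ρ / 2) (C := C) (B := A * Real.exp 1)
    (by positivity) (by positivity) fun k x hx => ?_
  refine norm_le_of_unit_vectors (by positivity) fun m hm => ?_
  rw [iteratedFDeriv_slice hI hv ht₀]
  refine (h (List.ofFn m) (fun e he => ?_) (t₀, x) ?_).trans ?_
  · obtain ⟨i, rfl⟩ := (List.mem_ofFn' _ _).1 he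
    exact hm i
  · rw [Metric.mem_closedBall, Prod.dist_eq, dist_self]
    exact max_le (by positivity) hx
  · rw [List.length_ofFn, mul_pow]
    calc C * A ^ k * (k : ℝ) ^ k ≤ C * A ^ k * (Real.exp 1 ^ k * k.factorial) := by
          gcongr
          exact natCast_pow_self_le k
      _ = _ := by ring

end Analyticity

/-! ### Functions of bounded mean oscillation -/

section BMO

variable {d : ℕ} {g : Space d → ℝ}

/-- The mean oscillation of `g` over every ball is at most `A`. -/
def MeanOscLE (g : Space d → ℝ) (A : ℝ) : Prop :=
  LocallyIntegrable g volume ∧ ∀ (x : Space d) (r : ℝ), 0 < r →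
    ∫ y in Metric.ball x r, |g y - ⨍ z in Metric.ball x r, g z| ≤ A * volume.real (Metric.ball x r)

lemma MeasureTheory.LocallyIntegrable.integrableOn_ball (hg : LocallyIntegrable g volume)
    (x : Space d) (r : ℝ) : IntegrableOn g (Metric.ball x r) :=
  (hg.integrableOn_isCompact (isCompact_closedBall x r)).mono_set Metric.ball_subset_closedBall

lemma MeasureTheory.LocallyIntegrable.integrableOn_abs_sub (hg : LocallyIntegrable g volume)
    (c : ℝ) (x : Space d) (r : ℝ) : IntegrableOn (fun y => |g y - c|) (Metric.ball x r) :=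
  ((hg.integrableOn_ball x r).sub (integrableOn_const measure_ball_lt_top.ne)).abs

lemma volume_real_ball (x : Space d) {r : ℝ} (hr : 0 < r) :
    volume.real (Metric.ball x r) = r ^ d * volume.real (Metric.ball (0 : Space d) 1) := by
  rw [measureReal_def, Measure.addHaar_ball_of_pos _ x hr, ENNReal.toReal_mul,
    finrank_euclideanSpace_fin, ENNReal.toReal_ofReal (by positivity), measureReal_def]

lemma volume_real_ball_pos (x : Space d) {r : ℝ} (hr : 0 < r) :
    0 < volume.real (Metric.ball x r) :=
  ENNReal.toReal_pos (Metric.measure_ball_pos _ x hr).ne' measure_ball_lt_top.ne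

lemma laverage_ball_enorm_eq {h : Space d → ℝ} {x : Space d} {r : ℝ} (hr : 0 < r)
    (hh : IntegrableOn h (Metric.ball x r)) :
    ⨍⁻ y in Metric.ball x r, ‖h y‖ₑ ∂volume =
      ENNReal.ofReal ((∫ y in Metric.ball x r, |h y|) / volume.real (Metric.ball x r)) := by
  rw [setLAverage_eq, ENNReal.ofReal_div_of_pos (volume_real_ball_pos x hr),
    ← ofReal_integral_norm_eq_lintegral_enorm hh, measureReal_def,
    ENNReal.ofReal_toReal measure_ball_lt_top.ne]
  rfl

lemma meanOsc_eq (hg : LocallyIntegrable g volume) {x : Space d} {r : ℝ} (hr : 0 < r) :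
    meanOsc g x r = ENNReal.ofReal
      ((∫ y in Metric.ball x r, |g y - ⨍ z in Metric.ball x r, g z|) /
        volume.real (Metric.ball x r)) :=
  laverage_ball_enorm_eq hr
    ((hg.integrableOn_ball x r).sub (integrableOn_const measure_ball_lt_top.ne))

lemma meanOscLE_of_bmoSeminorm_le (hg : LocallyIntegrable g volume) {A : ℝ} (hA : 0 ≤ A)
    (h : bmoSeminorm g ≤ ENNReal.ofReal A) : MeanOscLE g A := by
  refine ⟨hg, fun x r hr => ?_⟩
  have h1 : meanOsc g x r ≤ ENNReal.ofReal A :=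
    (le_iSup₂_of_le (f := fun (x : Space d) (r : ℝ) => ⨆ (_ : 0 < r), meanOsc g x r) x r
      (le_iSup_of_le hr le_rfl)).trans h
  rw [meanOsc_eq hg hr, ENNReal.ofReal_le_ofReal_iff hA,
    div_le_iff₀ (volume_real_ball_pos x hr)] at h1
  exact h1

lemma abs_average_sub_le (hg : LocallyIntegrable g volume) (c : ℝ) (x : Space d) {r : ℝ}
    (hr : 0 < r) :
    |(⨍ z in Metric.ball x r, g z) - c| ≤
      (∫ y in Metric.ball x r, |g y - c|) / volume.real (Metric.ball x r) := by
  have hv := volume_real_ball_pos x hr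
  have h1 : (⨍ z in Metric.ball x r, g z) - c =
      (∫ y in Metric.ball x r, (g y - c)) / volume.real (Metric.ball x r) := by
    rw [integral_sub (hg.integrableOn_ball x r) (integrableOn_const measure_ball_lt_top.ne),
      setIntegral_const, setAverage_eq, smul_eq_mul, smul_eq_mul]
    field_simp
  rw [h1, abs_div, abs_of_pos hv]
  gcongr
  exact abs_integral_le_integral_abs

lemma abs_average_le (hg : LocallyIntegrable g volume) (x : Space d) {r : ℝ} (hr : 0 < r) :
    |⨍ z in Metric.ball x r, g z| ≤
      (∫ y in Metric.ball x r, |g y|) / volume.real (Metric.ball x r) := by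
  simpa using abs_average_sub_le hg 0 x hr

lemma integral_ball_abs_sub_le (hg : LocallyIntegrable g volume) (a b : ℝ) (x : Space d) {r : ℝ} :
    ∫ y in Metric.ball x r, |g y - a| ≤
      (∫ y in Metric.ball x r, |g y - b|) + |b - a| * volume.real (Metric.ball x r) := by
  have h1 : ∫ y in Metric.ball x r, (|g y - b| + |b - a|) =
      (∫ y in Metric.ball x r, |g y - b|) + |b - a| * volume.real (Metric.ball x r) := by
    rw [integral_add (hg.integrableOn_abs_sub b x r) (integrableOn_const measure_ball_lt_top.ne),
      setIntegral_const, smul_eq_mul, mul_comm]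
  rw [← h1]
  refine integral_mono (hg.integrableOn_abs_sub a x r)
    ((hg.integrableOn_abs_sub b x r).add (integrableOn_const measure_ball_lt_top.ne)) fun y => ?_
  exact abs_sub_le _ _ _

/-- A function with small oscillation on balls of radius less than one and bounded means of its
absolute value on the larger balls has bounded mean oscillation. -/
lemma meanOscLE_of_localBMONorm_le (hg : LocallyIntegrable g volume) {B : ℝ} (hB : 0 ≤ B)
    (h : localBMONorm g ≤ ENNReal.ofReal B) :
    MeanOscLE g (2 * B) ∧ ∀ (x : Space d) (r : ℝ), 1 ≤ r → |⨍ z in Metric.ball x r, g z| ≤ B := by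
  have h1 : ∀ (x : Space d) (r : ℝ), 1 ≤ r →
      (∫ y in Metric.ball x r, |g y|) / volume.real (Metric.ball x r) ≤ B := by
    intro x r hr
    have h2 : ⨍⁻ y in Metric.ball x r, ‖g y‖ₑ ∂volume ≤ ENNReal.ofReal B :=
      (le_iSup₂_of_le (f := fun (x : Space d) (r : ℝ) => ⨆ (_ : 1 ≤ r),
        ⨍⁻ y in Metric.ball x r, ‖g y‖ₑ ∂volume) x r (le_iSup_of_le hr le_rfl)).trans
        (le_add_self.trans h)
    rwa [laverage_ball_enorm_eq (by linarith) (hg.integrableOn_ball x r),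
      ENNReal.ofReal_le_ofReal_iff hB] at h2
  have h3 : ∀ (x : Space d) (r : ℝ), 1 ≤ r → |⨍ z in Metric.ball x r, g z| ≤ B := fun x r hr =>
    (abs_average_le hg x (by linarith)).trans (h1 x r hr)
  refine ⟨⟨hg, fun x r hr => ?_⟩, h3⟩
  have hv := volume_real_ball_pos x hr
  rcases lt_or_ge r 1 with hr1 | hr1
  · have h4 : meanOsc g x r ≤ ENNReal.ofReal B :=
      (le_iSup₂_of_le (f := fun (x : Space d) (r : ℝ) => ⨆ (_ : 0 < r) (_ : r < 1), meanOsc g x r)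
        x r (le_iSup₂_of_le hr hr1 le_rfl)).trans (le_self_add.trans h)
    rw [meanOsc_eq hg hr, ENNReal.ofReal_le_ofReal_iff hB, div_le_iff₀ hv] at h4
    nlinarith
  · have h4 := integral_ball_abs_sub_le hg (⨍ z in Metric.ball x r, g z) 0 x (r := r)
    have h5 := h1 x r hr1
    rw [div_le_iff₀ hv] at h5
    simp only [sub_zero, zero_sub, abs_neg] at h4
    nlinarith [h3 x r hr1]

namespace MeanOscLE

variable {A : ℝ}

lemma nonneg (h : MeanOscLE g A) : 0 ≤ A := by
  have h1 := h.2 0 1 one_pos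
  have h2 : 0 ≤ ∫ y in Metric.ball (0 : Space d) 1, |g y - ⨍ z in Metric.ball 0 1, g z| :=
    integral_nonneg fun y => abs_nonneg _
  exact nonneg_of_mul_nonneg_left (h2.trans h1) (volume_real_ball_pos 0 one_pos)

lemma abs_average_two_mul_sub_le (h : MeanOscLE g A) (x : Space d) {r : ℝ} (hr : 0 < r) :
    |(⨍ z in Metric.ball x r, g z) - ⨍ z in Metric.ball x (2 * r), g z| ≤ 2 ^ d * A := by
  have hv := volume_real_ball_pos x hr
  refine (abs_average_sub_le h.1 _ x hr).trans ?_
  rw [div_le_iff₀ hv]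
  calc _ ≤ ∫ y in Metric.ball x (2 * r), |g y - ⨍ z in Metric.ball x (2 * r), g z| := by
        refine setIntegral_mono_set (h.1.integrableOn_abs_sub _ x (2 * r))
          (Eventually.of_forall fun y => abs_nonneg _)
          (Metric.ball_subset_ball (by linarith)).eventuallyLE
    _ ≤ A * volume.real (Metric.ball x (2 * r)) := h.2 x _ (by positivity)
    _ = _ := by
      rw [volume_real_ball x hr, volume_real_ball x (by positivity : 0 < 2 * r), mul_pow]
      ring

/-- Averages over concentric balls differ at most by a multiple of the logarithm of the ratio of
their radii. -/
lemma abs_average_two_pow_mul_sub_le (h : MeanOscLE g A) (x : Space d) {r : ℝ} (hr : 0 < r)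
    (k : ℕ) :
    |(⨍ z in Metric.ball x (2 ^ k * r), g z) - ⨍ z in Metric.ball x r, g z| ≤ k * (2 ^ d * A) := by
  induction k with
  | zero => simp
  | succ k ih =>
    have h1 := h.abs_average_two_mul_sub_le x (r := 2 ^ k * r) (by positivity)
    rw [abs_sub_comm, ← mul_assoc, ← pow_succ'] at h1
    refine (abs_sub_le _ _ _).trans ((add_le_add h1 ih).trans (le_of_eq ?_))
    push_cast
    ring

lemma integral_ball_two_pow_le (h : MeanOscLE g A) (x : Space d) {r : ℝ} (hr : 0 < r) (k : ℕ) :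
    ∫ y in Metric.ball x (2 ^ k * r), |g y - ⨍ z in Metric.ball x r, g z| ≤
      (1 + k) * 2 ^ d * A * ((2 ^ k) ^ d * (r ^ d * volume.real (Metric.ball (0 : Space d) 1))) := by
  have hr' : 0 < 2 ^ k * r := by positivity
  have hA := h.nonneg
  have hv : volume.real (Metric.ball x (2 ^ k * r)) =
      (2 ^ k) ^ d * (r ^ d * volume.real (Metric.ball (0 : Space d) 1)) := by
    rw [volume_real_ball x hr', mul_pow, mul_assoc]
  rw [← hv]
  have hv0 := volume_real_ball_pos x hr'
  refine (integral_ball_abs_sub_le h.1 _ _ x).trans ((add_le_add (h.2 x _ hr')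
    (mul_le_mul_of_nonneg_right (h.abs_average_two_pow_mul_sub_le x hr k) hv0.le)).trans ?_)
  have h2 : A ≤ 2 ^ d * A := le_mul_of_one_le_left hA (one_le_pow₀ (by norm_num))
  rw [← add_mul]
  refine mul_le_mul_of_nonneg_right ?_ hv0.le
  nlinarith

end MeanOscLE

/-- The weight `decay` is dominated by a sum over dyadic balls. -/
lemma decay_le_tsum (z : Space d) :
    ENNReal.ofReal (decay z) ≤ ∑' k : ℕ, (Metric.ball (0 : Space d) (2 ^ k)).indicator
      (fun _ => ENNReal.ofReal (2 ^ (d + 1) * ((2 ^ k) ^ (d + 1))⁻¹)) z := by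
  have hex : ∃ k : ℕ, ‖z‖ < 2 ^ k := pow_unbounded_of_one_lt _ one_lt_two
  classical
  set k := Nat.find hex with hk
  have hzk : ‖z‖ < 2 ^ k := Nat.find_spec hex
  refine le_trans ?_ (ENNReal.le_tsum k)
  rw [indicator_of_mem (by simpa using hzk)]
  refine ENNReal.ofReal_le_ofReal ?_
  rcases hk0 : k with _ | j
  · simpa using (decay_le_one z).trans (one_le_pow₀ (by norm_num))
  · have hj : 2 ^ j ≤ ‖z‖ := not_lt.1 (Nat.find_min hex (by omega))
    have h1 : (2 : ℝ) ^ (d + 1) * ((2 ^ (j + 1)) ^ (d + 1))⁻¹ = ((2 ^ j) ^ (d + 1))⁻¹ := by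
      rw [pow_succ (2 : ℝ) j, mul_pow (2 ^ j : ℝ) 2, mul_inv]
      field_simp
    rw [h1, decay]
    gcongr
    linarith

/-- Functions of bounded mean oscillation, after subtraction of a mean, are integrable against
rescaled weights, with a scale-invariant bound. -/
lemma exists_integral_decay_le (d : ℕ) : ∃ C, 0 ≤ C ∧ ∀ (g : Space d → ℝ) (A : ℝ), MeanOscLE g A →
    ∀ (x : Space d) (r : ℝ), 0 < r →
      Integrable (fun y => decay (r⁻¹ • (y - x)) * |g y - ⨍ z in Metric.ball x r, g z|) ∧
      ∫ y, decay (r⁻¹ • (y - x)) * |g y - ⨍ z in Metric.ball x r, g z| ≤ C * A * r ^ d := by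
  set V := volume.real (Metric.ball (0 : Space d) 1) with hV
  set c : ℕ → ℝ := fun k => 2 ^ (d + 1) * 2 ^ d * V * ((1 + k) * (1 / 2) ^ k) with hc
  have hc0 : ∀ k, 0 ≤ c k := fun k => by positivity
  have hcs : Summable c := by
    refine Summable.mul_left _ ?_
    have h1 := summable_pow_mul_geometric_of_norm_lt_one 1 (r := (1 / 2 : ℝ)) (by norm_num)
    have h2 := summable_geometric_of_lt_one (r := (1 / 2 : ℝ)) (by norm_num) (by norm_num)
    refine (h2.add h1).congr fun k => ?_
    ring
  refine ⟨∑' k, c k, tsum_nonneg hc0, fun g A hg x r hr => ?_⟩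
  have hA := hg.nonneg
  set m := ⨍ z in Metric.ball x r, g z with hm
  have hmeas : AEStronglyMeasurable (fun y => decay (r⁻¹ • (y - x)) * |g y - m|) :=
    (continuous_decay.comp (by fun_prop)).aestronglyMeasurable.mul
      (hg.1.aestronglyMeasurable.sub aestronglyMeasurable_const).norm
  have hnn : ∀ y, 0 ≤ decay (r⁻¹ • (y - x)) * |g y - m| := fun y =>
    mul_nonneg (decay_pos _).le (abs_nonneg _)
  have hball : ∀ k : ℕ, ∀ y, r⁻¹ • (y - x) ∈ Metric.ball (0 : Space d) (2 ^ k) ↔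
      y ∈ Metric.ball x (2 ^ k * r) := by
    intro k y
    rw [mem_ball_zero_iff, norm_smul, norm_inv, Real.norm_of_nonneg hr.le, mem_ball_iff_norm,
      inv_mul_lt_iff₀ hr, mul_comm]
  have hlin : ∫⁻ y, ENNReal.ofReal (decay (r⁻¹ • (y - x)) * |g y - m|) ≤
      ENNReal.ofReal ((∑' k, c k) * A * r ^ d) := by
    have hpt : ∀ y, ENNReal.ofReal (decay (r⁻¹ • (y - x)) * |g y - m|) ≤
        ∑' k : ℕ, (Metric.ball x (2 ^ k * r)).indicator
          (fun y => ENNReal.ofReal (2 ^ (d + 1) * ((2 ^ k) ^ (d + 1))⁻¹) *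
            ENNReal.ofReal |g y - m|) y := by
      intro y
      rw [ENNReal.ofReal_mul (decay_pos _).le]
      refine (mul_le_mul_left (decay_le_tsum _) _).trans (le_of_eq ?_)
      rw [← ENNReal.tsum_mul_right]
      refine tsum_congr fun k => ?_
      by_cases hy : y ∈ Metric.ball x (2 ^ k * r)
      · rw [indicator_of_mem hy, indicator_of_mem ((hball k y).2 hy)]
      · rw [indicator_of_notMem hy, indicator_of_notMem fun h' => hy ((hball k y).1 h'), zero_mul]
    have hgm : ∀ k : ℕ, AEMeasurable (fun y => ENNReal.ofReal |g y - m|)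
        (volume.restrict (Metric.ball x (2 ^ k * r))) := fun k =>
      ((hg.1.integrableOn_abs_sub m x (2 ^ k * r)).1.aemeasurable).ennreal_ofReal
    refine (lintegral_mono hpt).trans ?_
    rw [lintegral_tsum fun k => (aemeasurable_indicator_iff measurableSet_ball).2
      ((hgm k).const_mul _)]
    have hterm : ∀ k : ℕ, ∫⁻ y, (Metric.ball x (2 ^ k * r)).indicator
          (fun y => ENNReal.ofReal (2 ^ (d + 1) * ((2 ^ k) ^ (d + 1))⁻¹) *
            ENNReal.ofReal |g y - m|) y ≤ ENNReal.ofReal (c k * A * r ^ d) := by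
      intro k
      rw [lintegral_indicator measurableSet_ball, lintegral_const_mul'' _ (hgm k),
        ← ofReal_integral_eq_lintegral_ofReal (hg.1.integrableOn_abs_sub m x _)
          (Eventually.of_forall fun y => abs_nonneg _), ← ENNReal.ofReal_mul (by positivity)]
      refine ENNReal.ofReal_le_ofReal ?_
      refine (mul_le_mul_of_nonneg_left (hg.integral_ball_two_pow_le x hr k)
        (by positivity)).trans (le_of_eq ?_)
      simp only [hc, ← hV]
      rw [one_div, inv_pow, pow_succ ((2 : ℝ) ^ k) d]
      field_simp
    refine (ENNReal.tsum_le_tsum hterm).trans (le_of_eq ?_)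
    rw [← ENNReal.ofReal_tsum_of_nonneg (fun k => by have := hc0 k; positivity)
      ((hcs.mul_right A).mul_right (r ^ d)), tsum_mul_right, tsum_mul_right]
  have hint : Integrable (fun y => decay (r⁻¹ • (y - x)) * |g y - m|) := by
    refine ⟨hmeas, ?_⟩
    rw [hasFiniteIntegral_iff_ofReal (Eventually.of_forall hnn)]
    exact hlin.trans_lt ENNReal.ofReal_lt_top
  refine ⟨hint, ?_⟩
  have hC0 : 0 ≤ ∑' k, c k := tsum_nonneg hc0
  rw [← ENNReal.ofReal_le_ofReal_iff (by positivity),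
    ofReal_integral_eq_lintegral_ofReal hint (Eventually.of_forall hnn)]
  exact hlin

lemma MeanOscLE.heatIntegrable {A : ℝ} (h : MeanOscLE g A) : HeatIntegrable g := by
  obtain ⟨C, -, hC⟩ := exists_integral_decay_le d
  have h1 := (hC g A h 0 1 one_pos).1
  set m := ⨍ z in Metric.ball (0 : Space d) 1, g z
  have h2 : HeatIntegrable fun y => g y - m := by
    refine h1.mono (continuous_decay.aestronglyMeasurable.mul
      (h.1.aestronglyMeasurable.sub aestronglyMeasurable_const)) (Eventually.of_forall fun y => ?_)
    simp
  have h3 := h2.sub (HeatIntegrable.const (-m))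
  simpa using h3

/-- The heat kernel at time `t` sees oscillations at scale `√t` only. -/
lemma exists_integral_heatKernel_le (d : ℕ) : ∃ C, 0 ≤ C ∧ ∀ (g : Space d → ℝ) (A : ℝ),
    MeanOscLE g A → ∀ (x : Space d) (t : ℝ), 0 < t →
      Integrable (fun y => heatKernel t (x - y) * |g y - ⨍ z in Metric.ball x (√t), g z|) ∧
      ∫ y, heatKernel t (x - y) * |g y - ⨍ z in Metric.ball x (√t), g z| ≤ C * A := by
  obtain ⟨C₁, hC₁, h₁⟩ := exists_integral_decay_le d
  obtain ⟨C₂, hC₂, h₂⟩ := heatKernel_le_decay d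
  refine ⟨C₂ * C₁, by positivity, fun g A hg x t ht => ?_⟩
  have hst : 0 < √t := Real.sqrt_pos.2 ht
  obtain ⟨h3, h4⟩ := h₁ g A hg x (√t) hst
  set m := ⨍ z in Metric.ball x (√t), g z
  have hle : ∀ y, heatKernel t (x - y) * |g y - m| ≤
      C₂ * ((√t) ^ d)⁻¹ * (decay ((√t)⁻¹ • (y - x)) * |g y - m|) := by
    intro y
    rw [heatKernel_sub_comm, ← mul_assoc]
    exact mul_le_mul_of_nonneg_right (h₂ t ht _) (abs_nonneg _)
  have hint : Integrable (fun y => heatKernel t (x - y) * |g y - m|) := by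
    refine (h3.const_mul (C₂ * ((√t) ^ d)⁻¹)).mono'
      (((continuous_heatKernel t).comp (by fun_prop)).aestronglyMeasurable.mul
        (hg.1.aestronglyMeasurable.sub aestronglyMeasurable_const).norm)
      (Eventually.of_forall fun y => ?_)
    rw [Real.norm_of_nonneg (mul_nonneg (heatKernel_nonneg ht.le _) (abs_nonneg _))]
    exact hle y
  refine ⟨hint, (integral_mono hint (h3.const_mul _) hle).trans ?_⟩
  rw [integral_const_mul]
  calc C₂ * ((√t) ^ d)⁻¹ * ∫ y, decay ((√t)⁻¹ • (y - x)) * |g y - m|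
      ≤ C₂ * ((√t) ^ d)⁻¹ * (C₁ * A * (√t) ^ d) := by gcongr
    _ = _ := by field_simp

/-- The smoothing estimate `|∂_e e^{tΔ} g| ≤ C t^{-1/2} ‖g‖_{BMO}`. -/
lemma exists_fderiv_heatSemigroup_le (d : ℕ) : ∃ C, 0 ≤ C ∧ ∀ (g : Space d → ℝ) (A : ℝ),
    MeanOscLE g A → ∀ (t : ℝ), 0 < t → ∀ x e : Space d,
      |fderiv ℝ (heatSemigroup t g) x e| ≤ C * ‖e‖ * A * (√t)⁻¹ := by
  obtain ⟨C₁, hC₁, h₁⟩ := exists_integral_heatKernel_le d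
  obtain ⟨C₂, hC₂, h₂⟩ := abs_heatKernelDir_le d
  refine ⟨C₂ * C₁, by positivity, fun g A hg t ht x e => ?_⟩
  obtain ⟨h3, h4⟩ := h₁ g A hg x (2 * t) (by positivity)
  set m := ⨍ z in Metric.ball x (√(2 * t)), g z
  have hgi := hg.heatIntegrable
  rw [← hgi.fderiv_heatSemigroup_sub_const ht m,
    (hgi.sub (HeatIntegrable.const m)).fderiv_heatSemigroup_apply ht, ← Real.norm_eq_abs]
  refine (norm_integral_le_of_norm_le (h3.const_mul (C₂ * ‖e‖ * (√t)⁻¹))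
    (Eventually.of_forall fun y => ?_)).trans ?_
  · rw [norm_mul, ← mul_assoc]
    exact mul_le_mul_of_nonneg_right (h₂ t ht e _) (abs_nonneg _)
  · rw [integral_const_mul]
    calc _ ≤ C₂ * ‖e‖ * (√t)⁻¹ * (C₁ * A) := by gcongr
      _ = _ := by ring

/-- Tested against a fixed function, `∂_e e^{tΔ} g` is bounded uniformly for small times. -/
lemma exists_integral_fderiv_heatSemigroup_mul_le {φ : Space d → ℝ} (hφ : ContDiff ℝ ∞ φ)
    (hc : HasCompactSupport φ) (T : ℝ) (e : Space d) : ∃ C, 0 ≤ C ∧ ∀ (g : Space d → ℝ) (A : ℝ),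
      MeanOscLE g A → ∀ t, 0 < t → t ≤ T →
        |∫ x, fderiv ℝ (heatSemigroup t g) x e * φ x| ≤ C * A := by
  obtain ⟨C₁, hC₁, h₁⟩ := exists_integral_decay_le d
  obtain ⟨C₂, hC₂, h₂⟩ := abs_heatSemigroup_le_decay d T
  have hφ' : Continuous fun x => fderiv ℝ φ x e :=
    (hφ.continuous_fderiv (by simp)).clm_apply continuous_const
  obtain ⟨M, hM⟩ := exists_le_decay_of_hasCompactSupport hφ' (hc.fderiv_apply ℝ e)
  have hM0 : 0 ≤ M := nonneg_of_mul_nonneg_left ((abs_nonneg _).trans (hM 0)) (decay_pos _)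
  refine ⟨C₂ * M * C₁, by positivity, fun g A hg t ht htT => ?_⟩
  obtain ⟨h3, h4⟩ := h₁ g A hg 0 1 one_pos
  set m := ⨍ z in Metric.ball (0 : Space d) 1, g z
  have hgi := hg.heatIntegrable
  have hgm := hgi.sub (HeatIntegrable.const m)
  simp only [inv_one, sub_zero, one_smul, one_pow, mul_one] at h3 h4
  simp_rw [← hgi.fderiv_heatSemigroup_sub_const ht m]
  rw [hgm.integral_fderiv_heatSemigroup_mul (hφ.of_le (by simp)) hc ht,
    hgm.integral_heatSemigroup_mul hφ' hM ht, abs_neg, ← Real.norm_eq_abs]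
  refine (norm_integral_le_of_norm_le (h3.const_mul (C₂ * M))
    (Eventually.of_forall fun y => ?_)).trans ?_
  · rw [norm_mul]
    calc ‖g y - m‖ * ‖heatSemigroup t (fun x => fderiv ℝ φ x e) y‖
        ≤ ‖g y - m‖ * (C₂ * M * decay y) := by
          gcongr
          exact h₂ _ M hφ' hM t ht htT y
      _ = C₂ * M * (decay y * |g y - m|) := by rw [Real.norm_eq_abs]; ring
  · rw [integral_const_mul]
    calc _ ≤ C₂ * M * (C₁ * A) := by gcongr
      _ = _ := by ring

/-- The heat semigroup maps `bmo` into the bounded functions. The averages at scale `√t` grow only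
logarithmically as `t → 0`, which leaves room for the crude bound `t^{-1/2}`. -/
lemma exists_heatSemigroup_le (d : ℕ) : ∃ C, 0 ≤ C ∧ ∀ (g : Space d → ℝ) (B : ℝ), 0 ≤ B →
    LocallyIntegrable g volume → localBMONorm g ≤ ENNReal.ofReal B → ∀ t, 0 < t → ∀ x,
      |heatSemigroup t g x| ≤ C * B * (1 + (√t)⁻¹) := by
  obtain ⟨C₁, hC₁, h₁⟩ := exists_integral_heatKernel_le d
  refine ⟨2 * C₁ + 1 + 4 * 2 ^ d, by positivity, fun g B hB hg hgB t ht x => ?_⟩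
  obtain ⟨hosc, havg⟩ := meanOscLE_of_localBMONorm_le hg hB hgB
  have hst : 0 < √t := Real.sqrt_pos.2 ht
  obtain ⟨h3, h4⟩ := h₁ g _ hosc x t ht
  set m := ⨍ z in Metric.ball x (√t), g z with hm
  have hgi := hosc.heatIntegrable
  have h5 : |heatSemigroup t g x - m| ≤ C₁ * (2 * B) := by
    rw [← hgi.heatSemigroup_sub_const ht, ← Real.norm_eq_abs]
    refine (norm_integral_le_of_norm_le h3 (Eventually.of_forall fun y => ?_)).trans h4
    rw [norm_mul, Real.norm_of_nonneg (heatKernel_nonneg ht.le _), Real.norm_eq_abs]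
  have h6 : |m| ≤ B + 2 * (√t)⁻¹ * (2 ^ d * (2 * B)) := by
    have hex : ∃ k : ℕ, (√t)⁻¹ ≤ 2 ^ k := (pow_unbounded_of_one_lt _ one_lt_two).imp fun _ h => h.le
    classical
    set k := Nat.find hex with hk
    have hk1 : 1 ≤ 2 ^ k * √t := by
      have := Nat.find_spec hex
      rwa [← hk, inv_le_iff_one_le_mul₀ hst] at this
    have hk2 : (k : ℝ) ≤ 2 * (√t)⁻¹ := by
      rcases hk0 : k with _ | j
      · simp
      · have hj : (2 : ℝ) ^ j < (√t)⁻¹ := not_le.1 (Nat.find_min hex (by omega))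
        have h7 : ((j + 1 : ℕ) : ℝ) ≤ 2 ^ (j + 1) := by exact_mod_cast Nat.lt_two_pow_self.le
        rw [pow_succ] at h7
        linarith
    have h8 := hosc.abs_average_two_pow_mul_sub_le x hst k
    have h9 := havg x _ hk1
    have h10 : |m| ≤ |⨍ z in Metric.ball x (2 ^ k * √t), g z| +
        |(⨍ z in Metric.ball x (2 ^ k * √t), g z) - m| := by
      have := abs_sub_abs_le_abs_sub m (⨍ z in Metric.ball x (2 ^ k * √t), g z)
      rw [abs_sub_comm] at this
      linarith
    have h11 : k * (2 ^ d * (2 * B)) ≤ 2 * (√t)⁻¹ * (2 ^ d * (2 * B)) := by gcongr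
    linarith
  have h7 : |heatSemigroup t g x| ≤ |heatSemigroup t g x - m| + |m| := by
    have := abs_sub_abs_le_abs_sub (heatSemigroup t g x) m
    linarith
  have h8 : 0 ≤ (√t)⁻¹ := by positivity
  have h9 : 0 ≤ C₁ * B * (√t)⁻¹ := by positivity
  have h10 : 0 ≤ B * (√t)⁻¹ := by positivity
  have h11 : 0 ≤ 2 ^ d * B := by positivity
  nlinarith

end BMO

/-! ### Time integrals with an inverse square root singularity -/

section TimeIntegrals

lemma inv_sqrt_eq_rpow {s : ℝ} (hs : 0 ≤ s) : (√s)⁻¹ = s ^ (-(1 / 2) : ℝ) := by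
  rw [Real.sqrt_eq_rpow, Real.rpow_neg hs]

lemma intervalIntegrable_inv_sqrt {a : ℝ} (ha : 0 ≤ a) :
    IntervalIntegrable (fun s => (√s)⁻¹) volume 0 a := by
  refine (intervalIntegral.intervalIntegrable_rpow' (r := -(1 / 2)) (by norm_num)).congr ?_
  intro s hs
  rw [uIoc_of_le ha] at hs
  exact (inv_sqrt_eq_rpow hs.1.le).symm

lemma integral_inv_sqrt {a : ℝ} (ha : 0 ≤ a) : ∫ s in (0 : ℝ)..a, (√s)⁻¹ = 2 * √a := by
  have h1 : ∫ s in (0 : ℝ)..a, (√s)⁻¹ = ∫ s in (0 : ℝ)..a, s ^ (-(1 / 2) : ℝ) := by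
    refine intervalIntegral.integral_congr fun s hs => ?_
    rw [uIcc_of_le ha] at hs
    exact inv_sqrt_eq_rpow hs.1
  rw [h1, integral_rpow (Or.inl (by norm_num)), Real.sqrt_eq_rpow]
  norm_num
  ring

lemma intervalIntegrable_inv_sqrt_sub {a t : ℝ} (hat : a ≤ t) :
    IntervalIntegrable (fun s => (√(t - s))⁻¹) volume a t := by
  have h := (intervalIntegrable_inv_sqrt (sub_nonneg.2 hat)).comp_sub_left t
  simpa using h.symm

lemma integral_inv_sqrt_sub {a t : ℝ} (hat : a ≤ t) :
    ∫ s in a..t, (√(t - s))⁻¹ = 2 * √(t - a) := by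
  rw [intervalIntegral.integral_comp_sub_left (fun s => (√s)⁻¹) t, sub_self,
    integral_inv_sqrt (sub_nonneg.2 hat)]

lemma measurable_inv_sqrt_sub (t : ℝ) : Measurable fun s => (√(t - s))⁻¹ := by fun_prop

/-- A nonnegative continuous function on `(0, T)` that is integrable near `0`. -/
structure IsTimeDensity (T : ℝ) (b : ℝ → ℝ) : Prop where
  continuousOn : ContinuousOn b (Ioo 0 T)
  nonneg : ∀ t ∈ Ioo 0 T, 0 ≤ b t
  integrableOn : ∀ t ∈ Ioo 0 T, IntegrableOn b (Ioo 0 t)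

namespace IsTimeDensity

variable {T : ℝ} {b : ℝ → ℝ}

/-- The two singularities are separated: `b` is bounded near `s = t`, and `(t - s)^{-1/2}` is bounded
near `s = 0`. -/
lemma integrableOn_inv_sqrt_sub_mul (hb : IsTimeDensity T b) {t : ℝ} (ht : t ∈ Ioo 0 T) :
    IntegrableOn (fun s => (√(t - s))⁻¹ * b s) (Ioo 0 t) := by
  have ht2 : 0 < t / 2 := half_pos ht.1
  have hm := (hb.integrableOn t ht).aestronglyMeasurable
  have h1 : IntegrableOn (fun s => (√(t - s))⁻¹ * b s) (Ioo 0 (t / 2)) := by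
    have hsub : Ioo 0 (t / 2) ⊆ Ioo 0 t := Ioo_subset_Ioo_right (by linarith)
    refine (((hb.integrableOn t ht).mono_set hsub).const_mul (√(t / 2))⁻¹).mono'
      ((measurable_inv_sqrt_sub t).aestronglyMeasurable.mul (hm.mono_set hsub))
      (ae_restrict_of_forall_mem measurableSet_Ioo fun s hs => ?_)
    have hs' : s ∈ Ioo 0 T := ⟨hs.1, by linarith [hs.2, ht.2]⟩
    rw [Real.norm_of_nonneg (mul_nonneg (by positivity) (hb.nonneg s hs'))]
    refine mul_le_mul_of_nonneg_right ?_ (hb.nonneg s hs')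
    gcongr
    linarith [hs.2]
  have h2 : IntegrableOn (fun s => (√(t - s))⁻¹ * b s) (Ico (t / 2) t) := by
    have hsub : Icc (t / 2) t ⊆ Ioo 0 T := fun s hs => ⟨by linarith [hs.1], by linarith [hs.2, ht.2]⟩
    obtain ⟨M, hM⟩ := isCompact_Icc.exists_bound_of_continuousOn (hb.continuousOn.mono hsub)
    have h3 : IntegrableOn (fun s => (√(t - s))⁻¹) (Ico (t / 2) t) :=
      ((intervalIntegrable_iff_integrableOn_Ico_of_le (by linarith)).1
        (intervalIntegrable_inv_sqrt_sub (by linarith)))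
    have h4 : AEStronglyMeasurable b (volume.restrict (Ico (t / 2) t)) :=
      (hb.continuousOn.mono (Ico_subset_Icc_self.trans hsub)).aestronglyMeasurable measurableSet_Ico
    refine (h3.mul_const M).mono' ((measurable_inv_sqrt_sub t).aestronglyMeasurable.mul h4)
      (ae_restrict_of_forall_mem measurableSet_Ico fun s hs => ?_)
    rw [norm_mul, Real.norm_of_nonneg (by positivity : 0 ≤ (√(t - s))⁻¹)]
    exact mul_le_mul_of_nonneg_left (hM s (Ico_subset_Icc_self hs)) (by positivity)
  have h3 := h1.union h2
  rwa [Ioo_union_Ico_eq_Ioo ht2 (by linarith)] at h3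

lemma integrableOn_of_le (hb : IsTimeDensity T b) {t C : ℝ} (ht : t ∈ Ioo 0 T) {G : ℝ → ℝ}
    (hm : AEStronglyMeasurable G (volume.restrict (Ioo 0 t)))
    (hG : ∀ s ∈ Ioo 0 t, |G s| ≤ C * ((√(t - s))⁻¹ * b s)) : IntegrableOn G (Ioo 0 t) :=
  ((hb.integrableOn_inv_sqrt_sub_mul ht).const_mul C).mono' hm
    (ae_restrict_of_forall_mem measurableSet_Ioo hG)

lemma intervalIntegrable_of_le (hb : IsTimeDensity T b) {t C : ℝ} (ht : t ∈ Ioo 0 T) {G : ℝ → ℝ}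
    (hm : AEStronglyMeasurable G (volume.restrict (Ioo 0 t)))
    (hG : ∀ s ∈ Ioo 0 t, |G s| ≤ C * ((√(t - s))⁻¹ * b s)) : IntervalIntegrable G volume 0 t :=
  (intervalIntegrable_iff_integrableOn_Ioo_of_le ht.1.le).2 (hb.integrableOn_of_le ht hm hG)

/-- Continuity of an integral `∫₀ᵗ G(t, x, s) ds` with a singularity of order `(t - s)^{-1/2}`: away
from `s = t` the dominated convergence theorem applies, and the contribution of `s` near `t` is
uniformly small. -/
theorem continuousOn_integral (hb : IsTimeDensity T b) {X : Type*} [TopologicalSpace X]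
    [FirstCountableTopology X] {G : ℝ → X → ℝ → ℝ} {C : ℝ} (hC : 0 ≤ C)
    (hcont : ∀ s ∈ Ioo 0 T, ContinuousOn (fun p : ℝ × X => G p.1 p.2 s) (Ioo s T ×ˢ univ))
    (hm : ∀ t ∈ Ioo 0 T, ∀ x, AEStronglyMeasurable (G t x) (volume.restrict (Ioo 0 t)))
    (hG : ∀ t ∈ Ioo 0 T, ∀ x, ∀ s ∈ Ioo 0 t, |G t x s| ≤ C * ((√(t - s))⁻¹ * b s)) :
    ContinuousOn (fun p : ℝ × X => ∫ s in (0 : ℝ)..p.1, G p.1 p.2 s) (Ioo 0 T ×ˢ univ) := by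
  rintro ⟨t₀, x₀⟩ ⟨ht₀, -⟩
  replace ht₀ : t₀ ∈ Ioo 0 T := ht₀
  refine ContinuousAt.continuousWithinAt ?_
  set ρ := min t₀ (T - t₀) / 2 with hρ
  have hρ0 : 0 < ρ := half_pos (lt_min ht₀.1 (by linarith [ht₀.2]))
  have hρ1 : ρ ≤ t₀ / 2 := by rw [hρ]; gcongr; exact min_le_left _ _
  have hρ2 : ρ ≤ (T - t₀) / 2 := by rw [hρ]; gcongr; exact min_le_right _ _
  have hsub : Icc (t₀ - ρ) (t₀ + ρ) ⊆ Ioo 0 T := fun s hs =>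
    ⟨by linarith [hs.1, ht₀.1], by linarith [hs.2, ht₀.2]⟩
  obtain ⟨M, hM⟩ := isCompact_Icc.exists_bound_of_continuousOn (hb.continuousOn.mono hsub)
  have hM0 : 0 ≤ M := (norm_nonneg _).trans (hM t₀ ⟨by linarith, by linarith⟩)
  refine continuousAt_of_locally_uniform_approx_of_continuousAt fun u hu => ?_
  obtain ⟨ε, hε, hεu⟩ := Metric.mem_uniformity_dist.1 hu
  have hlim : Tendsto (fun δ : ℝ => C * M * (2 * √(3 * δ))) (𝓝[>] 0) (𝓝 0) := by
    have h1 : Continuous fun δ : ℝ => C * M * (2 * √(3 * δ)) := by fun_prop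
    have h2 := h1.tendsto 0
    simp only [mul_zero, Real.sqrt_zero] at h2
    exact h2.mono_left nhdsWithin_le_nhds
  obtain ⟨δ, hδε, hδ0, hδρ⟩ := ((hlim.eventually_lt_const hε).and
    (Ioo_mem_nhdsGT (half_pos hρ0))).exists
  set a := t₀ - 2 * δ with ha
  have ha0 : 0 < a := by linarith [ht₀.1]
  have hnear : {p : ℝ × X | p.1 ∈ Ioo (t₀ - δ) (t₀ + δ)} ∈ 𝓝 (t₀, x₀) :=
    continuous_fst.continuousAt.preimage_mem_nhds (Ioo_mem_nhds (by simpa) (by simpa))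
  have hT : ∀ t ∈ Ioo (t₀ - δ) (t₀ + δ), t ∈ Ioo 0 T := fun t ht =>
    hsub ⟨by linarith [ht.1], by linarith [ht.2]⟩
  refine ⟨_, hnear, fun p => ∫ s in (0 : ℝ)..a, G p.1 p.2 s, ?_, fun p hp => hεu ?_⟩
  · refine intervalIntegral.continuousAt_of_dominated_interval
      (bound := fun s => C * ((√δ)⁻¹ * b s)) ?_ ?_ ?_ ?_
    · filter_upwards [hnear] with p hp
      rw [uIoc_of_le ha0.le]
      have hsub' : Ioc 0 a ⊆ Ioo 0 p.1 := fun s hs => ⟨hs.1, by linarith [hs.2, hp.1]⟩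
      exact (hm p.1 (hT _ hp) p.2).mono_set hsub'
    · filter_upwards [hnear] with p hp
      refine Eventually.of_forall fun s hs => ?_
      rw [uIoc_of_le ha0.le] at hs
      refine (hG p.1 (hT _ hp) p.2 s ⟨hs.1, by linarith [hs.2, hp.1]⟩).trans ?_
      have hbs := hb.nonneg s ⟨hs.1, by linarith [hs.2, ht₀.2]⟩
      have h3 : δ ≤ p.1 - s := by linarith [hs.2, hp.1]
      gcongr
    · refine (((intervalIntegrable_iff_integrableOn_Ioo_of_le ha0.le).2 ?_).const_mul _).const_mul _
      exact hb.integrableOn a ⟨ha0, by linarith [ht₀.2]⟩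
    · refine Eventually.of_forall fun s hs => ?_
      rw [uIoc_of_le ha0.le] at hs
      have hsa := hs.2
      refine (hcont s ⟨hs.1, by linarith [ht₀.2]⟩).continuousAt
        ((isOpen_Ioo.prod isOpen_univ).mem_nhds ⟨⟨?_, ht₀.2⟩, mem_univ _⟩)
      change s < t₀
      linarith
  · have hpT := hT _ hp
    have hat : a ≤ p.1 := by linarith [hp.1]
    have hI := hb.intervalIntegrable_of_le hpT (hm _ hpT p.2) (hG _ hpT p.2)
    have h1 : IntervalIntegrable (G p.1 p.2) volume 0 a :=
      hI.mono_set (by rw [uIcc_of_le ha0.le, uIcc_of_le hpT.1.le]; exact Icc_subset_Icc_right hat)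
    have h2 : IntervalIntegrable (G p.1 p.2) volume a p.1 :=
      hI.mono_set (by rw [uIcc_of_le hat, uIcc_of_le hpT.1.le]; exact Icc_subset_Icc_left ha0.le)
    rw [dist_eq_norm, ← intervalIntegral.integral_add_adjacent_intervals h1 h2, add_sub_cancel_left]
    refine lt_of_le_of_lt ?_ hδε
    have h3 : ‖∫ s in a..p.1, G p.1 p.2 s‖ ≤ ∫ s in a..p.1, C * M * (√(p.1 - s))⁻¹ := by
      refine intervalIntegral.norm_integral_le_of_norm_le hat ?_
        ((intervalIntegrable_inv_sqrt_sub hat).const_mul _)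
      filter_upwards [compl_mem_ae_iff.2 (measure_singleton p.1)] with s hsne hs
      have hs' : s < p.1 := lt_of_le_of_ne hs.2 hsne
      refine (hG p.1 hpT p.2 s ⟨ha0.trans hs.1, hs'⟩).trans ?_
      have h4 : b s ≤ M := (le_abs_self _).trans
        (hM s ⟨by linarith [hs.1], by linarith [hp.2]⟩)
      calc C * ((√(p.1 - s))⁻¹ * b s) ≤ C * ((√(p.1 - s))⁻¹ * M) := by gcongr
        _ = _ := by ring
    rw [intervalIntegral.integral_const_mul, integral_inv_sqrt_sub hat] at h3
    refine h3.trans ?_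
    have h5 : p.1 - a ≤ 3 * δ := by linarith [hp.2]
    gcongr

/-- The integrand `(t - s)^{-1/2} b(s)`, cut off to `0 < s < T'` and `0 < t - s < T'`, is integrable
in `(t, s)`. -/
lemma integrable_convolution_integrand (hb : IsTimeDensity T b) {T' : ℝ} (hT' : T' ∈ Ioo 0 T) :
    Integrable (fun p : ℝ × ℝ => (Ioo 0 T').indicator b p.2 *
      (Ioo 0 T').indicator (fun r => (√r)⁻¹) (p.1 - p.2)) (volume.prod volume) :=
  Integrable.convolution_integrand (ContinuousLinearMap.mul ℝ ℝ)
    ((integrable_indicator_iff measurableSet_Ioo).2 (hb.integrableOn T' hT'))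
    ((integrable_indicator_iff measurableSet_Ioo).2
      ((intervalIntegrable_iff_integrableOn_Ioo_of_le hT'.1.le).1
        (intervalIntegrable_inv_sqrt hT'.1.le)))

/-- The half-order integral `∫₀ᵗ (t - s)^{-1/2} b(s) ds` depends continuously on `t`. -/
lemma continuousOn_halfIntegral (hb : IsTimeDensity T b) :
    ContinuousOn (fun t => ∫ s in (0 : ℝ)..t, (√(t - s))⁻¹ * b s) (Ioo 0 T) := by
  have h := hb.continuousOn_integral (X := Unit) (G := fun t _ s => (√(t - s))⁻¹ * b s)
    (C := 1) zero_le_one ?_ ?_ ?_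
  · exact h.comp (f := fun t => (t, ())) (by fun_prop) fun t ht => ⟨ht, mem_univ _⟩
  · intro s hs
    refine ContinuousOn.mul (ContinuousOn.inv₀ (by fun_prop) fun p hp => ?_) continuousOn_const
    exact (Real.sqrt_pos.2 (sub_pos.2 hp.1.1)).ne'
  · exact fun t ht x => (hb.integrableOn_inv_sqrt_sub_mul ht).aestronglyMeasurable
  · intro t ht x s hs
    rw [one_mul, abs_of_nonneg]
    exact mul_nonneg (by positivity) (hb.nonneg s ⟨hs.1, hs.2.trans ht.2⟩)

lemma halfIntegral_nonneg (hb : IsTimeDensity T b) {t : ℝ} (ht : t ∈ Ioo 0 T) :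
    0 ≤ ∫ s in (0 : ℝ)..t, (√(t - s))⁻¹ * b s := by
  rw [intervalIntegral.integral_of_le ht.1.le]
  exact setIntegral_nonneg measurableSet_Ioc fun s hs =>
    mul_nonneg (by positivity) (hb.nonneg s ⟨hs.1, hs.2.trans_lt ht.2⟩)

/-- The half-order integral is a convolution of integrable functions, hence integrable near `0`. -/
lemma integrableOn_halfIntegral (hb : IsTimeDensity T b) {T' : ℝ} (hT' : T' ∈ Ioo 0 T) :
    IntegrableOn (fun t => ∫ s in (0 : ℝ)..t, (√(t - s))⁻¹ * b s) (Ioo 0 T') := by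
  refine (hb.integrable_convolution_integrand hT').integral_prod_left.integrableOn.congr_fun
    (fun t ht => ?_) measurableSet_Ioo
  rw [intervalIntegral.integral_of_le ht.1.le, ← integral_Ioc_eq_integral_Ioo.symm,
    ← integral_indicator measurableSet_Ioo]
  refine integral_congr_ae (Eventually.of_forall fun s => ?_)
  by_cases hs : s ∈ Ioo 0 t
  · rw [indicator_of_mem hs]
    dsimp only
    have hs1 : s ∈ Ioo 0 T' := ⟨hs.1, hs.2.trans ht.2⟩
    have hs2 : t - s ∈ Ioo 0 T' := ⟨sub_pos.2 hs.2, by linarith [hs.1, ht.2]⟩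
    rw [indicator_of_mem hs1, indicator_of_mem hs2, mul_comm]
  · rw [indicator_of_notMem hs]
    dsimp only
    by_cases hs0 : 0 < s
    · rw [indicator_of_notMem (fun h : t - s ∈ Ioo 0 T' => hs ⟨hs0, sub_pos.1 h.1⟩), mul_zero]
    · rw [indicator_of_notMem (fun h : s ∈ Ioo 0 T' => hs0 h.1), zero_mul]

end IsTimeDensity

/-- A continuous function on `(0, T)` lies within distance one below a smooth function. -/
lemma exists_contDiffOn_ge {T : ℝ} {q : ℝ → ℝ} (hq : ContinuousOn q (Ioo 0 T)) :
    ∃ A : ℝ → ℝ, ContDiffOn ℝ ∞ A (Ioo 0 T) ∧ ∀ t ∈ Ioo 0 T, q t ≤ A t ∧ A t ≤ q t + 1 := by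
  -- The interval is transported to the line by the logistic function.
  have hT : ∀ y : ℝ, 0 < T → T / (1 + Real.exp y) ∈ Ioo 0 T := fun y hT =>
    ⟨by positivity, div_lt_self hT (by linarith [Real.exp_pos y])⟩
  rcases le_or_gt T 0 with h0 | h0
  · exact ⟨0, contDiffOn_const, fun t ht => absurd (ht.1.trans ht.2) (not_lt.2 h0)⟩
  have hc : Continuous fun y : ℝ => q (T / (1 + Real.exp y)) + 1 / 2 :=
    (hq.comp_continuous (continuous_const.div (by fun_prop) fun y => by positivity)
      fun y => hT y h0).add continuous_const
  obtain ⟨g, hg, hgq, -⟩ := hc.exists_contDiff_approx ⊤ (ε := fun _ => 1 / 2) continuous_const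
    fun _ => by norm_num
  refine ⟨fun t => g (Real.log (T / t - 1)), ?_, fun t ht => ?_⟩
  · refine hg.comp_contDiffOn (ContDiffOn.log ?_ fun t ht => ?_)
    · exact (contDiffOn_const.div contDiffOn_id fun t ht => ht.1.ne').sub contDiffOn_const
    · exact (sub_pos.2 ((one_lt_div ht.1).2 ht.2)).ne'
  · have h1 : 0 < T / t - 1 := sub_pos.2 ((one_lt_div ht.1).2 ht.2)
    have h2 := hgq (Real.log (T / t - 1))
    rw [Real.exp_log h1, add_sub_cancel, div_div_cancel₀ h0.ne', Real.dist_eq, abs_lt] at h2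
    constructor <;> linarith [h2.1, h2.2]

/-- The reciprocal of a smooth majorant of `1 + t^{-1/2} + ∫₀ᵗ (t - s)^{-1/2} b(s) ds` is a time
weight. -/
lemma IsTimeDensity.exists_isTimeWeight {T : ℝ} {b : ℝ → ℝ} (hb : IsTimeDensity T b) :
    ∃ a : ℝ → ℝ, IsTimeWeight T a ∧ ∀ t ∈ Ioo 0 T,
      a t * (1 + (√t)⁻¹ + ∫ s in (0 : ℝ)..t, (√(t - s))⁻¹ * b s) ≤ 1 := by
  set q : ℝ → ℝ := fun t => 1 + (√t)⁻¹ + ∫ s in (0 : ℝ)..t, (√(t - s))⁻¹ * b s with hq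
  have hqc : ContinuousOn q (Ioo 0 T) := by
    refine ContinuousOn.add (continuousOn_const.add
      (ContinuousOn.inv₀ (by fun_prop) fun t ht => ?_)) hb.continuousOn_halfIntegral
    exact (Real.sqrt_pos.2 ht.1).ne'
  have hq1 : ∀ t ∈ Ioo 0 T, 1 ≤ q t := fun t ht => by
    have h1 := hb.halfIntegral_nonneg ht
    have h2 : 0 ≤ (√t)⁻¹ := by positivity
    simp only [hq]
    linarith
  obtain ⟨A, hA, hAq⟩ := exists_contDiffOn_ge hqc
  have hA0 : ∀ t ∈ Ioo 0 T, 0 < A t := fun t ht => by linarith [hq1 t ht, (hAq t ht).1]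
  refine ⟨fun t => (A t)⁻¹, ⟨hA.inv fun t ht => (hA0 t ht).ne', fun t ht => inv_pos.2 (hA0 t ht),
    fun t ht => ?_⟩, fun t ht => ?_⟩
  · simp only [inv_inv]
    have hsub : Ioo 0 t ⊆ Ioo 0 T := Ioo_subset_Ioo_right ht.2.le
    have hint : IntegrableOn (fun s => q s + 1) (Ioo 0 t) :=
      (((integrableOn_const (by simp)).add ((intervalIntegrable_iff_integrableOn_Ioo_of_le
        ht.1.le).1 (intervalIntegrable_inv_sqrt ht.1.le))).add
          (hb.integrableOn_halfIntegral ht)).add (integrableOn_const (by simp))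
    refine hint.mono' ((hA.continuousOn.mono hsub).aestronglyMeasurable measurableSet_Ioo)
      (ae_restrict_of_forall_mem measurableSet_Ioo fun s hs => ?_)
    rw [Real.norm_of_nonneg (hA0 s (hsub hs)).le]
    exact (hAq s (hsub hs)).2
  · rw [inv_mul_le_iff₀ (hA0 t ht), mul_one]
    exact (hAq t ht).1

end TimeIntegrals

/-! ### The Duhamel integral -/

section Duhamel

variable {d : ℕ} {T : ℝ} {b : ℝ → ℝ} {g : ℝ → Space d → ℝ}

/-- A source term `g` on `(0, T) × ℝ^d` that is smooth and whose mean oscillation at time `s` is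
bounded by `K b(s)`, with `b` integrable near `0`. -/
structure IsDuhamelSource (T : ℝ) (b : ℝ → ℝ) (K : ℝ) (g : ℝ → Space d → ℝ) : Prop where
  density : IsTimeDensity T b
  nonneg : 0 ≤ K
  contDiffOn : ContDiffOn ℝ ∞ (fun p : ℝ × Space d => g p.1 p.2) (Ioo 0 T ×ˢ univ)
  meanOscLE : ∀ s ∈ Ioo 0 T, MeanOscLE (g s) (K * b s)

/-- The integral `∫₀ᵗ ∂_e e^{(t - s)Δ} g(s) ds`. -/
noncomputable def duhamelTerm (e : Space d) (g : ℝ → Space d → ℝ) (t : ℝ) (x : Space d) : ℝ :=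
  ∫ s in (0 : ℝ)..t, fderiv ℝ (heatSemigroup (t - s) (g s)) x e

lemma isOpen_timeSlab : IsOpen (Ioo (0 : ℝ) T ×ˢ (univ : Set (Space d))) :=
  isOpen_Ioo.prod isOpen_univ

/-- A function that is continuous on an open set times a test function supported there is
integrable. -/
lemma integrable_mul_of_tsupport_subset {E : Type*} [TopologicalSpace E] [MeasurableSpace E]
    [OpensMeasurableSpace E] {μ : Measure E} [IsFiniteMeasureOnCompacts μ] {U : Set E}
    (hU : IsOpen U) {F φ : E → ℝ} (hF : ContinuousOn F U) (hφ : Continuous φ)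
    (hc : HasCompactSupport φ) (hs : tsupport φ ⊆ U) : Integrable (fun p => F p * φ p) μ := by
  have hcont : Continuous fun p => F p * φ p :=
    continuous_of_tsupport fun p hp => (hF.continuousAt
      (hU.mem_nhds (hs (tsupport_mul_subset_right hp)))).mul hφ.continuousAt
  exact hcont.integrable_of_hasCompactSupport hc.mul_left

namespace IsDuhamelSource

variable {K : ℝ}

/-- The Duhamel integrand is jointly measurable in `(t, x, s)` on the domain `0 < s < t`, where it
is the integral of a measurable function depending on parameters. -/
lemma exists_stronglyMeasurable (hg : IsDuhamelSource T b K g) (e : Space d) :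
    ∃ H : (ℝ × Space d) × ℝ → ℝ, StronglyMeasurable H ∧ ∀ p : ℝ × Space d, ∀ s ∈ Ioo 0 T,
      s < p.1 → H (p, s) = fderiv ℝ (heatSemigroup (p.1 - s) (g s)) p.2 e := by
  classical
  set G : ℝ × Space d → ℝ := (Ioo 0 T ×ˢ univ).indicator fun p => g p.1 p.2 with hG
  have hGm : Measurable G := by
    rw [hG, ← piecewise_eq_indicator]
    exact hg.contDiffOn.continuousOn.measurable_piecewise continuousOn_const
      isOpen_timeSlab.measurableSet
  refine ⟨fun q => ∫ y, heatKernelDir e (q.1.1 - q.2) (q.1.2 - y) * G (q.2, y), ?_, ?_⟩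
  · have h1 : Measurable fun r : ((ℝ × Space d) × ℝ) × Space d =>
        heatKernelDir e (r.1.1.1 - r.1.2) (r.1.1.2 - r.2) * G (r.1.2, r.2) :=
      ((measurable_heatKernelDir e).comp (f := fun r : ((ℝ × Space d) × ℝ) × Space d =>
        (r.1.1.1 - r.1.2, r.1.1.2 - r.2)) (by fun_prop)).mul (hGm.comp (by fun_prop))
    exact h1.stronglyMeasurable.integral_prod_right'
  · intro p s hs hsp
    dsimp only
    rw [(hg.meanOscLE s hs).heatIntegrable.fderiv_heatSemigroup_apply (sub_pos.2 hsp)]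
    refine integral_congr_ae (Eventually.of_forall fun y => ?_)
    dsimp only
    have hsy : (s, y) ∈ Ioo 0 T ×ˢ (univ : Set (Space d)) := ⟨hs, mem_univ _⟩
    rw [hG, indicator_of_mem hsy]

lemma aestronglyMeasurable (hg : IsDuhamelSource T b K g) (e : Space d) {t : ℝ} (ht : t ∈ Ioo 0 T)
    (x : Space d) : AEStronglyMeasurable (fun s => fderiv ℝ (heatSemigroup (t - s) (g s)) x e)
      (volume.restrict (Ioo 0 t)) := by
  obtain ⟨H, hH, hHe⟩ := hg.exists_stronglyMeasurable e
  refine (hH.comp_measurable (measurable_prodMk_left (x := (t, x)))).aestronglyMeasurable.congr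
    (ae_restrict_of_forall_mem measurableSet_Ioo fun s hs => ?_)
  exact hHe (t, x) s ⟨hs.1, hs.2.trans ht.2⟩ hs.2

lemma exists_integrand_le (hg : IsDuhamelSource T b K g) (e : Space d) :
    ∃ C, 0 ≤ C ∧ ∀ t ∈ Ioo 0 T, ∀ x, ∀ s ∈ Ioo 0 t,
      |fderiv ℝ (heatSemigroup (t - s) (g s)) x e| ≤ C * ((√(t - s))⁻¹ * b s) := by
  obtain ⟨C, hC, h⟩ := exists_fderiv_heatSemigroup_le d
  have hK := hg.nonneg
  refine ⟨C * ‖e‖ * K, by positivity, fun t ht x s hs => ?_⟩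
  refine (h (g s) _ (hg.meanOscLE s ⟨hs.1, hs.2.trans ht.2⟩) (t - s) (sub_pos.2 hs.2) x e).trans
    (le_of_eq ?_)
  ring

lemma intervalIntegrable (hg : IsDuhamelSource T b K g) (e : Space d) {t : ℝ} (ht : t ∈ Ioo 0 T)
    (x : Space d) : IntervalIntegrable (fun s => fderiv ℝ (heatSemigroup (t - s) (g s)) x e)
      volume 0 t := by
  obtain ⟨C, -, h⟩ := hg.exists_integrand_le e
  exact hg.density.intervalIntegrable_of_le ht (hg.aestronglyMeasurable e ht x) (h t ht x)

lemma continuousOn_duhamelTerm (hg : IsDuhamelSource T b K g) (e : Space d) :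
    ContinuousOn (fun p : ℝ × Space d => duhamelTerm e g p.1 p.2) (Ioo 0 T ×ˢ univ) := by
  obtain ⟨C, hC, h⟩ := hg.exists_integrand_le e
  refine hg.density.continuousOn_integral (X := Space d)
    (G := fun t x s => fderiv ℝ (heatSemigroup (t - s) (g s)) x e) hC (fun s hs => ?_)
    (fun t ht x => hg.aestronglyMeasurable e ht x) h
  exact ((hg.meanOscLE s hs).heatIntegrable.continuousOn_fderiv_heatSemigroup e).comp
    (f := fun p : ℝ × Space d => (p.1 - s, p.2)) (by fun_prop)
    fun p hp => ⟨sub_pos.2 hp.1.1, mem_univ _⟩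

lemma exists_abs_duhamelTerm_le (hg : IsDuhamelSource T b K g) (e : Space d) :
    ∃ C, 0 ≤ C ∧ ∀ t ∈ Ioo 0 T, ∀ x,
      |duhamelTerm e g t x| ≤ C * ∫ s in (0 : ℝ)..t, (√(t - s))⁻¹ * b s := by
  obtain ⟨C, hC, h⟩ := hg.exists_integrand_le e
  refine ⟨C, hC, fun t ht x => ?_⟩
  rw [duhamelTerm, ← Real.norm_eq_abs, intervalIntegral.integral_of_le ht.1.le,
    intervalIntegral.integral_of_le ht.1.le, integral_Ioc_eq_integral_Ioo,
    integral_Ioc_eq_integral_Ioo, ← integral_const_mul]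
  exact norm_integral_le_of_norm_le ((hg.density.integrableOn_inv_sqrt_sub_mul ht).const_mul C)
    (ae_restrict_of_forall_mem measurableSet_Ioo (h t ht x))

/-- The Duhamel integrand, tested against `ψ`, is integrable in `(t, x, s)`. -/
lemma integrable_indicator_mul (hg : IsDuhamelSource T b K g) (e : Space d)
    {ψ : ℝ × Space d → ℝ} (hψ : Continuous ψ) (hc : HasCompactSupport ψ)
    (hs : tsupport ψ ⊆ Ioo 0 T ×ˢ univ) :
    Integrable (fun q : (ℝ × Space d) × ℝ => (Ioo 0 q.1.1).indicator
      (fun s => fderiv ℝ (heatSemigroup (q.1.1 - s) (g s)) q.1.2 e) q.2 * ψ q.1)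
      (volume.prod volume) := by
  obtain ⟨C, hC, h⟩ := hg.exists_integrand_le e
  obtain ⟨H, hH, hHe⟩ := hg.exists_stronglyMeasurable e
  have hψ0 : ∀ p, p.1 ∉ Ioo 0 T → ψ p = 0 := fun p hp =>
    image_eq_zero_of_notMem_tsupport fun h' => hp (hs h').1
  have hmeas : AEStronglyMeasurable (fun q : (ℝ × Space d) × ℝ => (Ioo 0 q.1.1).indicator
      (fun s => fderiv ℝ (heatSemigroup (q.1.1 - s) (g s)) q.1.2 e) q.2 * ψ q.1)
      (volume.prod volume) := by
    have hS : MeasurableSet {q : (ℝ × Space d) × ℝ | 0 < q.2 ∧ q.2 < q.1.1} :=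
      (measurableSet_lt measurable_const measurable_snd).inter
        (measurableSet_lt measurable_snd (measurable_fst.comp measurable_fst))
    refine ((hH.indicator hS).mul (hψ.stronglyMeasurable.comp_measurable
      measurable_fst)).aestronglyMeasurable.congr (Eventually.of_forall fun q => ?_)
    by_cases hq : q.1.1 ∈ Ioo 0 T
    · simp only [Pi.mul_apply, Function.comp_apply]
      congr 1
      by_cases hq2 : q.2 ∈ Ioo 0 q.1.1
      · rw [indicator_of_mem hq2, indicator_of_mem (by exact hq2)]
        exact hHe q.1 q.2 ⟨hq2.1, hq2.2.trans hq.2⟩ hq2.2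
      · rw [indicator_of_notMem hq2, indicator_of_notMem (by exact hq2)]
    · simp [hψ0 q.1 hq]
  have hle : ∀ p : ℝ × Space d, p.1 ∈ Ioo 0 T → ∀ s,
      ‖(Ioo 0 p.1).indicator (fun s => fderiv ℝ (heatSemigroup (p.1 - s) (g s)) p.2 e) s * ψ p‖ ≤
        (Ioo 0 p.1).indicator (fun s => C * ((√(p.1 - s))⁻¹ * b s)) s * |ψ p| := by
    intro p hp s
    rw [norm_mul, Real.norm_eq_abs, Real.norm_eq_abs]
    refine mul_le_mul_of_nonneg_right ?_ (abs_nonneg _)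
    by_cases hs' : s ∈ Ioo 0 p.1
    · rw [indicator_of_mem hs', indicator_of_mem hs']
      exact h p.1 hp p.2 s hs'
    · rw [indicator_of_notMem hs', indicator_of_notMem hs', abs_zero]
  rw [integrable_prod_iff hmeas]
  constructor
  · refine Eventually.of_forall fun p => ?_
    by_cases hp : p.1 ∈ Ioo 0 T
    · exact Integrable.mul_const ((integrable_indicator_iff measurableSet_Ioo).2
        (hg.density.integrableOn_of_le hp (hg.aestronglyMeasurable e hp p.2) (h p.1 hp p.2))) (ψ p)
    · simp [hψ0 p hp]
  · have hint : Integrable fun p : ℝ × Space d =>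
        (C * ∫ s in (0 : ℝ)..p.1, (√(p.1 - s))⁻¹ * b s) * |ψ p| := by
      refine integrable_mul_of_tsupport_subset isOpen_timeSlab (continuousOn_const.mul
        (hg.density.continuousOn_halfIntegral.comp (by fun_prop) fun p hp => hp.1)) hψ.abs
        (hc.comp_left abs_zero) (subset_trans (closure_mono ?_) hs)
      exact fun p hp => by simpa using hp
    refine hint.mono' hmeas.norm.integral_prod_right' (Eventually.of_forall fun p => ?_)
    rw [Real.norm_of_nonneg (integral_nonneg fun s => norm_nonneg _)]
    by_cases hp : p.1 ∈ Ioo 0 T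
    · have hk : Integrable ((Ioo 0 p.1).indicator (fun s => C * ((√(p.1 - s))⁻¹ * b s))) :=
        (integrable_indicator_iff measurableSet_Ioo).2
          ((hg.density.integrableOn_inv_sqrt_sub_mul hp).const_mul C)
      refine (integral_mono_of_nonneg (Eventually.of_forall fun s => norm_nonneg _)
        (hk.mul_const |ψ p|) (Eventually.of_forall (hle p hp))).trans (le_of_eq ?_)
      rw [integral_mul_const, integral_indicator measurableSet_Ioo, integral_const_mul,
        intervalIntegral.integral_of_le hp.1.le, integral_Ioc_eq_integral_Ioo]
    · simp [hψ0 p hp]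

/-- The Duhamel term is a weak solution of the heat equation with source `∂_e g`. -/
theorem integral_duhamelTerm_mul_heatOp (hg : IsDuhamelSource T b K g) (e : Space d)
    {φ : ℝ × Space d → ℝ} (hφ : ContDiff ℝ ∞ φ) (hc : HasCompactSupport φ)
    (hs : tsupport φ ⊆ Ioo 0 T ×ˢ univ) :
    ∫ p : ℝ × Space d, duhamelTerm e g p.1 p.2 * heatOp (-1) φ p =
      ∫ p : ℝ × Space d, spaceDeriv e (fun p => g p.1 p.2) p * φ p := by
  have hψs := (tsupport_heatOp_subset (-1) φ).trans hs
  have hI := hg.integrable_indicator_mul e (hφ.heatOp (-1)).continuous (hc.heatOp (-1)) hψs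
  have hzero : ∀ {ψ : ℝ × Space d → ℝ}, tsupport ψ ⊆ Ioo 0 T ×ˢ univ → ∀ t x, t ∉ Ioo 0 T →
      ψ (t, x) = 0 := fun h t x ht => image_eq_zero_of_notMem_tsupport fun h' => ht (h h').1
  obtain ⟨R, hR0, hR⟩ := hc.exists_time_bound
  obtain ⟨R', hR0', hR'⟩ := (hc.heatOp (-1)).exists_time_bound
  -- The time integral of the tested solution, for a source concentrated at time `s`.
  have hslice : ∀ s, Integrable (fun p : ℝ × Space d => (Ioo 0 p.1).indicator
      (fun s => fderiv ℝ (heatSemigroup (p.1 - s) (g s)) p.2 e) s * heatOp (-1) φ p)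
        (volume.prod volume) →
      ∫ p : ℝ × Space d, (Ioo 0 p.1).indicator
        (fun s => fderiv ℝ (heatSemigroup (p.1 - s) (g s)) p.2 e) s * heatOp (-1) φ p =
      ∫ y, spaceDeriv e (fun p => g p.1 p.2) (s, y) * φ (s, y) := by
    intro s hint
    by_cases hsT : s ∈ Ioo 0 T
    · have hsR : s ≤ max s (max R R') := le_max_left _ _
      have hφR : ∀ x, φ (max s (max R R'), x) = 0 := fun x =>
        hR _ ((le_max_left _ _).trans (le_max_right _ _))
      have hgi := (hg.meanOscLE s hsT).heatIntegrable
      have h1 := hgi.integral_fderiv_heatSemigroup_mul_heatOp hφ hc hsR hφR e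
      have hgs : ContDiff ℝ ∞ (g s) :=
        contDiffOn_univ.1 (hg.contDiffOn.comp (f := fun y => (s, y)) (by fun_prop)
          fun y _ => ⟨hsT, mem_univ _⟩)
      have hφs : ContDiff ℝ ∞ fun y => φ (s, y) := hφ.comp (by fun_prop)
      have h2 := integral_mul_fderiv_eq (μ := volume) (hgs.of_le (by simp)) (hφs.of_le (by simp))
        (hasCompactSupport_slice hc s) e
      have h3 : ∀ y, fderiv ℝ (fun y => φ (s, y)) y e = spaceDeriv e φ (s, y) := fun y =>
        fderiv_slice (p := (s, y)) (hφ.differentiable (by simp) _) e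
      have h4 : ∀ y, fderiv ℝ (g s) y e = spaceDeriv e (fun p => g p.1 p.2) (s, y) := fun y =>
        fderiv_slice (φ := fun p => g p.1 p.2) (p := (s, y)) ((hg.contDiffOn.differentiableOn
          (by simp)).differentiableAt (isOpen_timeSlab.mem_nhds ⟨hsT, mem_univ _⟩)) e
      simp only [h3, h4] at h2
      rw [h2, neg_neg] at h1
      rw [← h1, Measure.volume_eq_prod, integral_prod _ hint,
        intervalIntegral.integral_of_le hsR, ← integral_indicator measurableSet_Ioc]
      refine integral_congr_ae (Eventually.of_forall fun t => ?_)
      dsimp only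
      by_cases ht : t ∈ Ioc s (max s (max R R'))
      · rw [indicator_of_mem ht]
        refine integral_congr_ae (Eventually.of_forall fun x => ?_)
        dsimp only
        have hst : s ∈ Ioo 0 t := ⟨hsT.1, ht.1⟩
        rw [indicator_of_mem hst]
      · rw [indicator_of_notMem ht]
        refine integral_eq_zero_of_ae (Eventually.of_forall fun x => ?_)
        dsimp only
        by_cases hst : s < t
        · have : R' ≤ t := by
            by_contra hlt
            exact ht ⟨hst, (not_le.1 hlt).le.trans ((le_max_right _ _).trans (le_max_right _ _))⟩
          rw [hR' (t, x) this, mul_zero]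
          rfl
        · rw [indicator_of_notMem (fun h => hst h.2), zero_mul]
          rfl
    · have h1 : ∀ p : ℝ × Space d, (Ioo 0 p.1).indicator
          (fun s => fderiv ℝ (heatSemigroup (p.1 - s) (g s)) p.2 e) s * heatOp (-1) φ p = 0 := by
        intro p
        by_cases hsp : s ∈ Ioo 0 p.1
        · rw [hzero hψs p.1 p.2 fun h => hsT ⟨hsp.1, hsp.2.trans h.2⟩, mul_zero]
        · rw [indicator_of_notMem hsp, zero_mul]
      simp only [h1, hzero hs s _ hsT, mul_zero, integral_zero]
  have hF : Integrable (fun p : ℝ × Space d => spaceDeriv e (fun p => g p.1 p.2) p * φ p)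
      (volume.prod volume) :=
    integrable_mul_of_tsupport_subset isOpen_timeSlab
      (hg.contDiffOn.spaceDeriv isOpen_timeSlab e).continuousOn hφ.continuous hc hs
  calc ∫ p : ℝ × Space d, duhamelTerm e g p.1 p.2 * heatOp (-1) φ p
      = ∫ p : ℝ × Space d, ∫ s, (Ioo 0 p.1).indicator
          (fun s => fderiv ℝ (heatSemigroup (p.1 - s) (g s)) p.2 e) s * heatOp (-1) φ p := by
        refine integral_congr_ae (Eventually.of_forall fun p => ?_)
        dsimp only
        by_cases hp : p.1 ∈ Ioo 0 T
        · rw [integral_mul_const, integral_indicator measurableSet_Ioo, duhamelTerm,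
            intervalIntegral.integral_of_le hp.1.le, integral_Ioc_eq_integral_Ioo]
        · have : heatOp (-1) φ p = 0 := hzero hψs p.1 p.2 hp
          simp [this]
    _ = ∫ s, ∫ p : ℝ × Space d, (Ioo 0 p.1).indicator
          (fun s => fderiv ℝ (heatSemigroup (p.1 - s) (g s)) p.2 e) s * heatOp (-1) φ p :=
        integral_integral_swap hI
    _ = ∫ s, ∫ y, spaceDeriv e (fun p => g p.1 p.2) (s, y) * φ (s, y) := by
        refine integral_congr_ae ?_
        filter_upwards [hI.prod_left_ae] with s hint
        exact hslice s hint
    _ = _ := (integral_prod _ hF).symm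

/-- Tested against a fixed function, the Duhamel term vanishes as `t → 0`: the derivative is moved
to the test function, so that only `∫₀ᵗ b` remains. -/
lemma tendsto_integral_duhamelTerm_mul (hT : 0 < T) (hg : IsDuhamelSource T b K g) (e : Space d)
    {φ : Space d → ℝ} (hφ : ContDiff ℝ ∞ φ) (hc : HasCompactSupport φ) :
    Tendsto (fun t => ∫ x, duhamelTerm e g t x * φ x) (𝓝[>] 0) (𝓝 0) := by
  obtain ⟨C, hC, h⟩ := exists_integral_fderiv_heatSemigroup_mul_le hφ hc T e
  obtain ⟨C', hC', h'⟩ := hg.exists_integrand_le e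
  obtain ⟨H, hH, hHe⟩ := hg.exists_stronglyMeasurable e
  have hT2 : T / 2 ∈ Ioo 0 T := ⟨half_pos hT, half_lt_self hT⟩
  have hK := hg.nonneg
  have hle : ∀ t ∈ Ioo 0 T, |∫ x, duhamelTerm e g t x * φ x| ≤
      ∫ s in (0 : ℝ)..t, C * (K * b s) := by
    intro t ht
    have hI : Integrable (fun q : Space d × ℝ =>
        fderiv ℝ (heatSemigroup (t - q.2) (g q.2)) q.1 e * φ q.1)
        (volume.prod (volume.restrict (Ioo 0 t))) := by
      have hm : AEStronglyMeasurable (fun q : Space d × ℝ =>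
          fderiv ℝ (heatSemigroup (t - q.2) (g q.2)) q.1 e * φ q.1)
          (volume.prod (volume.restrict (Ioo 0 t))) := by
        have h1 : StronglyMeasurable fun q : Space d × ℝ => H ((t, q.1), q.2) * φ q.1 :=
          (hH.comp_measurable (by fun_prop)).mul
            (hφ.continuous.stronglyMeasurable.comp_measurable measurable_fst)
        refine h1.aestronglyMeasurable.congr ?_
        have h2 : ∀ᵐ q : Space d × ℝ ∂(volume.prod (volume.restrict (Ioo 0 t))),
            q.2 ∈ Ioo 0 t :=
          Measure.quasiMeasurePreserving_snd.ae (ae_restrict_mem measurableSet_Ioo)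
        filter_upwards [h2] with q hq
        rw [hHe (t, q.1) q.2 ⟨hq.1, hq.2.trans ht.2⟩ hq.2]
      rw [integrable_prod_iff hm]
      refine ⟨Eventually.of_forall fun x => Integrable.mul_const
        (hg.density.integrableOn_of_le ht (hg.aestronglyMeasurable e ht x) (h' t ht x)) (φ x), ?_⟩
      have hint : Integrable fun x => (∫ s in Ioo 0 t, C' * ((√(t - s))⁻¹ * b s)) * |φ x| :=
        ((hφ.continuous.integrable_of_hasCompactSupport hc).abs).const_mul _
      refine hint.mono' hm.norm.integral_prod_right' (Eventually.of_forall fun x => ?_)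
      rw [Real.norm_of_nonneg (integral_nonneg fun s => norm_nonneg _), ← integral_mul_const]
      refine integral_mono_of_nonneg (Eventually.of_forall fun s => norm_nonneg _)
        (((hg.density.integrableOn_inv_sqrt_sub_mul ht).const_mul C').mul_const |φ x|)
        (ae_restrict_of_forall_mem measurableSet_Ioo fun s hs => ?_)
      dsimp only
      rw [norm_mul, Real.norm_eq_abs, Real.norm_eq_abs]
      exact mul_le_mul_of_nonneg_right (h' t ht x s hs) (abs_nonneg _)
    have h1 : ∫ x, duhamelTerm e g t x * φ x = ∫ s in Ioo 0 t, ∫ x,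
        fderiv ℝ (heatSemigroup (t - s) (g s)) x e * φ x := by
      rw [← integral_integral_swap hI]
      refine integral_congr_ae (Eventually.of_forall fun x => ?_)
      dsimp only
      rw [integral_mul_const, duhamelTerm, intervalIntegral.integral_of_le ht.1.le,
        integral_Ioc_eq_integral_Ioo]
    rw [h1, intervalIntegral.integral_of_le ht.1.le, integral_Ioc_eq_integral_Ioo,
      ← Real.norm_eq_abs]
    refine norm_integral_le_of_norm_le (((hg.density.integrableOn t ht).const_mul K).const_mul C)
      (ae_restrict_of_forall_mem measurableSet_Ioo fun s hs => ?_)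
    exact h (g s) _ (hg.meanOscLE s ⟨hs.1, hs.2.trans ht.2⟩) (t - s) (sub_pos.2 hs.2)
      (by linarith [hs.1, ht.2])
  have hlim : Tendsto (fun t => ∫ s in (0 : ℝ)..t, C * (K * b s)) (𝓝[>] 0) (𝓝 0) := by
    have hb : IntegrableOn (fun s => C * (K * b s)) (Icc 0 (T / 2)) :=
      (integrableOn_Icc_iff_integrableOn_Ioo enorm_ne_top enorm_ne_top).2
        (((hg.density.integrableOn _ hT2).const_mul K).const_mul C)
    have h1 := intervalIntegral.continuousOn_primitive_interval
      (by rwa [uIcc_of_le hT2.1.le] : IntegrableOn (fun s => C * (K * b s)) (uIcc 0 (T / 2)))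
    have h2 := h1 0 left_mem_uIcc
    rw [ContinuousWithinAt, intervalIntegral.integral_same, uIcc_of_le hT2.1.le] at h2
    refine h2.mono_left (nhdsWithin_le_of_mem ?_)
    exact mem_of_superset (Ioo_mem_nhdsGT hT2.1) Ioo_subset_Icc_self
  refine squeeze_zero_norm' ?_ hlim
  filter_upwards [Ioo_mem_nhdsGT hT] with t ht
  exact hle t ht

end IsDuhamelSource

end Duhamel

/-! ### The components of the solution -/

section Components

variable {d : ℕ} {T : ℝ} {b : ℝ → ℝ} {K : Fin d → ℝ} {v : Space d → ℝ}
  {G : Fin d → ℝ → Space d → ℝ}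

/-- One component of the Duhamel formula, `e^{tΔ} v + ∫₀ᵗ ∑_j ∂_j e^{(t - s)Δ} G_j(s) ds`. -/
noncomputable def duhamelSum (v : Space d → ℝ) (G : Fin d → ℝ → Space d → ℝ) (p : ℝ × Space d) :
    ℝ :=
  heatSemigroup p.1 v p.2 + ∑ j, duhamelTerm (EuclideanSpace.single j 1) (G j) p.1 p.2

/-- One component of the divergence, `∑_j ∂_j G_j`. -/
noncomputable def divergenceSum (G : Fin d → ℝ → Space d → ℝ) (p : ℝ × Space d) : ℝ :=
  ∑ j, spaceDeriv (EuclideanSpace.single j 1) (fun p => G j p.1 p.2) p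

/-- Away from the initial time, `e^{tΔ} v` is a weak solution of the homogeneous heat equation. -/
lemma integral_heatSemigroup_mul_heatOp_eq_zero (hv : HeatIntegrable v) {φ : ℝ × Space d → ℝ}
    (hφ : ContDiff ℝ ∞ φ) (hc : HasCompactSupport φ) (hs : tsupport φ ⊆ Ioo 0 T ×ˢ univ) :
    Integrable (fun p : ℝ × Space d => heatSemigroup p.1 v p.2 * heatOp (-1) φ p) ∧
      ∫ p : ℝ × Space d, heatSemigroup p.1 v p.2 * heatOp (-1) φ p = 0 := by
  have hψs := (tsupport_heatOp_subset (-1) φ).trans hs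
  have hint : Integrable (fun p : ℝ × Space d => heatSemigroup p.1 v p.2 * heatOp (-1) φ p) :=
    integrable_mul_of_tsupport_subset (isOpen_Ioi.prod isOpen_univ) hv.continuousOn_heatSemigroup
      (hφ.heatOp (-1)).continuous (hc.heatOp (-1))
      (hψs.trans (prod_mono Ioo_subset_Ioi_self subset_rfl))
  refine ⟨hint, ?_⟩
  obtain ⟨R, hR0, hR⟩ := hc.exists_time_bound
  obtain ⟨R', hR0', hR'⟩ := (hc.heatOp (-1)).exists_time_bound
  have hRR : 0 ≤ max R R' := hR0.trans (le_max_left _ _)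
  have h1 := hv.integral_heatSemigroup_mul_heatOp hφ hc hRR
    fun x => hR (max R R', x) (le_max_left _ _)
  have h2 : ∀ y, φ (0, y) = 0 := fun y =>
    image_eq_zero_of_notMem_tsupport fun h' => lt_irrefl _ (hs h').1.1
  simp only [h2, mul_zero, integral_zero, sub_zero] at h1
  rw [Measure.volume_eq_prod] at hint ⊢
  rw [integral_prod _ hint, ← h1, intervalIntegral.integral_of_le hRR,
    ← integral_indicator measurableSet_Ioc]
  refine integral_congr_ae (Eventually.of_forall fun t => ?_)
  dsimp only
  by_cases ht : t ∈ Ioc 0 (max R R')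
  · rw [indicator_of_mem ht]
  · rw [indicator_of_notMem ht]
    refine integral_eq_zero_of_ae (Eventually.of_forall fun x => ?_)
    have h3 : heatOp (-1) φ (t, x) = 0 := by
      by_cases h0 : 0 < t
      · have h4 : max R R' < t := not_le.1 fun h => ht ⟨h0, h⟩
        exact hR' _ ((le_max_right _ _).trans h4.le)
      · exact image_eq_zero_of_notMem_tsupport fun h' => h0 (hψs h').1.1
    simp [h3]

lemma iterSpaceDeriv_sum {ι : Type*} (s : Finset ι) {U : Set (ℝ × Space d)} (hU : IsOpen U)
    {w : ι → ℝ × Space d → ℝ} (hw : ∀ i, ContDiffOn ℝ ∞ (w i) U) (l : List (Space d)) :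
    ∀ p ∈ U, iterSpaceDeriv l (fun p => ∑ i ∈ s, w i p) p = ∑ i ∈ s, iterSpaceDeriv l (w i) p := by
  induction l with
  | nil => exact fun p _ => rfl
  | cons e l ih =>
    intro p hp
    have h1 : iterSpaceDeriv l (fun p => ∑ i ∈ s, w i p) =ᶠ[𝓝 p]
        fun p => ∑ i ∈ s, iterSpaceDeriv l (w i) p := by
      filter_upwards [hU.mem_nhds hp] with q hq using ih q hq
    rw [iterSpaceDeriv_cons, spaceDeriv, h1.fderiv_eq, fderiv_fun_sum fun i _ =>
      ((((hw i).iterSpaceDeriv hU l).differentiableOn (by simp)).differentiableAt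
        (hU.mem_nhds hp)), _root_.sum_apply]
    rfl

/-- Spatial analyticity of the source gives Cauchy estimates for its divergence in the form needed
by the regularity theory. -/
lemma exists_divergenceSum_cauchy_estimate
    (hG : ∀ j, ContDiffOn ℝ ∞ (fun p : ℝ × Space d => G j p.1 p.2) (Ioo 0 T ×ˢ univ))
    (hA : ∀ j, SpaceAnalytic T (G j)) {t₀ : ℝ} (ht₀ : t₀ ∈ Ioo 0 T) (x₀ : Space d) :
    ∃ C₀ R : ℝ, ∀ᶠ p in 𝓝 (t₀, x₀), ∀ l : List (Space d), (∀ e ∈ l, ‖e‖ = 1) →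
      |iterSpaceDeriv l (divergenceSum G) p| ≤ C₀ * R ^ l.length * l.length ^ l.length := by
  choose C R hCR using fun j => hA j t₀ ht₀ x₀
  refine ⟨∑ j, |C j| * |R j|, 2 * ∑ j, |R j|, ?_⟩
  filter_upwards [isOpen_timeSlab.mem_nhds (⟨ht₀, mem_univ _⟩ : (t₀, x₀) ∈ Ioo 0 T ×ˢ univ),
    eventually_all.2 hCR] with p hpU hp l hl
  have h1 : iterSpaceDeriv l (divergenceSum G) p =
      ∑ j, iterSpaceDeriv (l ++ [EuclideanSpace.single j 1]) (fun p => G j p.1 p.2) p := by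
    refine (iterSpaceDeriv_sum Finset.univ isOpen_timeSlab
      (fun j => (hG j).spaceDeriv isOpen_timeSlab _) l p hpU).trans ?_
    simp only [iterSpaceDeriv, List.foldr_append, List.foldr_cons, List.foldr_nil]
  have h2 : ∀ j, |iterSpaceDeriv (l ++ [EuclideanSpace.single j 1]) (fun p => G j p.1 p.2) p| ≤
      |C j| * |R j| * (2 * ∑ j, |R j|) ^ l.length * l.length ^ l.length := by
    intro j
    set l' : List (Space d) := l ++ [EuclideanSpace.single j 1] with hl'
    have hlen : l'.length = l.length + 1 := by simp [hl']
    have hunit' : ∀ e ∈ l', ‖e‖ = 1 := by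
      intro e he
      rw [hl', List.mem_append, List.mem_singleton] at he
      rcases he with he | rfl
      · exact hl _ he
      · simp
    have hunit : ∀ i : Fin l'.length, ‖l'.get i‖ = 1 := fun i => hunit' _ (List.get_mem l' i)
    have h3 := iteratedFDeriv_slice isOpen_Ioo (hG j) hpU.1 l'.length p.2 l'.get
    rw [List.ofFn_get] at h3
    have h4 := ((iteratedFDeriv ℝ l'.length (G j p.1) p.2).le_opNorm l'.get).trans
      (mul_le_mul_of_nonneg_right (hp j l'.length) (Finset.prod_nonneg fun i _ => norm_nonneg _))
    simp only [hunit, Finset.prod_const_one, mul_one] at h4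
    rw [show iteratedFDeriv ℝ l'.length (G j p.1) p.2 l'.get =
      iterSpaceDeriv l' (fun p => G j p.1 p.2) p from h3, Real.norm_eq_abs] at h4
    -- the derivative lost to the divergence only changes the geometric factor
    have h5 : ((l.length + 1).factorial : ℝ) ≤ 2 ^ l.length * l.length ^ l.length := by
      rw [Nat.factorial_succ]
      exact_mod_cast Nat.mul_le_mul (Nat.lt_two_pow_self (n := l.length))
        (Nat.factorial_le_pow l.length)
    have h6 : |R j| ≤ ∑ j, |R j| :=
      Finset.single_le_sum (f := fun j => |R j|) (fun _ _ => abs_nonneg _) (Finset.mem_univ j)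
    calc _ ≤ C j * R j ^ l'.length * l'.length.factorial := h4
      _ ≤ |C j| * |R j| ^ l'.length * l'.length.factorial := by
        refine mul_le_mul_of_nonneg_right ?_ (by positivity)
        rw [← abs_pow, ← abs_mul]
        exact le_abs_self _
      _ = |C j| * |R j| * |R j| ^ l.length * (l.length + 1).factorial := by
        rw [hlen, pow_succ]
        ring
      _ ≤ |C j| * |R j| * (∑ j, |R j|) ^ l.length * (2 ^ l.length * l.length ^ l.length) := by
        gcongr
      _ = _ := by
        rw [mul_pow]
        ring
  rw [h1, Finset.sum_mul, Finset.sum_mul]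
  exact (Finset.abs_sum_le_sum_abs _ _).trans (Finset.sum_le_sum fun j _ => h2 j)

/-- A component of the Duhamel formula is smooth and solves the heat equation. -/
theorem contDiffOn_duhamelSum (hv : HeatIntegrable v) (hG : ∀ j, IsDuhamelSource T b (K j) (G j)) :
    ContDiffOn ℝ ∞ (duhamelSum v G) (Ioo 0 T ×ˢ univ) ∧
      ∀ p ∈ Ioo 0 T ×ˢ univ, heatOp 1 (duhamelSum v G) p = divergenceSum G p := by
  have hterm := fun j => (hG j).continuousOn_duhamelTerm (EuclideanSpace.single j 1)
  have hD := fun j => (hG j).contDiffOn.spaceDeriv isOpen_timeSlab (EuclideanSpace.single j 1)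
  refine contDiffOn_of_weak_solution isOpen_timeSlab ?_ ?_ fun φ hφ hc hs => ?_
  · exact (hv.continuousOn_heatSemigroup.mono (prod_mono Ioo_subset_Ioi_self subset_rfl)).add
      (continuousOn_finsetSum _ fun j _ => hterm j)
  · exact ContDiffOn.sum fun j _ => hD j
  · obtain ⟨h1, h2⟩ := integral_heatSemigroup_mul_heatOp_eq_zero hv hφ hc hs
    have hψs := (tsupport_heatOp_subset (-1) φ).trans hs
    have h3 : ∀ j, Integrable fun p : ℝ × Space d =>
        duhamelTerm (EuclideanSpace.single j 1) (G j) p.1 p.2 * heatOp (-1) φ p := fun j =>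
      integrable_mul_of_tsupport_subset isOpen_timeSlab (hterm j) (hφ.heatOp (-1)).continuous
        (hc.heatOp (-1)) hψs
    have h4 : ∀ j, Integrable fun p : ℝ × Space d =>
        spaceDeriv (EuclideanSpace.single j 1) (fun p => G j p.1 p.2) p * φ p := fun j =>
      integrable_mul_of_tsupport_subset isOpen_timeSlab (hD j).continuousOn hφ.continuous hc hs
    simp only [duhamelSum, divergenceSum, add_mul, Finset.sum_mul]
    rw [integral_add h1 (integrable_finsetSum _ fun j _ => h3 j), h2, zero_add,
      integral_finsetSum _ fun j _ => h3 j, integral_finsetSum _ fun j _ => h4 j]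
    exact Finset.sum_congr rfl fun j _ => (hG j).integral_duhamelTerm_mul_heatOp _ hφ hc hs

lemma analyticAt_duhamelSum (hv : HeatIntegrable v) (hG : ∀ j, IsDuhamelSource T b (K j) (G j))
    (hA : ∀ j, SpaceAnalytic T (G j)) {t : ℝ} (ht : t ∈ Ioo 0 T) (x : Space d) :
    AnalyticAt ℝ (fun x => duhamelSum v G (t, x)) x := by
  obtain ⟨h1, h2⟩ := contDiffOn_duhamelSum hv hG
  obtain ⟨C₀, R, h3⟩ := exists_divergenceSum_cauchy_estimate (fun j => (hG j).contDiffOn) hA ht x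
  exact analyticAt_slice_of_heat_equation isOpen_Ioo h1 h2 ht x h3

lemma tendsto_integral_duhamelSum_mul (hT : 0 < T) (hv : HeatIntegrable v)
    (hG : ∀ j, IsDuhamelSource T b (K j) (G j)) {φ : Space d → ℝ} (hφ : ContDiff ℝ ∞ φ)
    (hc : HasCompactSupport φ) :
    Tendsto (fun t => ∫ x, duhamelSum v G (t, x) * φ x) (𝓝[>] 0) (𝓝 (∫ x, v x * φ x)) := by
  have h1 := (hv.tendsto_integral_heatSemigroup_mul hφ.continuous hc).add
    (tendsto_finsetSum Finset.univ fun j _ =>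
      (hG j).tendsto_integral_duhamelTerm_mul hT (EuclideanSpace.single j 1) hφ hc)
  rw [Finset.sum_const_zero, add_zero] at h1
  refine h1.congr' ?_
  filter_upwards [Ioo_mem_nhdsGT hT] with t ht
  have hint : ∀ {w : Space d → ℝ}, Continuous w → Integrable fun x => w x * φ x := fun hw =>
    (hw.mul hφ.continuous).integrable_of_hasCompactSupport hc.mul_left
  have h2 := hint (hv.continuous_heatSemigroup ht.1)
  have h3 := fun j => hint (w := duhamelTerm (EuclideanSpace.single j 1) (G j) t)
    (((hG j).continuousOn_duhamelTerm _).comp_continuous (f := fun x => (t, x)) (by fun_prop)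
      fun x => ⟨ht, mem_univ _⟩)
  simp only [duhamelSum, add_mul, Finset.sum_mul]
  rw [integral_add h2 (integrable_finsetSum _ fun j _ => h3 j),
    integral_finsetSum _ fun j _ => h3 j]

/-- The bound that dictates the choice of the weight: `t^{-1/2}` dominates the growth of `e^{tΔ} v`
for `v` in `bmo`, and the Duhamel integral is controlled by the half-order integral of `b`. -/
lemma exists_abs_duhamelSum_le (hb : IsTimeDensity T b) (hv : MemLocalBMO v)
    (hG : ∀ j, IsDuhamelSource T b (K j) (G j)) :
    ∃ M, 0 ≤ M ∧ ∀ t ∈ Ioo 0 T, ∀ x, |duhamelSum v G (t, x)| ≤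
      M * (1 + (√t)⁻¹ + ∫ s in (0 : ℝ)..t, (√(t - s))⁻¹ * b s) := by
  obtain ⟨C, hC, h⟩ := exists_heatSemigroup_le d
  choose C' hC' h' using fun j => (hG j).exists_abs_duhamelTerm_le (EuclideanSpace.single j 1)
  have hB : localBMONorm v ≤ ENNReal.ofReal (localBMONorm v).toReal :=
    (ENNReal.ofReal_toReal hv.2.ne).ge
  have hM : 0 ≤ C * (localBMONorm v).toReal := by positivity
  have hS : 0 ≤ ∑ j, C' j := Finset.sum_nonneg fun j _ => hC' j
  refine ⟨C * (localBMONorm v).toReal + ∑ j, C' j, by positivity, fun t ht x => ?_⟩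
  have h1 := h v _ ENNReal.toReal_nonneg hv.1 hB t ht.1 x
  have h2 : |∑ j, duhamelTerm (EuclideanSpace.single j 1) (G j) t x| ≤
      (∑ j, C' j) * ∫ s in (0 : ℝ)..t, (√(t - s))⁻¹ * b s := by
    rw [Finset.sum_mul]
    exact (Finset.abs_sum_le_sum_abs _ _).trans (Finset.sum_le_sum fun j _ => h' j t ht x)
  have h3 : 0 ≤ (√t)⁻¹ := by positivity
  have h4 := hb.halfIntegral_nonneg ht
  refine (abs_add_le _ _).trans ((add_le_add h1 h2).trans ?_)
  nlinarith [mul_nonneg hM h4, mul_nonneg hS h3]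

end Components

/-! ### Assembling the vector-valued solution -/

section Assembly

variable {d : ℕ} {T : ℝ}

lemma MemLocalBMO.heatIntegrable {v : Space d → ℝ} (hv : MemLocalBMO v) : HeatIntegrable v :=
  (meanOscLE_of_localBMONorm_le hv.1 ENNReal.toReal_nonneg
    (ENNReal.ofReal_toReal hv.2.ne).ge).1.heatIntegrable

lemma MeanOscLE.const_mul {g : Space d → ℝ} {A : ℝ} (h : MeanOscLE g A) (c : ℝ) :
    MeanOscLE (fun x => c * g x) (|c| * A) := by
  refine ⟨fun x => ?_, fun x r hr => ?_⟩
  · obtain ⟨s, hs, h1⟩ := h.1 x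
    exact ⟨s, hs, h1.const_mul c⟩
  · have h1 : ⨍ z in Metric.ball x r, c * g z = c * ⨍ z in Metric.ball x r, g z := by
      rw [setAverage_eq, setAverage_eq, integral_const_mul, smul_eq_mul, smul_eq_mul]
      ring
    simp only [h1, ← mul_sub, abs_mul]
    rw [integral_const_mul, mul_assoc]
    exact mul_le_mul_of_nonneg_left (h.2 x r hr) (abs_nonneg c)

lemma IsTimeWeight.isTimeDensity_inv {a : ℝ → ℝ} (ha : IsTimeWeight T a) :
    IsTimeDensity T fun s => (a s)⁻¹ where
  continuousOn := ha.1.continuousOn.inv₀ fun t ht => (ha.2.1 t ht).ne'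
  nonneg t ht := (inv_pos.2 (ha.2.1 t ht)).le
  integrableOn := ha.2.2

/-- A tensor component with `a g` smooth and bounded in `BMO` is a Duhamel source for the density
`1 / a`. -/
lemma IsTimeWeight.exists_isDuhamelSource {a : ℝ → ℝ} (ha : IsTimeWeight T a)
    {g : ℝ → Space d → ℝ}
    (hg : ContDiffOn ℝ ∞ (fun p : ℝ × Space d => a p.1 * g p.1 p.2) (Ioo 0 T ×ˢ univ))
    (hbmo : (⨆ t ∈ Ioo 0 T, bmoSeminorm fun x => a t * g t x) < ⊤) :
    ∃ K, IsDuhamelSource T (fun s => (a s)⁻¹) K g := by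
  refine ⟨(⨆ t ∈ Ioo 0 T, bmoSeminorm fun x => a t * g t x).toReal, ha.isTimeDensity_inv,
    ENNReal.toReal_nonneg, ?_, fun s hs => ?_⟩
  · have h1 : ContDiffOn ℝ ∞ (fun p : ℝ × Space d => a p.1) (Ioo 0 T ×ˢ univ) :=
      ha.1.comp contDiffOn_fst fun p hp => hp.1
    refine ((h1.inv fun p hp => (ha.2.1 p.1 hp.1).ne').mul hg).congr fun p hp => ?_
    exact (inv_mul_cancel_left₀ (ha.2.1 p.1 hp.1).ne' _).symm
  · have hcont : Continuous fun x => a s * g s x :=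
      hg.continuousOn.comp_continuous (f := fun x => (s, x)) (by fun_prop)
        fun x => ⟨hs, mem_univ _⟩
    have h1 := meanOscLE_of_bmoSeminorm_le hcont.locallyIntegrable ENNReal.toReal_nonneg
      ((le_iSup₂ (f := fun t (_ : t ∈ Ioo 0 T) => bmoSeminorm fun x => a t * g t x) s hs).trans
        (ENNReal.ofReal_toReal hbmo.ne).ge)
    have h2 := h1.const_mul (a s)⁻¹
    rw [abs_of_pos (inv_pos.2 (ha.2.1 s hs)), mul_comm] at h2
    simpa only [inv_mul_cancel_left₀ (ha.2.1 s hs).ne'] using h2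

variable {b : ℝ → ℝ} {u₀ : Space d → Space d} {f : ℝ → Space d → Matrix (Fin d) (Fin d) ℝ}
  {K : Fin d → Fin d → ℝ}

lemma duhamel_apply (hf : ∀ i j, IsDuhamelSource T b (K i j) fun t x => f t x i j) {t : ℝ}
    (ht : t ∈ Ioo 0 T) (x : Space d) (i : Fin d) :
    duhamel u₀ f t x i = duhamelSum (fun y => u₀ y i) (fun j t x => f t x i j) (t, x) := by
  change heatSemigroup t (fun y => u₀ y i) x + _ = heatSemigroup t (fun y => u₀ y i) x + _
  congr 1
  exact intervalIntegral.integral_finsetSum fun j _ => (hf i j).intervalIntegrable _ ht x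

lemma duhamelWellDefined (hu : ∀ i, HeatIntegrable fun x => u₀ x i)
    (hf : ∀ i j, IsDuhamelSource T b (K i j) fun t x => f t x i j) :
    DuhamelWellDefined T u₀ f := by
  refine ⟨fun t ht x i => (hu i).integrable_heatKernel_mul ht.1 x,
    fun s hs τ hτ x i j => ((hf i j).meanOscLE s hs).heatIntegrable.integrable_heatKernel_mul hτ x,
    fun s hs τ hτ i j => ((hf i j).meanOscLE s hs).heatIntegrable.differentiable_heatSemigroup hτ,
    fun t ht x i j => (hf i j).intervalIntegrable _ ht x⟩

lemma contDiffOn_duhamel (hu : ∀ i, HeatIntegrable fun x => u₀ x i)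
    (hf : ∀ i j, IsDuhamelSource T b (K i j) fun t x => f t x i j) :
    ContDiffOn ℝ ∞ (fun p : ℝ × Space d => duhamel u₀ f p.1 p.2) (Ioo 0 T ×ˢ univ) :=
  contDiffOn_euclidean.2 fun i => (contDiffOn_duhamelSum (hu i) (hf i)).1.congr
    fun p hp => duhamel_apply hf hp.1 p.2 i

lemma solvesHeat_duhamel (hT : 0 < T) (hu : ∀ i, HeatIntegrable fun x => u₀ x i)
    (hf : ∀ i j, IsDuhamelSource T b (K i j) fun t x => f t x i j) :
    SolvesHeat T u₀ f (duhamel u₀ f) := by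
  have hC := contDiffOn_duhamel hu hf
  have hC2 : ∀ t ∈ Ioo 0 T, ContDiff ℝ 2 (duhamel u₀ f t) := fun t ht =>
    contDiff_infty.1 (contDiffOn_univ.1 (hC.comp (f := fun y => (t, y)) (by fun_prop)
      fun y _ => ⟨ht, mem_univ _⟩)) 2
  refine ⟨hC2, fun t ht x => ?_, fun i φ hφ hc => ?_⟩
  · have hcomp : ∀ i, HasDerivAt (fun τ => duhamel u₀ f τ x i)
        ((Laplacian.laplacian (duhamel u₀ f t) x + tensorDiv (f t) x) i) t := by
      intro i
      obtain ⟨h1, h2⟩ := contDiffOn_duhamelSum (hu i) (hf i)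
      have hp : (t, x) ∈ Ioo 0 T ×ˢ (univ : Set (Space d)) := ⟨ht, mem_univ _⟩
      have h3 := hasDerivAt_slice ((h1.differentiableOn (by simp)).differentiableAt
        (isOpen_timeSlab.mem_nhds hp))
      have h4 := h2 _ hp
      rw [heatOp_eq_laplacian (EuclideanSpace.basisFun (Fin d) ℝ) isOpen_timeSlab h1 1 hp,
        ← laplacian_slice (EuclideanSpace.basisFun (Fin d) ℝ) isOpen_timeSlab h1 hp] at h4
      have h5 : Laplacian.laplacian (fun y => duhamelSum (fun y => u₀ y i)
          (fun j t x => f t x i j) (t, y)) x = (Laplacian.laplacian (duhamel u₀ f t) x) i := by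
        have h6 := (hC2 t ht).contDiffAt.laplacian_CLM_comp_left (x := x)
          (l := (EuclideanSpace.proj i : Space d →L[ℝ] ℝ))
        have h7 : (fun y => duhamelSum (fun y => u₀ y i) (fun j t x => f t x i j) (t, y)) =
            (EuclideanSpace.proj i : Space d →L[ℝ] ℝ) ∘ duhamel u₀ f t :=
          funext fun y => (duhamel_apply hf ht y i).symm
        rw [h7, h6]
        rfl
      have h7 : divergenceSum (fun j t x => f t x i j) (t, x) = tensorDiv (f t) x i := by
        refine Finset.sum_congr rfl fun j _ => ?_
        exact (fderiv_slice (φ := fun p : ℝ × Space d => f p.1 p.2 i j) (p := (t, x))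
          (((hf i j).contDiffOn.differentiableOn (by simp)).differentiableAt
            (isOpen_timeSlab.mem_nhds hp)) _).symm
      have h8 : timeDeriv (duhamelSum (fun y => u₀ y i) (fun j t x => f t x i j)) (t, x) =
          (Laplacian.laplacian (duhamel u₀ f t) x + tensorDiv (f t) x) i := by
        rw [PiLp.add_apply, ← h5, ← h7, ← h4]
        ring
      rw [← h8]
      refine h3.congr_of_eventuallyEq ?_
      filter_upwards [isOpen_Ioo.mem_nhds ht] with τ hτ
      exact duhamel_apply hf hτ x i
    exact ((PiLp.continuousLinearEquiv 2 ℝ fun _ : Fin d => ℝ).symm :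
      (Fin d → ℝ) →L[ℝ] Space d).hasFDerivAt.comp_hasDerivAt t (hasDerivAt_pi.2 hcomp)
  · refine (tendsto_integral_duhamelSum_mul hT (hu i) (hf i) hφ hc).congr' ?_
    filter_upwards [Ioo_mem_nhdsGT hT] with t ht
    simp only [duhamel_apply hf ht]

lemma analyticOnNhd_duhamel (hu : ∀ i, HeatIntegrable fun x => u₀ x i)
    (hf : ∀ i j, IsDuhamelSource T b (K i j) fun t x => f t x i j)
    (hA : ∀ i j, SpaceAnalytic T fun t x => f t x i j) {t : ℝ} (ht : t ∈ Ioo 0 T) :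
    AnalyticOnNhd ℝ (duhamel u₀ f t) univ := by
  intro x _
  have h1 : AnalyticAt ℝ (fun y i => duhamel u₀ f t y i) x := AnalyticAt.pi fun i => by
    simp only [duhamel_apply hf ht]
    exact analyticAt_duhamelSum (hu i) (hf i) (hA i) ht x
  exact ((PiLp.continuousLinearEquiv 2 ℝ fun _ : Fin d => ℝ).symm :
    (Fin d → ℝ) →L[ℝ] Space d).analyticAt _ |>.comp h1

lemma norm_le_sum_abs (v : Space d) : ‖v‖ ≤ ∑ i, |v i| := by
  have h1 : v = ∑ i, v i • EuclideanSpace.single i (1 : ℝ) := by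
    simpa using ((EuclideanSpace.basisFun (Fin d) ℝ).sum_repr v).symm
  calc ‖v‖ = ‖∑ i, v i • EuclideanSpace.single i (1 : ℝ)‖ := by rw [← h1]
    _ ≤ ∑ i, ‖v i • EuclideanSpace.single i (1 : ℝ)‖ := norm_sum_le _ _
    _ = _ := by simp [norm_smul]

lemma exists_norm_duhamel_le (hb : IsTimeDensity T b) (hu : ∀ i, MemLocalBMO fun x => u₀ x i)
    (hf : ∀ i j, IsDuhamelSource T b (K i j) fun t x => f t x i j) :
    ∃ M, 0 ≤ M ∧ ∀ t ∈ Ioo 0 T, ∀ x, ‖duhamel u₀ f t x‖ ≤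
      M * (1 + (√t)⁻¹ + ∫ s in (0 : ℝ)..t, (√(t - s))⁻¹ * b s) := by
  choose M hM h using fun i => exists_abs_duhamelSum_le hb (hu i) (hf i)
  refine ⟨∑ i, M i, Finset.sum_nonneg fun i _ => hM i, fun t ht x => ?_⟩
  refine (norm_le_sum_abs _).trans ?_
  rw [Finset.sum_mul]
  refine Finset.sum_le_sum fun i _ => ?_
  rw [duhamel_apply hf ht]
  exact h i t ht x

end Assembly

theorem mainTheorem8 (d : ℕ) (T : ℝ) (hT : 0 < T) (a₀ : ℝ → ℝ) (ha₀ : IsTimeWeight T a₀) :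
    ∃ a₁ : ℝ → ℝ, IsTimeWeight T a₁ ∧
      ∀ (u₀ : Space d → Space d) (f : ℝ → Space d → Matrix (Fin d) (Fin d) ℝ),
        (∀ i, MemLocalBMO fun x => u₀ x i) →
        (∀ i j, ContDiffOn ℝ ∞ (fun p : ℝ × Space d => a₀ p.1 * f p.1 p.2 i j)
          (Ioo 0 T ×ˢ univ)) →
        (∀ i j, (⨆ t ∈ Ioo 0 T, bmoSeminorm fun x => a₀ t * f t x i j) < ⊤) →
        (∀ i j, SpaceAnalytic T fun t x => f t x i j) →
        DuhamelWellDefined T u₀ f ∧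
        SolvesHeat T u₀ f (duhamel u₀ f) ∧
        (∀ t ∈ Ioo 0 T, AnalyticOnNhd ℝ (duhamel u₀ f t) univ) ∧
        ContDiffOn ℝ ∞ (fun p : ℝ × Space d => a₁ p.1 • duhamel u₀ f p.1 p.2)
          (Ioo 0 T ×ˢ univ) ∧
        ∃ M : ℝ, ∀ t ∈ Ioo 0 T, ∀ x, ‖a₁ t • duhamel u₀ f t x‖ ≤ M := by
  have hb := ha₀.isTimeDensity_inv
  obtain ⟨a₁, ha₁, hle⟩ := hb.exists_isTimeWeight
  refine ⟨a₁, ha₁, fun u₀ f hu₀ hf hbmo hA => ?_⟩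
  choose K hK using fun i j => ha₀.exists_isDuhamelSource (hf i j) (hbmo i j)
  have hu := fun i => (hu₀ i).heatIntegrable
  refine ⟨duhamelWellDefined hu hK, solvesHeat_duhamel hT hu hK,
    fun t ht => analyticOnNhd_duhamel hu hK hA ht, ?_, ?_⟩
  · exact (ha₁.1.comp contDiffOn_fst fun p hp => hp.1).smul (contDiffOn_duhamel hu hK)
  · obtain ⟨M, hM0, hM⟩ := exists_norm_duhamel_le hb hu₀ hK
    refine ⟨M, fun t ht x => ?_⟩
    have ha := ha₁.2.1 t ht
    rw [norm_smul, Real.norm_of_nonneg ha.le]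
    calc a₁ t * ‖duhamel u₀ f t x‖
        ≤ a₁ t * (M * (1 + (√t)⁻¹ + ∫ s in (0 : ℝ)..t, (√(t - s))⁻¹ * (a₀ s)⁻¹)) :=
          mul_le_mul_of_nonneg_left (hM t ht x) ha.le
      _ = M * (a₁ t * (1 + (√t)⁻¹ + ∫ s in (0 : ℝ)..t, (√(t - s))⁻¹ * (a₀ s)⁻¹)) := by ring
      _ ≤ M * 1 := mul_le_mul_of_nonneg_left (hle t ht) hM0
      _ = M := mul_one M
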